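/- **Conventions.** Let $\pi$ be a finite groupoid with set of arrows $\pi_1$; for an arrow $i$ write $s(i),t(i)$ for its source and target, $-i=i^{-1}$, and $g\circ f$ for "first $f$, then $g$". Let $\pi^2$ be the double groupoid of commutative squares $\alpha$ of $\pi$ with left, right, top, bottom arrows $l,r,f,g$, so that $r\circ f=g\circ l$. Let $\beta\circ\alpha$ be the vertical composite ($\alpha$ above $\beta$), $\beta\bullet\alpha$ the horizontal composite ($\alpha$ left of $\beta$), $\mathrm{id}^\circ_f$ (top and bottom $f$, vertical sides identities) and $\mathrm{id}^\bullet_u$ (left and right $u$, horizontal sides identities) the identity squares, and $\iota(\alpha)$ the double inverse, with left, right, top, bottom arrows $r^{-1},l^{-1},g^{-1},f^{-1}$. Let $K$ be a commutative $\mathbb C$-algebra (for instance $\mathbb C$ or $\mathbb C[p]$). For $\pi^2$-graded $K$-modules put $(A\otimes_vB)_\gamma=\bigoplus_{\beta\circ\alpha=\gamma}A_\alpha\otimes B_\beta$ and $(A\otimes_hB)_\gamma=\bigoplus_{\beta\bullet\alpha=\gamma}A_\alpha\otimes B_\beta$, with units $I_v=\bigoplus_fK1_f$ ($1_f$ in degree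 $\mathrm{id}^\circ_f$) and $I_h=\bigoplus_uK1_u$ ($1_u$ in degree $\mathrm{id}^\bullet_u$). A *$\pi^2$-graded Hopf algebra* is a $\pi^2$-graded module $A$ with a unital algebra structure $\nabla\colon A\otimes_vA\to A$, $\eta\colon I_v\to A$ and a counital coalgebra structure $\Delta\colon A\to A\otimes_hA$, $\epsilon\colon A\to I_h$ such that $\Delta(ab)=\Delta(a)\Delta(b)$ (componentwise product, zero if the squares do not match); $\Delta\eta(1_f)=\sum_{f_2\circ f_1=f}\eta(1_{f_1})\otimes\eta(1_{f_2})$; $\epsilon(ab)=\epsilon(a)\epsilon(b)$, where $1_u1_{u'}=1_{u'\circ u}$ for composable arrows and $0$ otherwise; $\epsilon(\eta(1_f))=1_f\in I_h$ if $f$ is an identity arrow and $0$ otherwise; and with a bijective linear map $S$, $S(A_\alpha)\subset A_{\iota(\alpha)}$, $S(ab)=S(b)S(a)$, $S(\eta(1_f))=\eta(1_{f^{-1}})$, such that, products of components that do not match vertically being $0$, $$\nabla(\mathrm{id}\otimes S)\Delta(a)=\eta(\sigma'_s\epsilon(a)),\qquad \nabla(S\otimes\mathrm{id})\Delta(a)=\eta(\sigma'_t\epsilon(a)),$$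 where $\sigma'_s(1_u)=\sum_{f:\,s(f)=s(u)}1_f$ and $\sigma'_t(1_u)=\sum_{f:\,t(f)=t(u)}1_f$. **Data.** Let $V=\bigoplus_{i\in\pi_1}V_i$ be a finite dimensional $\pi$-graded complex vector space with a homogeneous basis $B$, $\deg x\in\pi_1$ for $x\in B$, with tensor products $(V\otimes W)_k=\bigoplus_{j\circ i=k}V_i\otimes W_j$. Fix $L\in\mathbb C\setminus\{0\}$ and $\lambda\in\mathbb C$. For each $\tau$ in the upper half-plane let $\omega=\omega(\tau)\colon V\otimes V\to\mathbf 1$ be an inner product (a nondegenerate graded bilinear form, so that $\omega_{x,y}=0$ unless $\deg y=(\deg x)^{-1}$), with dual $\sigma\colon\mathbf 1\to V\otimes V$, $\sigma(1)=\sum\sigma^{x,y}x\otimes y$, i.e. $(\mathrm{id}\otimes\omega)(\sigma\otimes\mathrm{id})=\mathrm{id}=(\omega\otimes\mathrm{id})(\mathrm{id}\otimes\sigma)$, and let $\check R(u)=\check R(u,\tau)\in\mathrm{End}(V\otimes V)$ be graded, meromorphic in $u\in\mathbb C$, and satisfy for generic $u,v$ $$\check R^{(23)}(u-v)\check R^{(12)}(u)\check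 R^{(23)}(v)=\check R^{(12)}(v)\check R^{(23)}(u)\check R^{(12)}(u-v),\qquad \check R(u)\check R(-u)=\mathrm{id}.$$ Assume that $\check R$ is rotationally invariant with crossing parameter $\lambda$: for some scalar function $h$ (which may depend on $\tau$) and generic $u$, $$(\mathrm{id}\otimes\mathrm{id}\otimes\omega)(\mathrm{id}\otimes\check R(\lambda-u)\otimes\mathrm{id})(\sigma\otimes\mathrm{id}\otimes\mathrm{id})=h(u)\check R(u);$$ this holds in particular if $\check R$ is crossing symmetric. Assume that the matrix elements of $\check R$ have power series expansions, convergent for small arguments, in $z=e^{2\pi iu/L}$ and $w=e^{2\pi i(\tau-u/L)}$, and those of $\omega$ and $\sigma$ in $p=zw=e^{2\pi i\tau}$ (for instance, $\omega$ does not depend on $\tau$). **The algebra.** Let $A=A_{R,\omega}$ be the $\pi^2$-graded unital $K$-algebra with generators $T_{\alpha,x}^{\,y}[n,m]$ in degree $\alpha$, for $x,y\in B$, every square $\alpha$ with left arrow $\deg x$ and right arrow $\deg y$, and $n,m\ge0$, and $\xi^\pm_f[n,m]$ in degree $\mathrm{id}^\circ_f$, for $f\in\pi_1$ and $n,m\geq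 0$. Put $T_x^y[n,m]=\sum_\alpha T_{\alpha,x}^{\,y}[n,m]$, $T_x^y(u)=\sum_{n,m}T_x^y[n,m]z^nw^m$, $\xi^\pm_f(u)=\sum_{n,m}\xi^\pm_f[n,m]z^nw^m$, $\xi^\pm(u)=\sum_f\xi^\pm_f(u)$; replacing $u$ by $u+c$ means multiplying $z$ by $e^{2\pi ic/L}$ and $w$ by $e^{-2\pi ic/L}$. The relations are that all $\xi^\pm[n,m]$ are central, $\xi^\pm(u)\xi^\mp(u)=\eta(1)=\sum_f\eta(1_f)$, and, with $\check R(x\otimes y)=\sum_{k,l\in B}\check R_{xy}^{kl}\,k\otimes l$ for $x,y\in B$, $$\sum_{k',l'}\check R_{k'l'}^{kl}(u_1-u_2)T_x^{k'}(u_1)T_y^{l'}(u_2)=\sum_{x',y'}T_{x'}^k(u_2)T_{y'}^l(u_1)\check R_{xy}^{x'y'}(u_1-u_2),$$ $$\sum_{k,l}\omega_{k,l}T_x^k(u+\lambda)T_y^l(u)=\omega_{x,y}\sum_{f:\,s(f)=s(\deg x)}\xi^+_f(u),\qquad \sum_{x,y}T_x^k(u)T_y^l(u+\lambda)\sigma^{x,y}=\sigma^{k,l}\sum_{f:\,t(f)=s(\deg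 k)}\xi^+_f(u).$$ They are understood coefficientwise: the last two and $\xi^\pm\xi^\mp=\eta(1)$ as identities of formal power series in independent variables $z,w$ with $p=zw$; the first one in independent variables $z_1,z_2,w$, where functions of $u_1$, $u_2$, $u_1-u_2$ are obtained by substituting $(z_1z_2,w)$, $(z_2,z_1w)$, $(z_1,z_2w)$ for $(z,w)$. **Theorem.** $A_{R,\omega}$ is a $\pi^2$-graded Hopf algebra, with coproduct, counit and antipode given on generators by $$\Delta(T_x^y(u))=\sum_{k\in B}T_x^k(u)\otimes T_k^y(u),\qquad \Delta(\xi^\pm_f(u))=\sum_{f_2\circ f_1=f}\xi^\pm_{f_1}(u)\otimes\xi^\pm_{f_2}(u),$$ $$\epsilon(T_x^y(u))=\delta_{x,y}1_{\deg x},\qquad \epsilon(\xi^\pm_f(u))=1_f\ \text{if $f$ is an identity arrow, and $0$ otherwise},$$ $$S(T_x^y(u))=\xi^-(u-\lambda)\sum_{x',y'}\omega_{x,x'}T_{y'}^{x'}(u-\lambda)\sigma^{y',y},\qquad S(\xi^\pm_f(u))=\xi^\mp_{f^{-1}}(u).$$ -/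

import Mathlib

open CategoryTheory
open scoped TensorProduct

namespace RestrictedQuantum

/-! ### Arrows of a groupoid and its commutative squares -/

/-- The set of all arrows of a groupoid. -/
@[ext]
structure Arr (π : Type*) [Groupoid π] where
  src : π
  tgt : π
  hom : src ⟶ tgt

/-- `IsComp f g h`: the arrows `f` and `g` are composable (`f` first, then `g`), with
composite `h`. -/
inductive IsComp {π : Type*} [Groupoid π] : Arr π → Arr π → Arr π → Prop
  | mk {a b c : π} (f : a ⟶ b) (g : b ⟶ c) : IsComp ⟨a, b, f⟩ ⟨b, c, g⟩ ⟨a, c, f ≫ g⟩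

namespace Arr

/-- The identity arrow of an object. -/
def id {π : Type*} [Groupoid π] (a : π) : Arr π := ⟨a, a, 𝟙 a⟩

/-- The inverse arrow. -/
def inv {π : Type*} [Groupoid π] (f : Arr π) : Arr π := ⟨f.tgt, f.src, Groupoid.inv f.hom⟩

end Arr

theorem IsComp.inv {π : Type*} [Groupoid π] {f g h : Arr π} (H : IsComp f g h) :
    IsComp g.inv f.inv h.inv := by
  cases H with
  | mk f g =>
    have := IsComp.mk (Groupoid.inv g) (Groupoid.inv f)
    simpa [Arr.inv] using this

theorem IsComp.comp_id {π : Type*} [Groupoid π] (f : Arr π) : IsComp f (Arr.id f.tgt) f := by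
  have := IsComp.mk f.hom (𝟙 f.tgt)
  rwa [Category.comp_id] at this

theorem IsComp.id_comp {π : Type*} [Groupoid π] (f : Arr π) : IsComp (Arr.id f.src) f f := by
  have := IsComp.mk (𝟙 f.src) f.hom
  rwa [Category.id_comp] at this

/-- The commutative squares of `π`, i.e. the 2-cells of the double groupoid `π²`:
`left` and `right` are the vertical arrows, `top` and `bot` the horizontal ones. -/
@[ext]
structure Sq (π : Type*) [Groupoid π] where
  left : Arr π
  right : Arr π
  top : Arr π
  bot : Arr π
  comm : ∃ d, IsComp top right d ∧ IsComp left bot d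

namespace Sq

/-- The identity 2-cell of the vertical groupoid at a horizontal arrow `f`. -/
def idV {π : Type*} [Groupoid π] (f : Arr π) : Sq π :=
  ⟨Arr.id f.src, Arr.id f.tgt, f, f, f, IsComp.comp_id f, IsComp.id_comp f⟩

/-- The identity 2-cell of the horizontal groupoid at a vertical arrow `u`. -/
def idH {π : Type*} [Groupoid π] (u : Arr π) : Sq π :=
  ⟨u, u, Arr.id u.src, Arr.id u.tgt, u, IsComp.id_comp u, IsComp.comp_id u⟩

/-- The double inverse of a square (inverse for both compositions). -/
def iota {π : Type*} [Groupoid π] (α : Sq π) : Sq π where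
  left := α.right.inv
  right := α.left.inv
  top := α.bot.inv
  bot := α.top.inv
  comm := by
    obtain ⟨d, h₁, h₂⟩ := α.comm
    exact ⟨d.inv, h₂.inv, h₁.inv⟩

/-- `γ` is the vertical composite of `α` (above) and `β` (below). -/
def VComp {π : Type*} [Groupoid π] (α β γ : Sq π) : Prop :=
  α.bot = β.top ∧ γ.top = α.top ∧ γ.bot = β.bot ∧
    IsComp α.left β.left γ.left ∧ IsComp α.right β.right γ.right

/-- `γ` is the horizontal composite of `α` (on the left) and `β` (on the right). -/
def HComp {π : Type*} [Groupoid π] (α β γ : Sq π) : Prop :=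
  α.right = β.left ∧ γ.left = α.left ∧ γ.right = β.right ∧
    IsComp α.top β.top γ.top ∧ IsComp α.bot β.bot γ.bot

/-- The squares with left arrow `i` and right arrow `j`. -/
abbrev Between {π : Type*} [Groupoid π] (i j : Arr π) : Type _ :=
  {α : Sq π // α.left = i ∧ α.right = j}

end Sq

instance {π : Type*} [Groupoid π] [Finite π] [∀ a b : π, Finite (a ⟶ b)] : Finite (Arr π) :=
  Finite.of_injective (fun f : Arr π => (⟨f.src, f.tgt, f.hom⟩ : Σ a b : π, (a ⟶ b))) <| by
    rintro ⟨a, b, f⟩ ⟨a', b', f'⟩ h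
    simp only [Sigma.mk.injEq] at h
    obtain ⟨rfl, h⟩ := h
    simp only [heq_eq_eq, Sigma.mk.injEq] at h
    obtain ⟨rfl, h⟩ := h
    simp only [heq_eq_eq] at h
    rw [h]

instance {π : Type*} [Groupoid π] [Finite π] [∀ a b : π, Finite (a ⟶ b)] : Finite (Sq π) :=
  Finite.of_injective (fun α : Sq π => (α.left, α.right, α.top, α.bot)) <| by
    intro α β h
    simp only [Prod.mk.injEq] at h
    exact Sq.ext h.1 h.2.1 h.2.2.1 h.2.2.2

noncomputable instance {π : Type*} [Groupoid π] [Finite π] [∀ a b : π, Finite (a ⟶ b)] :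
    Fintype (Arr π) := Fintype.ofFinite _

noncomputable instance {π : Type*} [Groupoid π] [Finite π] [∀ a b : π, Finite (a ⟶ b)]
    (i j : Arr π) : Fintype (Sq.Between i j) := Fintype.ofFinite _

/-! ### `π²`-graded Hopf algebras

For a finite groupoid `π`, a `π²`-graded module `(A_α)` is written as the total module
`A = ⨁ A_α` with its homogeneous components `𝒜 α`.  The vertical product `A_α ⊗ A_β → A_{β∘α}` is
the multiplication of `A`, where products of components that are not vertically composable
vanish; `e f` is the unit in the component of the identity 2-cell of `f`, so `1 = ∑ e f`.
The horizontal unit `I_h` has a free rank one component at each `Sq.idH u` and is written as the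
module of functions `u ↦ φ u` on arrows. -/

open scoped Classical in
/-- A unital algebra for the vertical tensor product of `π²`-graded modules. -/
structure IsGradedAlgebra (K : Type*) {π A : Type*} [Groupoid π] [CommRing K] [Ring A]
    [Algebra K A] (𝒜 : Sq π → Submodule K A) (e : Arr π → A) : Prop where
  isInternal : DirectSum.IsInternal 𝒜
  mul_mem : ∀ α β γ, Sq.VComp α β γ → ∀ a ∈ 𝒜 α, ∀ b ∈ 𝒜 β, a * b ∈ 𝒜 γ
  mul_eq_zero : ∀ α β, α.bot ≠ β.top → ∀ a ∈ 𝒜 α, ∀ b ∈ 𝒜 β, a * b = 0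
  unit_mem : ∀ f, e f ∈ 𝒜 (Sq.idV f)
  unit_mul : ∀ α, ∀ a ∈ 𝒜 α, e α.top * a = a
  mul_unit : ∀ α, ∀ a ∈ 𝒜 α, a * e α.bot = a

/-- The component at `γ` of the horizontal tensor square, as a submodule of `A ⊗ A`. -/
def tensorH {K π A : Type*} [Groupoid π] [CommRing K] [Ring A] [Algebra K A]
    (𝒜 : Sq π → Submodule K A) (γ : Sq π) : Submodule K (A ⊗[K] A) :=
  ⨆ (α : Sq π) (β : Sq π) (_ : Sq.HComp α β γ),
    Submodule.map₂ (TensorProduct.mk K A A) (𝒜 α) (𝒜 β)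

/-- The map `φ ↦ ∑ φ u`.  On `I_h ⊗_h A` and on `A ⊗_h I_h`, tensoring with it is the unit
isomorphism to `A`, which sends `1_u ⊗ a` and `a ⊗ 1_u` to `a`. -/
noncomputable def sumArr (K π : Type*) [Groupoid π] [Finite π] [∀ a b : π, Finite (a ⟶ b)]
    [CommRing K] : (Arr π → K) →ₗ[K] K := ∑ u : Arr π, LinearMap.proj u

/-- A counital coalgebra for the horizontal tensor product of `π²`-graded modules. -/
structure IsGradedCoalgebra {K π A : Type*} [Groupoid π] [Finite π]
    [∀ a b : π, Finite (a ⟶ b)] [CommRing K] [Ring A] [Algebra K A]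
    (𝒜 : Sq π → Submodule K A) (Δ : A →ₗ[K] A ⊗[K] A) (ε : A →ₗ[K] (Arr π → K)) : Prop where
  comul_mem : ∀ γ, ∀ a ∈ 𝒜 γ, Δ a ∈ tensorH 𝒜 γ
  counit_mem : ∀ α, ∀ a ∈ 𝒜 α, ∀ u, α ≠ Sq.idH u → ε a u = 0
  coassoc : (TensorProduct.assoc K A A A).toLinearMap ∘ₗ Δ.rTensor A ∘ₗ Δ = Δ.lTensor A ∘ₗ Δ
  counit_left : (TensorProduct.lid K A).toLinearMap ∘ₗ (sumArr K π ∘ₗ ε).rTensor A ∘ₗ Δ =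
    LinearMap.id
  counit_right : (TensorProduct.rid K A).toLinearMap ∘ₗ (sumArr K π ∘ₗ ε).lTensor A ∘ₗ Δ =
    LinearMap.id

open scoped Classical in
/-- The map `σ : I_v → I_h` on the basis element `1_f`: it is `1_u` if `f = u` is an identity
arrow and `0` otherwise. -/
noncomputable def sigmaUnit (K : Type*) {π : Type*} [Groupoid π] [CommRing K] (f : Arr π) :
    Arr π → K :=
  fun u => if f = u ∧ ∃ a, f = Arr.id a then 1 else 0

open scoped Classical in
/-- A `π²`-graded Hopf algebra.  In the total algebra the interchange map
`(A ⊗_h A) ⊗_v (A ⊗_h A) → (A ⊗_v A) ⊗_h (A ⊗_v A)` followed by the products is the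
multiplication of `A ⊗ A`, and the projection `A ⊗ A → A ⊗_v A` followed by the product is the
multiplication of `A`. -/
structure IsGradedHopfAlgebra {K π A : Type*} [Groupoid π] [Finite π]
    [∀ a b : π, Finite (a ⟶ b)] [CommRing K] [Ring A] [Algebra K A]
    (𝒜 : Sq π → Submodule K A) (e : Arr π → A)
    (Δ : A →ₗ[K] A ⊗[K] A) (ε : A →ₗ[K] (Arr π → K)) (S : A →ₗ[K] A) : Prop where
  algebra : IsGradedAlgebra K 𝒜 e
  coalgebra : IsGradedCoalgebra 𝒜 Δ ε
  /-- The coproduct is compatible with products. -/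
  comul_mul : ∀ a b, Δ (a * b) = Δ a * Δ b
  /-- The coproduct is compatible with the unit. -/
  comul_unit : ∀ f, Δ (e f) =
    ∑ q : Arr π × Arr π with IsComp q.1 q.2 f, e q.1 ⊗ₜ[K] e q.2
  /-- The counit is compatible with products: `1_u · 1_v = 1_{v ∘ u}` in `I_h` for composable
  arrows, and `0` otherwise. -/
  counit_mul : ∀ a b w, ε (a * b) w =
    ∑ q : Arr π × Arr π with IsComp q.1 q.2 w, ε a q.1 * ε b q.2
  /-- The counit is compatible with the unit. -/
  counit_unit : ∀ f, ε (e f) = sigmaUnit K f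
  /-- The antipode is an isomorphism of `π²`-graded algebras from `A` to `A^op`. -/
  antipode_mem : ∀ α, ∀ a ∈ 𝒜 α, S a ∈ 𝒜 α.iota
  antipode_mul : ∀ a b, S (a * b) = S b * S a
  antipode_unit : ∀ f, S (e f) = e f.inv
  antipode_bijective : Function.Bijective S
  /-- The antipode axioms.  `1_u ∈ I_h` is sent to the sum of the units `1_f ∈ I_v` over all
  arrows `f` with the source (respectively, with the target) of `u`. -/
  mul_antipode_right : ∀ a, LinearMap.mul' K A (S.lTensor A (Δ a)) =
    ∑ u : Arr π, ε a u • ∑ f : Arr π with f.src = u.src, e f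
  mul_antipode_left : ∀ a, LinearMap.mul' K A (S.rTensor A (Δ a)) =
    ∑ u : Arr π, ε a u • ∑ f : Arr π with f.tgt = u.tgt, e f

/-! ### `R`-matrices

A finite dimensional `π`-graded vector space `V` is given by a finite homogeneous basis `B`,
with degrees `deg : B → Arr π`; so `V_i` has the basis `{x | deg x = i}` and `V ⊗ V` has as basis
the pairs `(x, y)` with composable degrees.  Endomorphisms of `V ⊗ V` are written as matrices with
entries `M (z, w) (x, y)`, the coefficient of `z ⊗ w` in the image of `x ⊗ y`, and are extended by
zero to pairs that are not composable. -/

/-- The degrees of `x` and `y` are composable. -/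
def Composable {π B : Type*} [Groupoid π] (deg : B → Arr π) (x y : B) : Prop :=
  (deg x).tgt = (deg y).src

/-- The operator `M^{(12)}` on triple tensors. -/
def op12 {B : Type*} [DecidableEq B] (M : Matrix (B × B) (B × B) ℂ) :
    Matrix (B × B × B) (B × B × B) ℂ :=
  fun a x => if a.2.2 = x.2.2 then M (a.1, a.2.1) (x.1, x.2.1) else 0

/-- The operator `M^{(23)}` on triple tensors. -/
def op23 {B : Type*} [DecidableEq B] (M : Matrix (B × B) (B × B) ℂ) :
    Matrix (B × B × B) (B × B × B) ℂ :=
  fun a x => if a.1 = x.1 then M a.2 x.2 else 0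

open scoped Classical in
/-- An `R`-matrix on `V`: a meromorphic function with values in the graded endomorphisms of
`V ⊗ V` that obeys the Yang-Baxter equation and the inversion relation for generic arguments. -/
structure IsRMatrix {π B : Type*} [Groupoid π] [Fintype B] [DecidableEq B] (deg : B → Arr π)
    (R : ℂ → Matrix (B × B) (B × B) ℂ) : Prop where
  meromorphic : ∀ i j, MeromorphicOn (fun u => R u i j) Set.univ
  graded : ∀ u z w x y, R u (z, w) (x, y) ≠ 0 →
    ∃ d, IsComp (deg x) (deg y) d ∧ IsComp (deg z) (deg w) d
  yangBaxter : ∀ᶠ v in Filter.codiscrete ℂ, ∀ᶠ u in Filter.codiscrete ℂ,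
    op23 (R (u - v)) * op12 (R u) * op23 (R v) = op12 (R v) * op23 (R u) * op12 (R (u - v))
  inversion : ∀ᶠ u in Filter.codiscrete ℂ, R u * R (-u) =
    Matrix.diagonal fun q : B × B => if Composable deg q.1 q.2 then 1 else 0

/-- An inner product on `V`, with `ω x y` the value at `x ⊗ y`: a nondegenerate graded map
`V ⊗ V → 𝟏`.  Its dual map `σ : 𝟏 → V ⊗ V`, determined by
`(id ⊗ ω)(σ ⊗ id) = id = (ω ⊗ id)(id ⊗ σ)`, has the inverse matrix `ω⁻¹` as coefficients. -/
structure IsInnerProduct {π B : Type*} [Groupoid π] [Fintype B] [DecidableEq B]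
    (deg : B → Arr π) (ω : Matrix B B ℂ) : Prop where
  graded : ∀ x y, ω x y ≠ 0 → deg y = (deg x).inv
  nondegenerate : IsUnit ω.det

/-- The rotation by 90 degrees, `(id ⊗ id ⊗ ω)(id ⊗ R(lam - u) ⊗ id)(σ ⊗ id ⊗ id)`. -/
noncomputable def rotation {B : Type*} [Fintype B] [DecidableEq B] (lam : ℂ) (ω : Matrix B B ℂ)
    (R : ℂ → Matrix (B × B) (B × B) ℂ) (u : ℂ) : Matrix (B × B) (B × B) ℂ :=
  fun a x => ∑ b, ∑ d, ω⁻¹ a.1 b * R (lam - u) (a.2, d) (b, x.1) * ω d x.2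

/-- Rotational invariance with crossing parameter `lam`. -/
def IsRotationallyInvariant {B : Type*} [Fintype B] [DecidableEq B] (lam : ℂ)
    (ω : Matrix B B ℂ) (R : ℂ → Matrix (B × B) (B × B) ℂ) : Prop :=
  ∃ f : ℂ → ℂ, ∀ᶠ u in Filter.codiscrete ℂ, rotation lam ω R u = f u • R u

/-- The entries of a family `R τ u` have the power series expansion `∑ r[n,m] zⁿ wᵐ` in
`z = exp(2πi u/L)` and `w = exp(2πi (τ - u/L))`, for small `z` and `w` (away from isolated
points `u`, where the value of a meromorphic function carries no information). -/
def HasExpansion {I : Type*} (L : ℂ) (R : UpperHalfPlane → ℂ → Matrix I I ℂ)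
    (r : ℕ → ℕ → Matrix I I ℂ) : Prop :=
  ∃ δ > 0, ∀ τ : UpperHalfPlane, ∀ᶠ u in Filter.codiscrete ℂ,
    ∀ z w : ℂ, z = Complex.exp (2 * Real.pi * Complex.I * u / L) →
      w = Complex.exp (2 * Real.pi * Complex.I * (τ - u / L)) → ‖z‖ < δ → ‖w‖ < δ →
      ∀ i j, HasSum (fun k : ℕ × ℕ => r k.1 k.2 i j * z ^ k.1 * w ^ k.2) (R τ u i j)

/-- The entries of a family `M τ` have the expansion `∑ c[k] pᵏ` in `p = exp(2πi τ)`, for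
small `p`. -/
def HasModularExpansion {I : Type*} (M : UpperHalfPlane → Matrix I I ℂ)
    (c : ℕ → Matrix I I ℂ) : Prop :=
  ∃ δ > 0, ∀ τ : UpperHalfPlane, ∀ p : ℂ, p = Complex.exp (2 * Real.pi * Complex.I * τ) →
    ‖p‖ < δ → ∀ i j, HasSum (fun k : ℕ => c k i j * p ^ k) (M τ i j)

/-! ### Generating series

A doubly indexed family `t[n,m]` stands for `t(u) = ∑ t[n,m] zⁿ wᵐ` with `z = exp(2πi u/L)` and
`w = p/z`. -/

/-- The series `t(u)` in the variables `(z, w)`. -/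
def ser {A : Type*} (t : ℕ → ℕ → A) : MvPowerSeries (Fin 2) A := fun d => t (d 0) (d 1)

/-- A series in `p = z w`. -/
def serP {A : Type*} [Zero A] (c : ℕ → A) : MvPowerSeries (Fin 2) A :=
  fun d => if d 0 = d 1 then c (d 0) else 0

/-- The coefficients of `t(u + c)`: `z` is multiplied by `exp(2πi c/L)` and `w` by its inverse. -/
noncomputable def shift (K : Type*) {A : Type*} [CommRing K] [Algebra ℂ K] [Ring A] [Algebra K A]
    (L c : ℂ) (t : ℕ → ℕ → A) : ℕ → ℕ → A :=
  fun n m =>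
    algebraMap ℂ K (Complex.exp (2 * Real.pi * Complex.I * c * ((n : ℂ) - (m : ℂ)) / L)) • t n m

/-- `t(u₁)` in the variables `(z₁, z₂, w)`, where `exp(2πi u₁/L) = z₁ z₂`,
`exp(2πi u₂/L) = z₂`, `p = z₁ z₂ w`: substitute `(z₁ z₂, w)` for `(z, w)`. -/
def serU₁ {A : Type*} [Zero A] (t : ℕ → ℕ → A) : MvPowerSeries (Fin 3) A :=
  fun d => if d 0 = d 1 then t (d 0) (d 2) else 0

/-- `t(u₂)` in the variables `(z₁, z₂, w)`: substitute `(z₂, z₁ w)` for `(z, w)`. -/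
def serU₂ {A : Type*} [Zero A] (t : ℕ → ℕ → A) : MvPowerSeries (Fin 3) A :=
  fun d => if d 0 = d 2 then t (d 1) (d 0) else 0

/-- `t(u₁ - u₂)` in the variables `(z₁, z₂, w)`: substitute `(z₁, z₂ w)` for `(z, w)`. -/
def serU₁₂ {A : Type*} [Zero A] (t : ℕ → ℕ → A) : MvPowerSeries (Fin 3) A :=
  fun d => if d 1 = d 2 then t (d 0) (d 1) else 0

/-- Complex numbers as scalars of a `K`-algebra. -/
def scal (K A : Type*) [CommRing K] [Algebra ℂ K] [Ring A] [Algebra K A] : ℂ →+* A :=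
  (algebraMap K A).comp (algebraMap ℂ K)

/-! ### The restricted quantum algebra of orthogonal type -/

/-- The generators: the units `e f`, the components at `Sq.idV f` of the central elements
`ξ⁺[n,m]` (sign `true`) and `ξ⁻[n,m]` (sign `false`), and the matrix elements `T_x^y[n,m]` in the
component of each square `α` with left arrow `deg x` and right arrow `deg y`. -/
inductive Gen {π B : Type*} [Groupoid π] (deg : B → Arr π)
  | e (f : Arr π)
  | xi (s : Bool) (f : Arr π) (n m : ℕ)
  | T (x y : B) (α : Sq.Between (deg x) (deg y)) (n m : ℕ)

/-- The square by which a generator is graded. -/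
def Gen.degree {π B : Type*} [Groupoid π] {deg : B → Arr π} : Gen deg → Sq π
  | .e f => Sq.idV f
  | .xi _ f _ _ => Sq.idV f
  | .T _ _ α _ _ => α.1

/-- The matrix element `T_x^y[n,m]` with all its homogeneous components, for generators placed in
an algebra by a map `g`. -/
noncomputable def matT {π B A : Type*} [Groupoid π] [Finite π] [∀ a b : π, Finite (a ⟶ b)] [Ring A]
    {deg : B → Arr π} (g : Gen deg → A) (x y : B) : ℕ → ℕ → A :=
  fun n m => ∑ α : Sq.Between (deg x) (deg y), g (.T x y α n m)

open scoped Classical in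
/-- The sum of the components `ξ^±_f[n,m]` over the arrows `f` with a property `P`. -/
noncomputable def xiOn {π B A : Type*} [Groupoid π] [Finite π] [∀ a b : π, Finite (a ⟶ b)] [Ring A]
    {deg : B → Arr π} (g : Gen deg → A) (s : Bool) (P : Arr π → Prop) : ℕ → ℕ → A :=
  fun n m => ∑ f : Arr π with P f, g (.xi s f n m)

/-- The element `ξ^±[n,m]`, with all its homogeneous components. -/
noncomputable def xiAll {π B A : Type*} [Groupoid π] [Finite π] [∀ a b : π, Finite (a ⟶ b)] [Ring A]
    {deg : B → Arr π} (g : Gen deg → A) (s : Bool) : ℕ → ℕ → A :=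
  xiOn g s fun _ => True

/-- The defining relations, for the coefficients `r` of the `R`-matrix, `ωc` of the inner product
and `σc` of its dual.  The first group says that generators multiply like elements of a
`π²`-graded unital algebra. -/
inductive Rel (K : Type*) {π B : Type*} [Groupoid π] [Finite π] [∀ a b : π, Finite (a ⟶ b)]
    [CommRing K] [Algebra ℂ K] [Fintype B] (deg : B → Arr π) (L lam : ℂ)
    (r : ℕ → ℕ → Matrix (B × B) (B × B) ℂ) (ωc σc : ℕ → Matrix B B ℂ) :
    FreeAlgebra K (Gen deg) → FreeAlgebra K (Gen deg) → Prop
  | unit_idem (f : Arr π) : Rel K deg L lam r ωc σc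
      (FreeAlgebra.ι K (.e f) * FreeAlgebra.ι K (.e f)) (FreeAlgebra.ι K (.e f))
  | unit_orth (f g : Arr π) (h : f ≠ g) : Rel K deg L lam r ωc σc
      (FreeAlgebra.ι K (.e f) * FreeAlgebra.ι K (.e g)) 0
  | unit_sum : Rel K deg L lam r ωc σc (∑ f : Arr π, FreeAlgebra.ι K (.e f)) 1
  | unit_mul (x : Gen deg) : Rel K deg L lam r ωc σc
      (FreeAlgebra.ι K (.e x.degree.top) * FreeAlgebra.ι K x) (FreeAlgebra.ι K x)
  | mul_unit (x : Gen deg) : Rel K deg L lam r ωc σc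
      (FreeAlgebra.ι K x * FreeAlgebra.ι K (.e x.degree.bot)) (FreeAlgebra.ι K x)
  /-- `ξ^±[n,m]` is central. -/
  | central (s : Bool) (n m : ℕ) (x : Gen deg) : Rel K deg L lam r ωc σc
      (xiAll (FreeAlgebra.ι K) s n m * FreeAlgebra.ι K x)
      (FreeAlgebra.ι K x * xiAll (FreeAlgebra.ι K) s n m)
  /-- `ξ^±(u) ξ^∓(u) = 1`. -/
  | xi_inv (s : Bool) (d : Fin 2 →₀ ℕ) : Rel K deg L lam r ωc σc
      (MvPowerSeries.coeff d
        (ser (xiAll (FreeAlgebra.ι K) s) * ser (xiAll (FreeAlgebra.ι K) (!s))))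
      (MvPowerSeries.coeff d 1)
  /-- `R^{(23)}(u₁-u₂) T^{(1)}(u₁) T^{(2)}(u₂) = T^{(1)}(u₂) T^{(2)}(u₁) R^{(12)}(u₁-u₂)`. -/
  | rtt (x y z w : B) (d : Fin 3 →₀ ℕ) : Rel K deg L lam r ωc σc
      (MvPowerSeries.coeff d (∑ z' : B, ∑ w' : B,
        serU₁₂ (fun n m => scal K _ (r n m (z, w) (z', w'))) *
          serU₁ (matT (FreeAlgebra.ι K) x z') * serU₂ (matT (FreeAlgebra.ι K) y w')))
      (MvPowerSeries.coeff d (∑ x' : B, ∑ y' : B,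
        serU₂ (matT (FreeAlgebra.ι K) x' z) * serU₁ (matT (FreeAlgebra.ι K) y' w) *
          serU₁₂ (fun n m => scal K _ (r n m (x', y') (x, y)))))
  /-- `ω^{(23)} T^{(1)}(u+λ) T^{(2)}(u) = ξ⁺(u) ω^{(12)}`. -/
  | omega (x y : B) (d : Fin 2 →₀ ℕ) : Rel K deg L lam r ωc σc
      (MvPowerSeries.coeff d (∑ z : B, ∑ w : B,
        serP (fun k => scal K _ (ωc k z w)) *
          ser (shift K L lam (matT (FreeAlgebra.ι K) x z)) * ser (matT (FreeAlgebra.ι K) y w)))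
      (MvPowerSeries.coeff d
        (ser (xiOn (FreeAlgebra.ι K) true fun f => f.src = (deg x).src) *
          serP (fun k => scal K _ (ωc k x y))))
  /-- `T^{(1)}(u) T^{(2)}(u+λ) σ^{(12)} = ξ⁺(u) σ^{(23)}`. -/
  | sigma (z w : B) (d : Fin 2 →₀ ℕ) : Rel K deg L lam r ωc σc
      (MvPowerSeries.coeff d (∑ x : B, ∑ y : B,
        ser (matT (FreeAlgebra.ι K) x z) * ser (shift K L lam (matT (FreeAlgebra.ι K) y w)) *
          serP (fun k => scal K _ (σc k x y))))
      (MvPowerSeries.coeff d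
        (ser (xiOn (FreeAlgebra.ι K) true fun f => f.tgt = (deg z).src) *
          serP (fun k => scal K _ (σc k z w))))

/-- The restricted quantum algebra of orthogonal type `A_{R,ω}`. -/
abbrev QAlg (K : Type*) {π B : Type*} [Groupoid π] [Finite π] [∀ a b : π, Finite (a ⟶ b)]
    [CommRing K] [Algebra ℂ K] [Fintype B] (deg : B → Arr π) (L lam : ℂ)
    (r : ℕ → ℕ → Matrix (B × B) (B × B) ℂ) (ωc σc : ℕ → Matrix B B ℂ) : Type _ :=
  RingQuot (Rel K deg L lam r ωc σc)

/-- The generators in `A_{R,ω}`. -/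
noncomputable def gen (K : Type*) {π B : Type*} [Groupoid π] [Finite π]
    [∀ a b : π, Finite (a ⟶ b)] [CommRing K] [Algebra ℂ K] [Fintype B] (deg : B → Arr π)
    (L lam : ℂ) (r : ℕ → ℕ → Matrix (B × B) (B × B) ℂ) (ωc σc : ℕ → Matrix B B ℂ)
    (x : Gen deg) : QAlg K deg L lam r ωc σc :=
  RingQuot.mkAlgHom K (Rel K deg L lam r ωc σc) (FreeAlgebra.ι K x)

/-- The vertically composable monomials in generators, with their degrees. -/
inductive IsMonomial {π A : Type*} [Groupoid π] [Ring A] {G : Type*} (g : G → A)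
    (degree : G → Sq π) : Sq π → A → Prop
  | gen (x : G) : IsMonomial g degree (degree x) (g x)
  | mul {α β γ : Sq π} {a b : A} (h : Sq.VComp α β γ) :
      IsMonomial g degree α a → IsMonomial g degree β b → IsMonomial g degree γ (a * b)

/-- The component of degree `α` of `A_{R,ω}`, spanned by the monomials of this degree. -/
def component (K : Type*) {π B : Type*} [Groupoid π] [Finite π]
    [∀ a b : π, Finite (a ⟶ b)] [CommRing K] [Algebra ℂ K] [Fintype B] (deg : B → Arr π)
    (L lam : ℂ) (r : ℕ → ℕ → Matrix (B × B) (B × B) ℂ) (ωc σc : ℕ → Matrix B B ℂ)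
    (α : Sq π) : Submodule K (QAlg K deg L lam r ωc σc) :=
  Submodule.span K {a | IsMonomial (gen K deg L lam r ωc σc) Gen.degree α a}

open scoped Classical in
/-- The values of the coproduct, the counit and the antipode on generators; the formulas for
matrix elements `T_x^y` collect all homogeneous components. -/
structure GeneratorFormulas {K π B A : Type*} [Groupoid π] [Finite π]
    [∀ a b : π, Finite (a ⟶ b)] [CommRing K] [Algebra ℂ K] [Fintype B] [Ring A] [Algebra K A]
    {deg : B → Arr π} (L lam : ℂ) (ωc σc : ℕ → Matrix B B ℂ) (g : Gen deg → A)
    (Δ : A →ₗ[K] A ⊗[K] A) (ε : A →ₗ[K] (Arr π → K)) (S : A →ₗ[K] A) : Prop where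
  /-- `Δ(T_x^y(u)) = ∑ T_x^z(u) ⊗ T_z^y(u)`. -/
  comul_T : ∀ x y n m, Δ (matT g x y n m) =
    ∑ z : B, ∑ a ∈ Finset.HasAntidiagonal.antidiagonal n, ∑ b ∈ Finset.HasAntidiagonal.antidiagonal m,
      matT g x z a.1 b.1 ⊗ₜ[K] matT g z y a.2 b.2
  /-- `Δ(ξ^±(u)) = ξ^±(u) ⊗_h ξ^±(u)`. -/
  comul_xi : ∀ s f n m, Δ (g (.xi s f n m)) =
    ∑ q : Arr π × Arr π with IsComp q.1 q.2 f,
      ∑ a ∈ Finset.HasAntidiagonal.antidiagonal n, ∑ b ∈ Finset.HasAntidiagonal.antidiagonal m,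
        g (.xi s q.1 a.1 b.1) ⊗ₜ[K] g (.xi s q.2 a.2 b.2)
  /-- `ε(T_x^y(u)) = δ_{xy}`, in the component of `I_h` of the arrow `deg x`. -/
  counit_T : ∀ x y n m u, ε (matT g x y n m) u =
    if x = y ∧ u = deg x ∧ n = 0 ∧ m = 0 then 1 else 0
  /-- `ε(ξ^±(u)) = 1`. -/
  counit_xi : ∀ s f n m, ε (g (.xi s f n m)) = if n = 0 ∧ m = 0 then sigmaUnit K f else 0
  /-- `S(T_x^y(u)) = ξ⁻(u-λ) ∑ ω_{x,x'} T_{y'}^{x'}(u-λ) σ^{y',y}`. -/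
  antipode_T : ∀ x y (d : Fin 2 →₀ ℕ), S (matT g x y (d 0) (d 1)) =
    MvPowerSeries.coeff d (∑ x' : B, ∑ y' : B,
      ser (shift K L (-lam) (xiAll g false)) * serP (fun k => scal K A (ωc k x x')) *
        ser (shift K L (-lam) (matT g y' x')) * serP (fun k => scal K A (σc k y' y)))
  /-- `S(ξ^±(u)) = ξ^∓(u)`. -/
  antipode_xi : ∀ s f n m, S (g (.xi s f n m)) = g (.xi (!s) f.inv n m)

end RestrictedQuantum

/-!
The algebra `A_{R,ω}` is given by generators and relations, so `Δ`, `ε` and `S` are obtained from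
its universal property.  A representation (`IsRep`) consists of elements `E f`, `X^±[n,m]` and
`T_x^y[n,m]` of an algebra that obey the relations, where `∑ E f` is only required to be a unit for
these elements.  Every representation extends to a multiplicative, in general not unital,
homomorphism on `A_{R,ω}` (`IsRep.exists_hom'`).  The weaker condition on `∑ E f` is needed for the
coproduct, since `Δ(1)` is the sum of `e f ⊗ e g` over composable arrows only.  The relations are
identities between matrices over rings of formal power series: with `T = T(u)`, the relations for
`ω` and `σ` are formulas for `T(u+λ) ω T(u)ᵗ` and `T(u)ᵗ σ T(u+λ)`.

* The coproduct: two commuting copies of a representation can be multiplied (`IsRep.conv`); this is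
  applied to the two copies of `A` in `A ⊗ A`.  Coassociativity is checked on generators.
* The counit: the values of `ε` on generators form a representation in the convolution algebra of
  `π` (`isRep_counit`), because `R`, `ω` and `σ` preserve degrees.  The coefficients of the
  expansions inherit this property, as well as the identities `ω σ = 1 = σ ω`, because convergent
  power series that agree near zero have equal coefficients (`HasExpansion.coeff_eq_zero`,
  `HasModularExpansion.coeff_eq_zero`, `HasModularExpansion.cauchyProduct_eq_one`).
* The antipode: the relations for `ω` and `σ` say that `ξ⁻(u-λ) ω T(u-λ)ᵗ σ` is a two-sided inverse
  of the matrix `T(u)`, up to idempotents (`IsRep.serT_mul_antiT`, `IsRep.antiT_mul_serT`).  The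
  entries of the inverse matrix satisfy the exchange relation in the opposite algebra, since one may
  invert both sides of it (`intertwine_inverse`).  Hence they form a representation there
  (`IsRep.isRep_antiT`), which is the antipode.  The matrix `ξ⁻(u) ωᵗ T(u+λ)ᵗ σᵗ` is inverse to
  `T(u)` for the opposite product of entries and leads in the same way to the inverse of the antipode
  (`IsRep.isRep_antiInvT`, `bijective_of_isAnti`).

The components `A_α` span `A` since products of components lie in components.  That their sum is
direct is not apparent from the relations.  It follows from the Hopf structure: on `A_α`, the map
`(ε ⊗ id) Δ` is `a ↦ 1_u ⊗ a` with `u` the left arrow of `α`, and `(id ⊗ ε) Δ` detects the right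
arrow in the same way, while multiplication by the idempotents `e f` detects the top and bottom
arrows; so there is a projection to each component (`exists_proj_component`).

The antipode axioms are not multiplicative in `a` as they stand.  They become so when the idempotent
of all arrows with a given source (or target) is inserted between the two factors: `x ⊗ y` acts on
`z` by `x z S(y)`, which is an action of the algebra `A ⊗ A` (`mulRightAnti_mul`), and so the refined
axiom holds for a product if it holds for its factors (`IsAnti.mul_right_unit`,
`IsAnti.mul_left_unit`).  On the generators `T_x^y(u)` it says that `S(T(u))` is the inverse matrix.
-/

set_option linter.unusedSectionVars false

/-! ### Uniqueness of convergent power series -/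

open Filter Topology in
/-- The values at `0` are not needed: by the identity theorem a power series that vanishes near `0`
away from `0` is zero. -/
theorem eq_zero_of_hasSum_pow_zero {c : ℕ → ℂ} {δ : ℝ} (hδ : 0 < δ)
    (h : ∀ p : ℂ, p ≠ 0 → ‖p‖ < δ → HasSum (fun k => c k * p ^ k) 0) : c = 0 := by
  set q := FormalMultilinearSeries.ofScalars ℂ c with hq
  have hpos : (0 : ℝ) < δ / 2 := by positivity
  have hrad : ((δ / 2).toNNReal : ENNReal) ≤ q.radius := by
    apply q.le_radius_of_summable
    have hs := (h ((δ / 2 : ℝ) : ℂ) (by exact_mod_cast hpos.ne')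
      (by rw [Complex.norm_real, Real.norm_of_nonneg hpos.le]; linarith)).summable.norm
    refine hs.congr fun n => ?_
    rw [hq, FormalMultilinearSeries.ofScalars_norm, norm_mul, norm_pow, Complex.norm_real,
      Real.norm_of_nonneg hpos.le, Real.coe_toNNReal _ hpos.le]
  have hball : HasFPowerSeriesOnBall q.sum q 0 q.radius :=
    q.hasFPowerSeriesOnBall (lt_of_lt_of_le (by simpa using hpos) hrad)
  have hzero : ∀ᶠ z in 𝓝[≠] (0 : ℂ), q.sum z = 0 := by
    rw [eventually_nhdsWithin_iff]
    filter_upwards [Metric.ball_mem_nhds (0 : ℂ) hδ] with z hz hz0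
    have := (h z hz0 (by simpa using hz)).tsum_eq
    rw [← this]
    refine tsum_congr fun n => ?_
    simp [hq, mul_comm]
  have hev := (hball.analyticAt.frequently_zero_iff_eventually_zero).1 hzero.frequently
  have h0 : q = 0 := (hball.hasFPowerSeriesAt.congr hev).eq_zero
  exact (FormalMultilinearSeries.ofScalars_series_eq_zero ℂ).1 h0

/-- Summing over the second exponent first reduces the case of two variables to that of one
variable, applied in `z` and then in `w`. -/
theorem eq_zero_of_hasSum_mul_pow_zero {r : ℕ → ℕ → ℂ} {δ : ℝ} (hδ : 0 < δ)
    (h : ∀ z w : ℂ, z ≠ 0 → w ≠ 0 → ‖z‖ < δ → ‖w‖ < δ →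
      HasSum (fun k : ℕ × ℕ => r k.1 k.2 * z ^ k.1 * w ^ k.2) 0) (n m : ℕ) : r n m = 0 := by
  obtain ⟨z₀, hz₀, hz₀'⟩ : ∃ z : ℂ, z ≠ 0 ∧ ‖z‖ < δ :=
    ⟨((δ / 2 : ℝ) : ℂ), by exact_mod_cast (half_pos hδ).ne', by
      rw [Complex.norm_real, Real.norm_of_nonneg (half_pos hδ).le]; linarith⟩
  have hsum : ∀ w : ℂ, w ≠ 0 → ‖w‖ < δ → ∀ n, Summable fun m => r n m * w ^ m := by
    intro w hw hw' n
    have := (h z₀ w hz₀ hw hz₀' hw').summable.prod_factor n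
    refine ((this.mul_left ((z₀ ^ n)⁻¹))).congr fun m => ?_
    simp only
    field_simp
  have key : ∀ w : ℂ, w ≠ 0 → ‖w‖ < δ → (fun n => ∑' m, r n m * w ^ m) = 0 := by
    intro w hw hw'
    refine eq_zero_of_hasSum_pow_zero hδ fun z hz hz' => ?_
    refine (h z w hz hw hz' hw').prod_fiberwise fun n => ?_
    have := ((hsum w hw hw' n).hasSum).mul_right (z ^ n)
    exact this.congr_fun fun m => by ring
  have := eq_zero_of_hasSum_pow_zero hδ (c := r n) fun w hw hw' => by
    have h1 := congrFun (key w hw hw') n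
    have h2 := (hsum w hw hw' n).hasSum
    rwa [h1] at h2
  exact congrFun this m

open Filter Topology in
theorem eventually_nhdsNE_of_codiscrete {p : ℂ → Prop} (h : ∀ᶠ u in codiscrete ℂ, p u) (u₀ : ℂ) :
    ∀ᶠ u in 𝓝[≠] u₀, p u := by
  have := mem_codiscrete.1 h u₀
  rwa [disjoint_principal_right, compl_compl] at this

namespace RestrictedQuantum

/-- Nome coordinates: every pair of nonzero numbers `z, w` of norm less than one arises from a
modular parameter `τ` and a spectral parameter `u`. -/
theorem exists_nome {L z w : ℂ} (hL : L ≠ 0) (hz : z ≠ 0) (hw : w ≠ 0) (hz' : ‖z‖ < 1)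
    (hw' : ‖w‖ < 1) : ∃ (τ : UpperHalfPlane) (u : ℂ),
      Complex.exp (2 * Real.pi * Complex.I * u / L) = z ∧
      Complex.exp (2 * Real.pi * Complex.I * (τ - u / L)) = w := by
  have hpi : (Real.pi : ℂ) ≠ 0 := by exact_mod_cast Real.pi_ne_zero
  set t : ℂ := (Complex.log z + Complex.log w) / (2 * Real.pi * Complex.I) with ht
  have him : 0 < t.im := by
    have h1 : t = ((-(Complex.log z + Complex.log w).re / (2 * Real.pi) : ℝ) : ℂ) * Complex.I +
        (((Complex.log z + Complex.log w).im / (2 * Real.pi) : ℝ) : ℂ) := by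
      rw [ht, div_eq_iff (by simp [hpi])]
      conv_lhs => rw [← Complex.re_add_im (Complex.log z + Complex.log w)]
      push_cast
      field_simp
      linear_combination ((Complex.log z + Complex.log w).re : ℂ) * Complex.I_sq
    rw [h1]
    simp only [Complex.add_im, Complex.mul_im, Complex.ofReal_re, Complex.I_im, Complex.ofReal_im,
      Complex.add_re, Complex.log_re]
    have := Real.log_neg (norm_pos_iff.2 hz) hz'
    have := Real.log_neg (norm_pos_iff.2 hw) hw'
    have : 0 < -(Real.log ‖z‖ + Real.log ‖w‖) / (2 * Real.pi) := by
      apply div_pos <;> linarith [Real.pi_pos]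
    simpa using this
  refine ⟨⟨t, him⟩, L * Complex.log z / (2 * Real.pi * Complex.I), ?_, ?_⟩
  · rw [show 2 * Real.pi * Complex.I * (L * Complex.log z / (2 * Real.pi * Complex.I)) / L =
      Complex.log z by field_simp, Complex.exp_log hz]
  · rw [show 2 * Real.pi * Complex.I * (((⟨t, him⟩ : UpperHalfPlane) : ℂ) -
      L * Complex.log z / (2 * Real.pi * Complex.I) / L) = Complex.log w by
        change 2 * Real.pi * Complex.I * (t - _) = _
        rw [ht]; field_simp; ring, Complex.exp_log hw]

open Filter Topology in
/-- If an entry of a family vanishes identically, so do the coefficients of its expansion. -/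
theorem HasExpansion.coeff_eq_zero {I : Type*} {L : ℂ} (hL : L ≠ 0)
    {R : UpperHalfPlane → ℂ → Matrix I I ℂ} {r : ℕ → ℕ → Matrix I I ℂ} (hr : HasExpansion L R r)
    {i j : I} (h0 : ∀ τ u, R τ u i j = 0) (n m : ℕ) : r n m i j = 0 := by
  obtain ⟨δ, hδ, hr⟩ := hr
  set Z : ℂ → ℂ := fun u => Complex.exp (2 * Real.pi * Complex.I * u / L)
  set W : UpperHalfPlane → ℂ → ℂ := fun τ u =>
    Complex.exp (2 * Real.pi * Complex.I * (τ - u / L))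
  have hZ : Continuous Z := by fun_prop
  have hW : ∀ τ, Continuous (W τ) := fun τ => by fun_prop
  refine eq_zero_of_hasSum_mul_pow_zero (r := fun n m => r n m i j) (δ := min δ 1) (by positivity)
    (fun z₁ w₁ hz₁ hw₁ hz₁' hw₁' => ?_) n m
  -- a point of absolute convergence beyond `(z₁, w₁)`
  obtain ⟨ρ, hρ, hρ'⟩ := exists_between (max_lt hz₁' hw₁')
  have hρ0 : 0 < ρ := lt_of_le_of_lt (le_max_of_le_left (norm_nonneg z₁)) hρ
  have hρn : ‖(ρ : ℂ)‖ = ρ := by rw [Complex.norm_real, Real.norm_of_nonneg hρ0.le]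
  have hρ1 : ρ < 1 := lt_of_lt_of_le hρ' (min_le_right _ _)
  have hρδ : ρ < δ := lt_of_lt_of_le hρ' (min_le_left _ _)
  obtain ⟨τ₀, u₀, hu₀, hu₀'⟩ := exists_nome (z := (ρ : ℂ)) (w := (ρ : ℂ)) hL
    (by exact_mod_cast hρ0.ne') (by exact_mod_cast hρ0.ne') (by rwa [hρn]) (by rwa [hρn])
  have hnhds : ∀ (f : ℂ → ℂ) (a b : ℝ) (v : ℂ), Continuous f → a < ‖f v‖ → ‖f v‖ < b →
      ∀ᶠ u in 𝓝[≠] v, a < ‖f u‖ ∧ ‖f u‖ < b := fun f a b v hf h1 h2 =>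
    (hf.norm.continuousAt.eventually (Ioo_mem_nhds h1 h2)).filter_mono nhdsWithin_le_nhds
  obtain ⟨u₂, ⟨h1, h1'⟩, ⟨h2, h2'⟩, h3⟩ := ((hnhds Z (max ‖z₁‖ ‖w₁‖) δ u₀ hZ
    (by simp only [Z]; rwa [hu₀, hρn]) (by simp only [Z]; rwa [hu₀, hρn])).and
    ((hnhds (W τ₀) (max ‖z₁‖ ‖w₁‖) δ u₀ (hW _)
    (by simp only [W]; rwa [hu₀', hρn]) (by simp only [W]; rwa [hu₀', hρn])).and
    (eventually_nhdsNE_of_codiscrete (hr τ₀) u₀))).exists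
  have hsum := (h3 (Z u₂) (W τ₀ u₂) rfl rfl h1' h2' i j).summable.norm
  set a := ‖Z u₂‖
  set b := ‖W τ₀ u₂‖
  set F : ℂ × ℂ → ℂ := fun q => ∑' k : ℕ × ℕ, r k.1 k.2 i j * q.1 ^ k.1 * q.2 ^ k.2
  have hbound : ∀ (k : ℕ × ℕ) (q : ℂ × ℂ), q ∈ Metric.ball (0 : ℂ) a ×ˢ Metric.ball (0 : ℂ) b →
      ‖r k.1 k.2 i j * q.1 ^ k.1 * q.2 ^ k.2‖ ≤
        ‖r k.1 k.2 i j * Z u₂ ^ k.1 * W τ₀ u₂ ^ k.2‖ := by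
    rintro k ⟨x, y⟩ ⟨hx, hy⟩
    simp only [mem_ball_zero_iff] at hx hy
    simp only [norm_mul, norm_pow]
    gcongr
  have hcont : ContinuousOn F (Metric.ball (0 : ℂ) a ×ˢ Metric.ball (0 : ℂ) b) :=
    continuousOn_tsum (fun k => by fun_prop) hsum hbound
  have hmem : (z₁, w₁) ∈ Metric.ball (0 : ℂ) a ×ˢ Metric.ball (0 : ℂ) b := by
    simp only [Set.mem_prod, mem_ball_zero_iff]
    exact ⟨lt_of_le_of_lt (le_max_left _ _) h1, lt_of_le_of_lt (le_max_right _ _) h2⟩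
  have hat : ContinuousAt F (z₁, w₁) :=
    hcont.continuousAt ((Metric.isOpen_ball.prod Metric.isOpen_ball).mem_nhds hmem)
  obtain ⟨τ₁, u₁, hu₁, hu₁'⟩ := exists_nome hL hz₁ hw₁ (lt_of_lt_of_le hz₁' (min_le_right _ _))
    (lt_of_lt_of_le hw₁' (min_le_right _ _))
  have hF : F (z₁, w₁) = 0 := by
    have hlim : Tendsto (fun u => F (Z u, W τ₁ u)) (𝓝[≠] u₁) (𝓝 (F (z₁, w₁))) := by
      have hc : Continuous fun u => (Z u, W τ₁ u) := hZ.prodMk (hW τ₁)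
      have hval : (Z u₁, W τ₁ u₁) = (z₁, w₁) := by simp only [Z, W, hu₁, hu₁']
      rw [← hval] at hat ⊢
      exact (ContinuousAt.comp (f := fun u => (Z u, W τ₁ u)) hat hc.continuousAt).tendsto.mono_left
        nhdsWithin_le_nhds
    refine tendsto_nhds_unique_of_eventuallyEq hlim tendsto_const_nhds ?_
    filter_upwards [eventually_nhdsNE_of_codiscrete (hr τ₁) u₁,
      hnhds Z (-1) δ u₁ hZ (by linarith [norm_nonneg (Z u₁)])
        (by simp only [Z]; rw [hu₁]; exact lt_of_lt_of_le hz₁' (min_le_left _ _)),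
      hnhds (W τ₁) (-1) δ u₁ (hW _) (by linarith [norm_nonneg (W τ₁ u₁)])
        (by simp only [W]; rw [hu₁']; exact lt_of_lt_of_le hw₁' (min_le_left _ _))] with u hu hu' hu''
    have := hu (Z u) (W τ₁ u) rfl rfl hu'.2 hu''.2 i j
    rw [h0] at this
    exact this.tsum_eq
  rw [← hF]
  exact (Summable.of_norm_bounded hsum fun k => hbound k _ hmem).hasSum

/-- Every nonzero `p` of norm less than one is a nome. -/
theorem exists_modular_nome {p : ℂ} (hp : p ≠ 0) (hp' : ‖p‖ < 1) :
    ∃ τ : UpperHalfPlane, Complex.exp (2 * Real.pi * Complex.I * τ) = p := by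
  obtain ⟨τ, u, h1, h2⟩ := exists_nome (L := 1) (z := ((Real.sqrt ‖p‖ : ℝ) : ℂ))
    (w := p / ((Real.sqrt ‖p‖ : ℝ) : ℂ)) one_ne_zero
    (by simpa using hp) (div_ne_zero hp (by simpa using hp))
    (by
      rw [Complex.norm_real, Real.norm_of_nonneg (Real.sqrt_nonneg _)]
      rw [Real.sqrt_lt' one_pos]; simpa using hp')
    (by
      rw [norm_div, Complex.norm_real, Real.norm_of_nonneg (Real.sqrt_nonneg _), Real.div_sqrt]
      rw [Real.sqrt_lt' one_pos]; simpa using hp')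
  refine ⟨τ, ?_⟩
  have h3 := congrArg₂ (· * ·) h1 h2
  simp only [← Complex.exp_add] at h3
  rw [mul_div_cancel₀ _ (by simpa using hp)] at h3
  rw [← h3]
  congr 1
  ring

theorem HasModularExpansion.coeff_eq_zero {I : Type*} {M : UpperHalfPlane → Matrix I I ℂ}
    {c : ℕ → Matrix I I ℂ} (hc : HasModularExpansion M c) {i j : I} (h0 : ∀ τ, M τ i j = 0)
    (k : ℕ) : c k i j = 0 := by
  obtain ⟨δ, hδ, hc⟩ := hc
  refine congrFun (eq_zero_of_hasSum_pow_zero (c := fun k => c k i j) (δ := min δ 1) (by positivity)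
    fun p hp hp' => ?_) k
  obtain ⟨τ, hτ⟩ := exists_modular_nome hp (lt_of_lt_of_le hp' (min_le_right _ _))
  have := hc τ p hτ.symm (lt_of_lt_of_le hp' (min_le_left _ _)) i j
  rwa [h0] at this

/-- The Cauchy product of the expansions of mutually inverse matrices is the identity matrix. -/
theorem HasModularExpansion.cauchyProduct_eq_one {I : Type*} [Fintype I] [DecidableEq I]
    {M N : UpperHalfPlane → Matrix I I ℂ} {c d : ℕ → Matrix I I ℂ} (hc : HasModularExpansion M c)
    (hd : HasModularExpansion N d) (h1 : ∀ τ, M τ * N τ = 1) (k : ℕ) (i j : I) :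
    ∑ l, ∑ q ∈ Finset.HasAntidiagonal.antidiagonal k, c q.1 i l * d q.2 l j =
      if i = j ∧ k = 0 then 1 else 0 := by
  obtain ⟨δ, hδ, hc⟩ := hc
  obtain ⟨δ', hδ', hd⟩ := hd
  have := congrFun (eq_zero_of_hasSum_pow_zero (c := fun k =>
    (∑ l, ∑ q ∈ Finset.HasAntidiagonal.antidiagonal k, c q.1 i l * d q.2 l j) -
      if i = j ∧ k = 0 then 1 else 0) (δ := min (min δ δ') 1) (by positivity)
    fun p hp hp' => ?_) k
  · simpa [sub_eq_zero] using this
  · obtain ⟨τ, hτ⟩ := exists_modular_nome hp (lt_of_lt_of_le hp' (min_le_right _ _))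
    have hcs := hc τ p hτ.symm
      (lt_of_lt_of_le hp' ((min_le_left _ _).trans (min_le_left _ _)))
    have hds := hd τ p hτ.symm
      (lt_of_lt_of_le hp' ((min_le_left _ _).trans (min_le_right _ _)))
    have hprod : ∀ l, HasSum (fun k => ∑ q ∈ Finset.HasAntidiagonal.antidiagonal k,
        (c q.1 i l * p ^ q.1) * (d q.2 l j * p ^ q.2)) (M τ i l * N τ l j) := by
      intro l
      have hn1 := (hcs i l).summable.norm
      have hn2 := (hds l j).summable.norm
      rw [← (hcs i l).tsum_eq, ← (hds l j).tsum_eq,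
        tsum_mul_tsum_eq_tsum_sum_antidiagonal_of_summable_norm hn1 hn2]
      exact (summable_norm_sum_mul_antidiagonal_of_summable_norm hn1 hn2).of_norm.hasSum
    have h2 := hasSum_sum (s := Finset.univ) fun l _ => hprod l
    have h3 : ∑ l, M τ i l * N τ l j = if i = j then 1 else 0 := by
      rw [← Matrix.mul_apply, h1, Matrix.one_apply]
    rw [h3] at h2
    have h4 : HasSum (fun k => (if i = j ∧ k = 0 then (1 : ℂ) else 0) * p ^ k)
        (if i = j then 1 else 0) := by
      convert! hasSum_ite_eq 0 (if i = j then (1 : ℂ) else 0) using 1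
      funext k
      by_cases hk : k = 0 <;> simp [hk]
    have h5 := h2.sub h4
    rw [sub_self] at h5
    refine h5.congr_fun fun k => ?_
    rw [sub_mul, Finset.sum_mul]
    congr 1
    refine Finset.sum_congr rfl fun l _ => ?_
    rw [Finset.sum_mul]
    refine Finset.sum_congr rfl fun q hq => ?_
    rw [← Finset.HasAntidiagonal.mem_antidiagonal.1 hq, pow_add]
    ring


/-! ### Operations on generating series -/

section Series

variable {K A C : Type*} [CommRing K] [Algebra ℂ K] [Ring A] [Algebra K A] [Ring C] [Algebra K C]

open Finset.HasAntidiagonal (antidiagonal)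

theorem scal_smul (c : ℂ) (a : A) : scal K A c * a = algebraMap ℂ K c • a := by
  simp [scal, Algebra.smul_def]

theorem smul_scal (c : ℂ) (a : A) : a * scal K A c = algebraMap ℂ K c • a := by
  rw [← scal_smul]
  exact (Algebra.commutes _ _).symm

/-- The exponents pulled back along a map of variables. -/
noncomputable def pullExp {α β : Type*} [Finite α] (f : α → β) : (β →₀ ℕ) →+ (α →₀ ℕ) where
  toFun d := Finsupp.equivFunOnFinite.symm fun a => d (f a)
  map_zero' := by ext; simp
  map_add' d e := by ext; simp

@[simp]
theorem pullExp_apply {α β : Type*} [Finite α] (f : α → β) (d : β →₀ ℕ) (a : α) :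
    pullExp f d a = d (f a) := rfl

theorem coeff_ser (t : ℕ → ℕ → A) (d : Fin 2 →₀ ℕ) :
    MvPowerSeries.coeff d (ser t) = t (d 0) (d 1) := rfl

theorem coeff_serP (c : ℕ → A) (d : Fin 2 →₀ ℕ) :
    MvPowerSeries.coeff d (serP c) = if d 0 = d 1 then c (d 0) else 0 := rfl

theorem coeff_serU₁ (t : ℕ → ℕ → A) (d : Fin 3 →₀ ℕ) :
    MvPowerSeries.coeff d (serU₁ t) = if d 0 = d 1 then t (d 0) (d 2) else 0 := rfl

theorem coeff_serU₂ (t : ℕ → ℕ → A) (d : Fin 3 →₀ ℕ) :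
    MvPowerSeries.coeff d (serU₂ t) = if d 0 = d 2 then t (d 1) (d 0) else 0 := rfl

theorem coeff_serU₁₂ (t : ℕ → ℕ → A) (d : Fin 3 →₀ ℕ) :
    MvPowerSeries.coeff d (serU₁₂ t) = if d 1 = d 2 then t (d 0) (d 1) else 0 := rfl

open scoped Classical in
/-- The substitution which replaces the variable `a` by the product of the variables in the fibre
of `g` over `a`; the section `f` of `g` serves to read off exponents. -/
noncomputable def monomialSubstFun {α β : Type*} [Finite α] [Finite β] (f : α → β) (g : β → α)
    (φ : MvPowerSeries α A) : MvPowerSeries β A :=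
  fun d => if pullExp g (pullExp f d) = d then MvPowerSeries.coeff (pullExp f d) φ else 0

open scoped Classical in
theorem coeff_monomialSubstFun {α β : Type*} [Finite α] [Finite β] (f : α → β) (g : β → α)
    (φ : MvPowerSeries α A) (d : β →₀ ℕ) : MvPowerSeries.coeff d (monomialSubstFun f g φ) =
      if pullExp g (pullExp f d) = d then MvPowerSeries.coeff (pullExp f d) φ else 0 := rfl

theorem monomialSubstFun_C {α β : Type*} [Finite α] [Finite β] (f : α → β)
    (g : β → α) (a : A) :
    monomialSubstFun f g (MvPowerSeries.C a) = MvPowerSeries.C a := by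
  classical
  ext d
  rw [coeff_monomialSubstFun, MvPowerSeries.coeff_C, MvPowerSeries.coeff_C]
  by_cases hd : d = 0
  · simp [hd]
  · by_cases hd' : pullExp g (pullExp f d) = d
    · have : pullExp f d ≠ 0 := fun h0 => hd (by rw [← hd', h0, map_zero])
      simp [hd, this]
    · simp [hd, hd']

theorem monomialSubstFun_mul {α β : Type*} [Finite α] [Finite β] (f : α → β) (g : β → α)
    (h : ∀ a, g (f a) = a) (φ ψ : MvPowerSeries α A) :
    monomialSubstFun f g (φ * ψ) = monomialSubstFun f g φ * monomialSubstFun f g ψ := by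
  classical
  have hret : ∀ e : α →₀ ℕ, pullExp f (pullExp g e) = e := fun e => by ext a; simp [h]
  ext d
  rw [MvPowerSeries.coeff_mul]
  simp only [coeff_monomialSubstFun]
  by_cases hd : pullExp g (pullExp f d) = d
  · rw [if_pos hd, MvPowerSeries.coeff_mul]
    refine Finset.sum_of_injOn (fun e => (pullExp g e.1, pullExp g e.2)) ?_ ?_ ?_ ?_
    · rintro ⟨a, b⟩ - ⟨a', b'⟩ - hab
      simp only [Prod.mk.injEq] at hab
      rw [← hret a, ← hret b, hab.1, hab.2, hret, hret]
    · rintro ⟨a, b⟩ hab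
      simp only [Finset.mem_coe, Finset.HasAntidiagonal.mem_antidiagonal] at hab ⊢
      rw [← map_add, hab, hd]
    · rintro ⟨a, b⟩ hab hn
      simp only [Finset.HasAntidiagonal.mem_antidiagonal] at hab
      by_cases ha : pullExp g (pullExp f a) = a
      · by_cases hb : pullExp g (pullExp f b) = b
        · refine absurd ⟨(pullExp f a, pullExp f b), ?_, ?_⟩ hn
          · simp only [Finset.mem_coe, Finset.HasAntidiagonal.mem_antidiagonal]
            rw [← map_add, hab]
          · simp [ha, hb]
        · simp [hb]
      · simp [ha]
    · rintro ⟨a, b⟩ -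
      simp [hret]
  · rw [if_neg hd]
    symm
    refine Finset.sum_eq_zero ?_
    rintro ⟨a, b⟩ hab
    simp only [Finset.HasAntidiagonal.mem_antidiagonal] at hab
    by_cases ha : pullExp g (pullExp f a) = a
    · by_cases hb : pullExp g (pullExp f b) = b
      · exact absurd (by rw [← hab, map_add, map_add, ha, hb]) hd
      · simp [hb]
    · simp [ha]

/-- A substitution of monomials with disjoint sets of variables is a ring homomorphism. -/
noncomputable def monomialSubst {α β : Type*} [Finite α] [Finite β] (A : Type*) [Ring A] (f : α → β)
    (g : β → α) (h : ∀ a, g (f a) = a) : MvPowerSeries α A →+* MvPowerSeries β A where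
  toFun := monomialSubstFun f g
  map_one' := by
    have := monomialSubstFun_C f g (1 : A)
    rwa [map_one, map_one] at this
  map_zero' := by
    have := monomialSubstFun_C f g (0 : A)
    rwa [map_zero, map_zero] at this
  map_add' φ ψ := by
    ext d
    simp only [map_add, coeff_monomialSubstFun]
    split_ifs <;> simp
  map_mul' := monomialSubstFun_mul f g h

/-- The substitution of `u₁`, on series. -/
noncomputable def substU₁ (A : Type*) [Ring A] :
    MvPowerSeries (Fin 2) A →+* MvPowerSeries (Fin 3) A :=
  monomialSubst A ![0, 2] ![0, 0, 1] (by decide)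

/-- The substitution of `u₂`, on series. -/
noncomputable def substU₂ (A : Type*) [Ring A] :
    MvPowerSeries (Fin 2) A →+* MvPowerSeries (Fin 3) A :=
  monomialSubst A ![1, 0] ![1, 0, 1] (by decide)

theorem substU₁_ser (t : ℕ → ℕ → A) : substU₁ A (ser t) = serU₁ t := by
  ext d
  refine (coeff_monomialSubstFun _ _ _ d).trans ?_
  rw [coeff_ser, coeff_serU₁]
  split_ifs with h1 h2 h2
  · simp
  · simp [Finsupp.ext_iff, Fin.forall_fin_succ] at h1 h2; grind
  · simp [Finsupp.ext_iff, Fin.forall_fin_succ] at h1 h2; grind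
  · rfl

theorem substU₂_ser (t : ℕ → ℕ → A) : substU₂ A (ser t) = serU₂ t := by
  ext d
  refine (coeff_monomialSubstFun _ _ _ d).trans ?_
  rw [coeff_ser, coeff_serU₂]
  split_ifs with h1 h2 h2
  · simp
  · simp [Finsupp.ext_iff, Fin.forall_fin_succ] at h1 h2; grind
  · simp [Finsupp.ext_iff, Fin.forall_fin_succ] at h1 h2; grind
  · rfl

theorem substU₁_C (a : A) : substU₁ A (MvPowerSeries.C a) = MvPowerSeries.C a :=
  monomialSubstFun_C _ _ a

theorem substU₂_C (a : A) : substU₂ A (MvPowerSeries.C a) = MvPowerSeries.C a :=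
  monomialSubstFun_C _ _ a

/-- The coefficients of a series in `z` and `w`, as a doubly indexed family. -/
noncomputable def unser (φ : MvPowerSeries (Fin 2) A) : ℕ → ℕ → A :=
  fun n m => MvPowerSeries.coeff (Finsupp.equivFunOnFinite.symm ![n, m]) φ

theorem ser_unser (φ : MvPowerSeries (Fin 2) A) : ser (unser φ) = φ := by
  ext d
  rw [coeff_ser, unser]
  congr 2
  ext i
  fin_cases i <;> rfl

theorem unser_ser (t : ℕ → ℕ → A) : unser (ser t) = t := rfl

theorem ser_injective : Function.Injective (ser : (ℕ → ℕ → A) → MvPowerSeries (Fin 2) A) :=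
  Function.LeftInverse.injective unser_ser

/-- The factor by which the shift of the spectral parameter by `c` multiplies `zⁿ wᵐ`. -/
noncomputable def shiftFactor (K : Type*) [CommRing K] [Algebra ℂ K] (L c : ℂ) (n m : ℕ) : K :=
  algebraMap ℂ K (Complex.exp (2 * Real.pi * Complex.I * c * ((n : ℂ) - (m : ℂ)) / L))

theorem shiftFactor_self (L c : ℂ) (n : ℕ) : shiftFactor K L c n n = 1 := by simp [shiftFactor]

theorem shiftFactor_zero (L : ℂ) (n m : ℕ) : shiftFactor K L 0 n m = 1 := by simp [shiftFactor]

theorem shiftFactor_mul (L c : ℂ) (n m n' m' : ℕ) : shiftFactor K L c n m * shiftFactor K L c n' m' =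
    shiftFactor K L c (n + n') (m + m') := by
  rw [shiftFactor, shiftFactor, ← map_mul, ← Complex.exp_add, shiftFactor]
  congr 2
  push_cast
  ring

theorem shiftFactor_add (L c c' : ℂ) (n m : ℕ) : shiftFactor K L c n m * shiftFactor K L c' n m =
    shiftFactor K L (c + c') n m := by
  rw [shiftFactor, shiftFactor, ← map_mul, ← Complex.exp_add, shiftFactor]
  congr 2
  ring

theorem coeff_ser_shift (L c : ℂ) (t : ℕ → ℕ → A) (d : Fin 2 →₀ ℕ) :
    MvPowerSeries.coeff d (ser (shift K L c t)) = shiftFactor K L c (d 0) (d 1) • t (d 0) (d 1) :=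
  rfl

theorem ser_shift_C (L c : ℂ) (a : A) :
    ser (shift K L c (unser (MvPowerSeries.C a))) = MvPowerSeries.C a := by
  classical
  ext d
  rw [coeff_ser_shift, ← coeff_ser (unser _), ser_unser, MvPowerSeries.coeff_C]
  split_ifs with hd
  · rw [hd, Finsupp.zero_apply, Finsupp.zero_apply, shiftFactor_self, one_smul]
  · rw [smul_zero]

/-- The shift of the spectral parameter by `c`, on series. -/
noncomputable def shiftHom (K : Type*) {A : Type*} [CommRing K] [Algebra ℂ K] [Ring A] [Algebra K A]
    (L c : ℂ) : MvPowerSeries (Fin 2) A →+* MvPowerSeries (Fin 2) A where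
  toFun φ := ser (shift K L c (unser φ))
  map_one' := by
    have := ser_shift_C (K := K) L c (1 : A)
    rwa [map_one] at this
  map_zero' := by
    have := ser_shift_C (K := K) L c (0 : A)
    rwa [map_zero] at this
  map_add' φ ψ := by
    ext d
    simp only [map_add, coeff_ser_shift, ← smul_add]
    rfl
  map_mul' φ ψ := by
    ext d
    rw [MvPowerSeries.coeff_mul, coeff_ser_shift, ← coeff_ser (unser _), ser_unser,
      MvPowerSeries.coeff_mul, Finset.smul_sum]
    refine Finset.sum_congr rfl fun e he => ?_
    rw [Finset.HasAntidiagonal.mem_antidiagonal] at he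
    rw [coeff_ser_shift, ← coeff_ser (unser _), ser_unser, coeff_ser_shift, ← coeff_ser (unser _),
      ser_unser, smul_mul_smul_comm, shiftFactor_mul, ← he, Finsupp.add_apply, Finsupp.add_apply]

theorem coeff_shiftHom (L c : ℂ) (φ : MvPowerSeries (Fin 2) A) (d : Fin 2 →₀ ℕ) :
    MvPowerSeries.coeff d (shiftHom K L c φ) =
      shiftFactor K L c (d 0) (d 1) • MvPowerSeries.coeff d φ := by
  refine (coeff_ser_shift L c (unser φ) d).trans ?_
  rw [← coeff_ser (unser _), ser_unser]

theorem ser_shift (L c : ℂ) (t : ℕ → ℕ → A) : ser (shift K L c t) = shiftHom K L c (ser t) := rfl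

theorem shiftHom_add (L c c' : ℂ) (φ : MvPowerSeries (Fin 2) A) :
    shiftHom K L c (shiftHom K L c' φ) = shiftHom K L (c + c') φ := by
  ext d
  rw [coeff_shiftHom, coeff_shiftHom, coeff_shiftHom, smul_smul, shiftFactor_add]

theorem shiftHom_zero (L : ℂ) (φ : MvPowerSeries (Fin 2) A) : shiftHom K L 0 φ = φ := by
  ext d
  rw [coeff_shiftHom, shiftFactor_zero, one_smul]

theorem shiftHom_C (L c : ℂ) (a : A) :
    shiftHom K L c (MvPowerSeries.C a : MvPowerSeries (Fin 2) A) = MvPowerSeries.C a :=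
  ser_shift_C L c a

theorem shiftHom_serP (L c : ℂ) (s : ℕ → A) : shiftHom K L c (serP s) = serP s := by
  ext d
  rw [coeff_shiftHom, coeff_serP]
  split_ifs with hd
  · rw [hd, shiftFactor_self, one_smul]
  · rw [smul_zero]

/-- The entries of a matrix of series in `p` with complex coefficients. -/
def serMat {B : Type*} (K A : Type*) [CommRing K] [Algebra ℂ K] [Ring A] [Algebra K A]
    (c : ℕ → Matrix B B ℂ) (x y : B) : MvPowerSeries (Fin 2) A :=
  serP fun k => scal K A (c k x y)

/-- The entries of the series `r(u₁ - u₂)`. -/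
def serR {B : Type*} (K A : Type*) [CommRing K] [Algebra ℂ K] [Ring A] [Algebra K A]
    (r : ℕ → ℕ → Matrix (B × B) (B × B) ℂ) (i j : B × B) : MvPowerSeries (Fin 3) A :=
  serU₁₂ fun n m => scal K A (r n m i j)

theorem serMat_eq_map {B : Type*} (c : ℕ → Matrix B B ℂ) (x y : B) :
    serMat K A c x y = MvPowerSeries.map (scal K A) (serP fun k => c k x y) := by
  ext d
  rw [MvPowerSeries.coeff_map, serMat, coeff_serP, coeff_serP]
  split_ifs <;> simp

theorem serR_eq_map {B : Type*} (r : ℕ → ℕ → Matrix (B × B) (B × B) ℂ) (i j : B × B) :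
    serR K A r i j = MvPowerSeries.map (scal K A) (serU₁₂ fun n m => r n m i j) := by
  ext d
  rw [MvPowerSeries.coeff_map, serR, coeff_serU₁₂, coeff_serU₁₂]
  split_ifs <;> simp

/-- Series with commuting coefficients commute. -/
theorem ser_commute {σ : Type*} {φ ψ : MvPowerSeries σ A}
    (h : ∀ d e, MvPowerSeries.coeff d φ * MvPowerSeries.coeff e ψ =
      MvPowerSeries.coeff e ψ * MvPowerSeries.coeff d φ) : φ * ψ = ψ * φ := by
  classical
  ext d
  rw [MvPowerSeries.coeff_mul, MvPowerSeries.coeff_mul]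
  refine (Finset.sum_congr rfl fun e _ => h e.1 e.2).trans ?_
  exact Finsupp.sum_antidiagonal_swap d fun a b =>
    MvPowerSeries.coeff b ψ * MvPowerSeries.coeff a φ

theorem map_scal_comm {σ : Type*} (s : MvPowerSeries σ ℂ) (φ : MvPowerSeries σ A) :
    MvPowerSeries.map (scal K A) s * φ = φ * MvPowerSeries.map (scal K A) s :=
  ser_commute fun d e => by rw [MvPowerSeries.coeff_map, scal_smul, smul_scal]

theorem serMat_comm {B : Type*} (c : ℕ → Matrix B B ℂ) (x y : B) (φ : MvPowerSeries (Fin 2) A) :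
    serMat K A c x y * φ = φ * serMat K A c x y := by
  rw [serMat_eq_map, map_scal_comm]

theorem serR_comm {B : Type*} (r : ℕ → ℕ → Matrix (B × B) (B × B) ℂ) (i j : B × B)
    (φ : MvPowerSeries (Fin 3) A) : serR K A r i j * φ = φ * serR K A r i j := by
  rw [serR_eq_map, map_scal_comm]

/-- A (not necessarily unital) homomorphism of algebras, applied to coefficients. -/
def mapSer {σ : Type*} (Ψ : A →ₙₐ[K] C) (φ : MvPowerSeries σ A) : MvPowerSeries σ C :=
  fun d => Ψ (MvPowerSeries.coeff d φ)

theorem coeff_mapSer {σ : Type*} (Ψ : A →ₙₐ[K] C) (φ : MvPowerSeries σ A) (d : σ →₀ ℕ) :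
    MvPowerSeries.coeff d (mapSer Ψ φ) = Ψ (MvPowerSeries.coeff d φ) := rfl

theorem mapSer_mul {σ : Type*} (Ψ : A →ₙₐ[K] C) (φ ψ : MvPowerSeries σ A) :
    mapSer Ψ (φ * ψ) = mapSer Ψ φ * mapSer Ψ ψ := by
  classical
  ext d
  rw [MvPowerSeries.coeff_mul, coeff_mapSer, MvPowerSeries.coeff_mul, map_sum]
  exact Finset.sum_congr rfl fun e _ => map_mul Ψ _ _

theorem mapSer_sum {σ ι : Type*} (Ψ : A →ₙₐ[K] C) (s : Finset ι) (φ : ι → MvPowerSeries σ A) :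
    mapSer Ψ (∑ i ∈ s, φ i) = ∑ i ∈ s, mapSer Ψ (φ i) := by
  ext d
  rw [map_sum, coeff_mapSer, map_sum, map_sum]
  rfl

theorem mapSer_map_scal_mul {σ : Type*} (Ψ : A →ₙₐ[K] C) (s : MvPowerSeries σ ℂ)
    (φ : MvPowerSeries σ A) : mapSer Ψ (MvPowerSeries.map (scal K A) s * φ) =
      MvPowerSeries.map (scal K C) s * mapSer Ψ φ := by
  classical
  ext d
  rw [MvPowerSeries.coeff_mul, coeff_mapSer, MvPowerSeries.coeff_mul, map_sum]
  refine Finset.sum_congr rfl fun e _ => ?_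
  rw [MvPowerSeries.coeff_map, MvPowerSeries.coeff_map, scal_smul, scal_smul, map_smul,
    coeff_mapSer]

theorem mapSer_serMat_mul {B : Type*} (Ψ : A →ₙₐ[K] C) (c : ℕ → Matrix B B ℂ) (x y : B)
    (φ : MvPowerSeries (Fin 2) A) :
    mapSer Ψ (serMat K A c x y * φ) = serMat K C c x y * mapSer Ψ φ := by
  rw [serMat_eq_map, serMat_eq_map, mapSer_map_scal_mul]

theorem mapSer_serR_mul {B : Type*} (Ψ : A →ₙₐ[K] C) (r : ℕ → ℕ → Matrix (B × B) (B × B) ℂ)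
    (i j : B × B) (φ : MvPowerSeries (Fin 3) A) :
    mapSer Ψ (serR K A r i j * φ) = serR K C r i j * mapSer Ψ φ := by
  rw [serR_eq_map, serR_eq_map, mapSer_map_scal_mul]

theorem mapSer_ser (Ψ : A →ₙₐ[K] C) (t : ℕ → ℕ → A) :
    mapSer Ψ (ser t) = ser fun n m => Ψ (t n m) := rfl

theorem mapSer_serU₁ (Ψ : A →ₙₐ[K] C) (t : ℕ → ℕ → A) :
    mapSer Ψ (serU₁ t) = serU₁ fun n m => Ψ (t n m) := by
  ext d
  rw [coeff_mapSer, coeff_serU₁, coeff_serU₁]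
  split_ifs <;> simp

theorem mapSer_serU₂ (Ψ : A →ₙₐ[K] C) (t : ℕ → ℕ → A) :
    mapSer Ψ (serU₂ t) = serU₂ fun n m => Ψ (t n m) := by
  ext d
  rw [coeff_mapSer, coeff_serU₂, coeff_serU₂]
  split_ifs <;> simp

theorem mapSer_shiftHom (Ψ : A →ₙₐ[K] C) (L c : ℂ) (φ : MvPowerSeries (Fin 2) A) :
    mapSer Ψ (shiftHom K L c φ) = shiftHom K L c (mapSer Ψ φ) := by
  ext d
  rw [coeff_mapSer, coeff_shiftHom, coeff_shiftHom, map_smul, coeff_mapSer]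

/-- The series with the same coefficients, placed in the opposite algebra. -/
def opSer {σ : Type*} (φ : MvPowerSeries σ A) : MvPowerSeries σ Aᵐᵒᵖ :=
  fun d => MulOpposite.op (MvPowerSeries.coeff d φ)

theorem coeff_opSer {σ : Type*} (φ : MvPowerSeries σ A) (d : σ →₀ ℕ) :
    MvPowerSeries.coeff d (opSer φ) = MulOpposite.op (MvPowerSeries.coeff d φ) := rfl

theorem opSer_mul {σ : Type*} (φ ψ : MvPowerSeries σ A) :
    opSer (φ * ψ) = opSer ψ * opSer φ := by
  classical
  ext d
  rw [MvPowerSeries.coeff_mul, coeff_opSer, MvPowerSeries.coeff_mul, Finset.op_sum]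
  exact Finsupp.sum_antidiagonal_swap d fun a b =>
    MulOpposite.op (MvPowerSeries.coeff a φ * MvPowerSeries.coeff b ψ)

theorem opSer_sum {σ ι : Type*} (s : Finset ι) (φ : ι → MvPowerSeries σ A) :
    opSer (∑ i ∈ s, φ i) = ∑ i ∈ s, opSer (φ i) := by
  ext d
  rw [map_sum, coeff_opSer, map_sum, Finset.op_sum]
  rfl

theorem opSer_C {σ : Type*} (a : A) : opSer (MvPowerSeries.C a : MvPowerSeries σ A) =
    MvPowerSeries.C (MulOpposite.op a) := by
  classical
  ext d
  rw [MvPowerSeries.coeff_C, coeff_opSer, MvPowerSeries.coeff_C]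
  split_ifs <;> simp

theorem opSer_serMat {B : Type*} (c : ℕ → Matrix B B ℂ) (x y : B) :
    opSer (serMat K A c x y) = serMat K Aᵐᵒᵖ c x y := by
  ext d
  rw [coeff_opSer, serMat, serMat, coeff_serP, coeff_serP]
  split_ifs
  · rfl
  · rfl

theorem opSer_serR {B : Type*} (r : ℕ → ℕ → Matrix (B × B) (B × B) ℂ) (i j : B × B) :
    opSer (serR K A r i j) = serR K Aᵐᵒᵖ r i j := by
  ext d
  rw [coeff_opSer, serR, serR, coeff_serU₁₂, coeff_serU₁₂]
  split_ifs
  · rfl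
  · rfl

theorem opSer_ser (t : ℕ → ℕ → A) : opSer (ser t) = ser fun n m => MulOpposite.op (t n m) := rfl

theorem opSer_serU₁ (t : ℕ → ℕ → A) : opSer (serU₁ t) = serU₁ fun n m => MulOpposite.op (t n m) := by
  ext d
  rw [coeff_opSer, coeff_serU₁, coeff_serU₁]
  split_ifs <;> simp

theorem opSer_serU₂ (t : ℕ → ℕ → A) : opSer (serU₂ t) = serU₂ fun n m => MulOpposite.op (t n m) := by
  ext d
  rw [coeff_opSer, coeff_serU₂, coeff_serU₂]
  split_ifs <;> simp

theorem opSer_shiftHom (L c : ℂ) (φ : MvPowerSeries (Fin 2) A) :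
    opSer (shiftHom K L c φ) = shiftHom K L c (opSer φ) := by
  ext d
  rw [coeff_opSer, coeff_shiftHom, coeff_shiftHom, MulOpposite.op_smul, coeff_opSer]

end Series


/-! ### Representations of the defining relations -/

open scoped Classical in
/-- The sum of the values of `E` at the arrows with source `c`. -/
noncomputable def srcSum {π C : Type*} [Groupoid π] [Finite π] [∀ a b : π, Finite (a ⟶ b)] [Ring C]
    (E : Arr π → C) (c : π) : C := ∑ f : Arr π with f.src = c, E f

open scoped Classical in
/-- The sum of the values of `E` at the arrows with target `c`. -/
noncomputable def tgtSum {π C : Type*} [Groupoid π] [Finite π] [∀ a b : π, Finite (a ⟶ b)] [Ring C]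
    (E : Arr π → C) (c : π) : C := ∑ f : Arr π with f.tgt = c, E f

/-- Elements `E f`, `X^±[n,m]` and `T_x^y[n,m]` of an algebra `C` that obey the relations of `e f`,
`ξ^±[n,m]` and `T_x^y[n,m]` in `A_{R,ω}`, except that the idempotent `∑ E f` need not be `1`: it is
only required to be a unit for the other elements.  The homogeneous components of `T_x^y` are
`E f * T_x^y * E g`, and the condition `square` says that they vanish unless `f` and `g` are the
horizontal sides of a commutative square with vertical sides `deg x` and `deg y`. -/
structure IsRep (K : Type*) {π B C : Type*} [Groupoid π] [Finite π] [∀ a b : π, Finite (a ⟶ b)]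
    [Fintype B] [CommRing K] [Algebra ℂ K] [Ring C] [Algebra K C] (deg : B → Arr π)
    (L lam : ℂ) (r : ℕ → ℕ → Matrix (B × B) (B × B) ℂ) (ωc σc : ℕ → Matrix B B ℂ)
    (E : Arr π → C) (X : Bool → ℕ → ℕ → C) (T : B → B → ℕ → ℕ → C) : Prop where
  idem : ∀ f, E f * E f = E f
  orth : ∀ f g, f ≠ g → E f * E g = 0
  unit_T : ∀ x y n m, (∑ f, E f) * T x y n m = T x y n m
  T_unit : ∀ x y n m, T x y n m * (∑ f, E f) = T x y n m
  unit_X : ∀ s n m, (∑ f, E f) * X s n m = X s n m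
  square : ∀ f g x y n m, (¬ ∃ α : Sq.Between (deg x) (deg y), α.1.top = f ∧ α.1.bot = g) →
    E f * T x y n m * E g = 0
  comm_E : ∀ s n m f, X s n m * E f = E f * X s n m
  comm_X : ∀ s n m s' n' m', X s n m * X s' n' m' = X s' n' m' * X s n m
  comm_T : ∀ s n m x y n' m', X s n m * T x y n' m' = T x y n' m' * X s n m
  inv : ∀ s, ser (X s) * ser (X (!s)) = MvPowerSeries.C (∑ f, E f)
  rtt : ∀ x y z w, ∑ z' : B, ∑ w' : B,
      serR K C r (z, w) (z', w') * serU₁ (T x z') * serU₂ (T y w') =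
    ∑ x' : B, ∑ y' : B, serU₂ (T x' z) * serU₁ (T y' w) * serR K C r (x', y') (x, y)
  omega : ∀ x y, ∑ z : B, ∑ w : B,
      serMat K C ωc z w * ser (shift K L lam (T x z)) * ser (T y w) =
    MvPowerSeries.C (srcSum E (deg x).src) * ser (X true) * serMat K C ωc x y
  sigma : ∀ z w, ∑ x : B, ∑ y : B,
      ser (T x z) * ser (shift K L lam (T y w)) * serMat K C σc x y =
    MvPowerSeries.C (tgtSum E (deg z).src) * ser (X true) * serMat K C σc z w

section

variable {K π B C : Type*} [Groupoid π] [Finite π] [∀ a b : π, Finite (a ⟶ b)]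
    [Fintype B] [CommRing K] [Algebra ℂ K] [Ring C] [Algebra K C] {deg : B → Arr π}
    {L lam : ℂ} {r : ℕ → ℕ → Matrix (B × B) (B × B) ℂ} {ωc σc : ℕ → Matrix B B ℂ}
    {E : Arr π → C} {X : Bool → ℕ → ℕ → C} {T : B → B → ℕ → ℕ → C}

/-- The images of the generators of `A_{R,ω}` under the homomorphism defined by `E`, `X`, `T`. -/
def repGen (deg : B → Arr π) (E : Arr π → C) (X : Bool → ℕ → ℕ → C) (T : B → B → ℕ → ℕ → C) :
    Gen deg → C
  | .e f => E f
  | .xi s f n m => E f * X s n m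
  | .T x y α n m => E α.1.top * T x y n m * E α.1.bot

theorem orth_ite {ι : Type*} [DecidableEq ι] {E : ι → C} (h1 : ∀ f, E f * E f = E f)
    (h2 : ∀ f g, f ≠ g → E f * E g = 0) (f g : ι) : E f * E g = if f = g then E f else 0 := by
  split_ifs with h
  · rw [← h, h1]
  · exact h2 f g h

theorem IsRep.sum_mul_E (h : IsRep K deg L lam r ωc σc E X T) (f : Arr π) :
    (∑ g, E g) * E f = E f := by
  classical
  simp [Finset.sum_mul, orth_ite h.idem h.orth]

theorem IsRep.E_mul_sum (h : IsRep K deg L lam r ωc σc E X T) (f : Arr π) :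
    E f * (∑ g, E g) = E f := by
  classical
  simp [Finset.mul_sum, orth_ite h.idem h.orth]

theorem IsRep.sum_idem (h : IsRep K deg L lam r ωc σc E X T) :
    IsIdempotentElem (∑ g, E g) := by
  rw [IsIdempotentElem, Finset.mul_sum]
  exact Finset.sum_congr rfl fun f _ => h.sum_mul_E f

theorem IsRep.X_unit (h : IsRep K deg L lam r ωc σc E X T) (s : Bool) (n m : ℕ) :
    X s n m * (∑ f, E f) = X s n m := by
  rw [Finset.mul_sum, Finset.sum_congr rfl fun f _ => h.comm_E s n m f, ← Finset.sum_mul, h.unit_X]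

theorem IsRep.unit_repGen (h : IsRep K deg L lam r ωc σc E X T) (x : Gen deg) :
    (∑ f, E f) * repGen deg E X T x = repGen deg E X T x := by
  cases x <;> simp only [repGen, ← mul_assoc, h.sum_mul_E]

theorem IsRep.repGen_unit (h : IsRep K deg L lam r ωc σc E X T) (x : Gen deg) :
    repGen deg E X T x * (∑ f, E f) = repGen deg E X T x := by
  cases x <;> simp only [repGen, mul_assoc, h.E_mul_sum, h.X_unit]

/-- A family indexed by pairs `(top, bot)` that vanishes off the squares with given vertical sides
can be summed over these squares. -/
theorem sum_between {M : Type*} [AddCommMonoid M] (i j : Arr π) (F : Arr π → Arr π → M)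
    (hF : ∀ f g, (¬ ∃ α : Sq.Between i j, α.1.top = f ∧ α.1.bot = g) → F f g = 0) :
    ∑ α : Sq.Between i j, F α.1.top α.1.bot = ∑ f, ∑ g, F f g := by
  rw [← Finset.sum_product' Finset.univ Finset.univ, Finset.univ_product_univ]
  refine Fintype.sum_of_injective (fun α : Sq.Between i j => (α.1.top, α.1.bot)) ?_ _ _ ?_ ?_
  · rintro ⟨α, h1, h2⟩ ⟨β, h3, h4⟩ hab
    simp only [Prod.mk.injEq] at hab
    exact Subtype.ext (Sq.ext (h1.trans h3.symm) (h2.trans h4.symm) hab.1 hab.2)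
  · rintro ⟨f, g⟩ hfg
    refine hF f g ?_
    rintro ⟨α, h1, h2⟩
    exact hfg ⟨α, by simp [h1, h2]⟩
  · intro α
    rfl

theorem IsRep.matT_repGen (h : IsRep K deg L lam r ωc σc E X T) (x y : B) (n m : ℕ) :
    matT (repGen deg E X T) x y n m = T x y n m := by
  have := sum_between (deg x) (deg y) (fun f g => E f * T x y n m * E g)
    fun f g => h.square f g x y n m
  simp only [matT, repGen]
  rw [this]
  simp only [← Finset.mul_sum, ← Finset.sum_mul, h.unit_T, h.T_unit]

theorem xiOn_repGen (s : Bool) (P : Arr π → Prop) (n m : ℕ) :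
    xiOn (repGen deg E X T) s P n m = (open scoped Classical in ∑ f with P f, E f) * X s n m := by
  simp only [xiOn, repGen, Finset.sum_mul]

theorem IsRep.xiAll_repGen (h : IsRep K deg L lam r ωc σc E X T) (s : Bool) (n m : ℕ) :
    xiAll (repGen deg E X T) s n m = X s n m := by
  rw [xiAll, xiOn_repGen]
  simp only [Finset.filter_true, h.unit_X]

theorem ser_C_mul (a : C) (t : ℕ → ℕ → C) :
    ser (fun n m => a * t n m) = MvPowerSeries.C a * ser t := by
  ext d
  rw [MvPowerSeries.coeff_C_mul, coeff_ser, coeff_ser]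

theorem map_matT {A : Type*} [Ring A] [Algebra K A] (Ψ : A →ₙₐ[K] C) (g : Gen deg → A) (x y : B)
    (n m : ℕ) : Ψ (matT g x y n m) = matT (fun i => Ψ (g i)) x y n m := by
  simp only [matT, map_sum]

theorem map_xiOn {A : Type*} [Ring A] [Algebra K A] (Ψ : A →ₙₐ[K] C) (g : Gen deg → A) (s : Bool)
    (P : Arr π → Prop) (n m : ℕ) : Ψ (xiOn g s P n m) = xiOn (fun i => Ψ (g i)) s P n m := by
  simp only [xiOn, map_sum]

theorem map_xiAll {A : Type*} [Ring A] [Algebra K A] (Ψ : A →ₙₐ[K] C) (g : Gen deg → A) (s : Bool)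
    (n m : ℕ) : Ψ (xiAll g s n m) = xiAll (fun i => Ψ (g i)) s n m := map_xiOn Ψ g s _ n m

section Transport

variable {A : Type*} [Ring A] [Algebra K A] (Ψ : A →ₙₐ[K] C) (g : Gen deg → A)

theorem mapSer_rtt_left (x y z w : B) :
    mapSer Ψ (∑ z' : B, ∑ w' : B,
        serU₁₂ (fun n m => scal K A (r n m (z, w) (z', w'))) *
          serU₁ (matT g x z') * serU₂ (matT g y w')) =
      ∑ z' : B, ∑ w' : B, serR K C r (z, w) (z', w') *
        serU₁ (matT (fun i => Ψ (g i)) x z') * serU₂ (matT (fun i => Ψ (g i)) y w') := by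
  rw [mapSer_sum]
  refine Finset.sum_congr rfl fun z' _ => ?_
  rw [mapSer_sum]
  refine Finset.sum_congr rfl fun w' _ => ?_
  rw [mapSer_mul, ← serR, mapSer_serR_mul, mapSer_serU₁, mapSer_serU₂]
  simp only [map_matT]

theorem mapSer_rtt_right (x y z w : B) :
    mapSer Ψ (∑ x' : B, ∑ y' : B, serU₂ (matT g x' z) * serU₁ (matT g y' w) *
        serU₁₂ (fun n m => scal K A (r n m (x', y') (x, y)))) =
      ∑ x' : B, ∑ y' : B, serU₂ (matT (fun i => Ψ (g i)) x' z) *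
        serU₁ (matT (fun i => Ψ (g i)) y' w) * serR K C r (x', y') (x, y) := by
  rw [mapSer_sum]
  refine Finset.sum_congr rfl fun z' _ => ?_
  rw [mapSer_sum]
  refine Finset.sum_congr rfl fun w' _ => ?_
  rw [← serR, ← serR_comm, mapSer_serR_mul, serR_comm, mapSer_mul, mapSer_serU₁, mapSer_serU₂]
  simp only [map_matT]

theorem mapSer_omega_left (x y : B) :
    mapSer Ψ (∑ z : B, ∑ w : B, serP (fun k => scal K A (ωc k z w)) *
        ser (shift K L lam (matT g x z)) * ser (matT g y w)) =
      ∑ z : B, ∑ w : B, serMat K C ωc z w *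
        ser (shift K L lam (matT (fun i => Ψ (g i)) x z)) * ser (matT (fun i => Ψ (g i)) y w) := by
  rw [mapSer_sum]
  refine Finset.sum_congr rfl fun z' _ => ?_
  rw [mapSer_sum]
  refine Finset.sum_congr rfl fun w' _ => ?_
  rw [mapSer_mul, ← serMat, mapSer_serMat_mul, ser_shift, mapSer_shiftHom, mapSer_ser, mapSer_ser]
  simp only [map_matT]
  rfl

theorem mapSer_sigma_left (z w : B) :
    mapSer Ψ (∑ x : B, ∑ y : B, ser (matT g x z) * ser (shift K L lam (matT g y w)) *
          serP (fun k => scal K A (σc k x y))) =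
      ∑ x : B, ∑ y : B, ser (matT (fun i => Ψ (g i)) x z) *
        ser (shift K L lam (matT (fun i => Ψ (g i)) y w)) * serMat K C σc x y := by
  rw [mapSer_sum]
  refine Finset.sum_congr rfl fun z' _ => ?_
  rw [mapSer_sum]
  refine Finset.sum_congr rfl fun w' _ => ?_
  rw [← serMat, ← serMat_comm, mapSer_serMat_mul, serMat_comm, mapSer_mul, ser_shift,
    mapSer_shiftHom, mapSer_ser, mapSer_ser]
  simp only [map_matT]
  rfl

theorem mapSer_xiOn_mul (s : Bool) (P : Arr π → Prop) (c : ℕ → Matrix B B ℂ) (x y : B) :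
    mapSer Ψ (ser (xiOn g s P) * serP (fun k => scal K A (c k x y))) =
      ser (xiOn (fun i => Ψ (g i)) s P) * serMat K C c x y := by
  rw [← serMat, ← serMat_comm, mapSer_serMat_mul, serMat_comm, mapSer_ser]
  simp only [map_xiOn]

theorem mapSer_xiAll_mul (s s' : Bool) :
    mapSer Ψ (ser (xiAll g s) * ser (xiAll g s')) =
      ser (xiAll (fun i => Ψ (g i)) s) * ser (xiAll (fun i => Ψ (g i)) s') := by
  rw [mapSer_mul, mapSer_ser, mapSer_ser]
  simp only [map_xiAll]

end Transport

open scoped Classical in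
/-- A homomorphism from the free algebra that sends the generators to a representation, and `1` to
its idempotent `∑ E f`, respects the defining relations. -/
theorem IsRep.rel (h : IsRep K deg L lam r ωc σc E X T) (Ψ : FreeAlgebra K (Gen deg) →ₙₐ[K] C)
    (hΨ : ∀ x, Ψ (FreeAlgebra.ι K x) = repGen deg E X T x) (h1 : Ψ 1 = ∑ f, E f)
    {a b : FreeAlgebra K (Gen deg)} (hab : Rel K deg L lam r ωc σc a b) : Ψ a = Ψ b := by
  have hΨ' : (fun x => Ψ (FreeAlgebra.ι K x)) = repGen deg E X T := funext hΨ
  have hT : ∀ x y, matT (repGen deg E X T) x y = T x y := fun x y => by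
    ext n m; exact h.matT_repGen x y n m
  have hX : ∀ s, xiAll (repGen deg E X T) s = X s := fun s => by
    ext n m; exact h.xiAll_repGen s n m
  cases hab with
  | unit_idem f => rw [map_mul, hΨ]; exact h.idem f
  | unit_orth f g hfg => rw [map_mul, map_zero, hΨ, hΨ]; exact h.orth f g hfg
  | unit_sum => rw [map_sum, h1]; exact Finset.sum_congr rfl fun f _ => hΨ _
  | unit_mul x =>
    rw [map_mul, hΨ, hΨ]
    cases x <;> simp only [repGen, Gen.degree, Sq.idV, ← mul_assoc, h.idem]
  | mul_unit x =>
    rw [map_mul, hΨ, hΨ]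
    cases x with
    | e f => exact h.idem f
    | xi s f n m =>
      simp only [repGen, Gen.degree, Sq.idV]
      rw [mul_assoc, h.comm_E, ← mul_assoc, h.idem]
    | T x y α n m => simp only [repGen, Gen.degree, mul_assoc, h.idem]
  | central s n m x =>
    rw [map_mul, map_mul, map_xiAll, hΨ', hΨ, hX]
    cases x with
    | e f => exact h.comm_E s n m f
    | xi s' f n' m' =>
      simp only [repGen]
      rw [← mul_assoc, h.comm_E, mul_assoc, h.comm_X, mul_assoc]
    | T x y α n' m' =>
      simp only [repGen]
      rw [← mul_assoc, ← mul_assoc, h.comm_E, mul_assoc _ (X s n m), h.comm_T, mul_assoc, mul_assoc,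
        h.comm_E]
      simp only [mul_assoc]
  | xi_inv s d =>
    rw [← coeff_mapSer, mapSer_xiAll_mul, hΨ', hX, hX, h.inv, MvPowerSeries.coeff_one,
      MvPowerSeries.coeff_C, apply_ite Ψ, h1, map_zero]
  | rtt x y z w d =>
    rw [← coeff_mapSer, ← coeff_mapSer, mapSer_rtt_left, mapSer_rtt_right, hΨ']
    simp only [hT]
    rw [h.rtt]
  | omega x y d =>
    rw [← coeff_mapSer, ← coeff_mapSer, mapSer_omega_left, mapSer_xiOn_mul, hΨ']
    simp only [hT]
    rw [h.omega]
    have : xiOn (repGen deg E X T) true (fun f => f.src = (deg x).src) =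
      fun n m => srcSum E (deg x).src * X true n m := by ext n m; exact xiOn_repGen _ _ _ _
    rw [this, ser_C_mul]
  | sigma z w d =>
    rw [← coeff_mapSer, ← coeff_mapSer, mapSer_sigma_left, mapSer_xiOn_mul, hΨ']
    simp only [hT]
    rw [h.sigma]
    have : xiOn (repGen deg E X T) true (fun f => f.tgt = (deg z).src) =
      fun n m => tgtSum E (deg z).src * X true n m := by ext n m; exact xiOn_repGen _ _ _ _
    rw [this, ser_C_mul]

/-- The scalar multiplication of a corner. -/
instance cornerSMul {P : C} (hP : IsIdempotentElem P) : SMul K hP.Corner where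
  smul k a := ⟨k • a.1, k • a.1, by
    obtain ⟨h1, h2⟩ := (Subsemigroup.mem_corner_iff hP).1 a.2
    simp only [mul_smul_comm, smul_mul_assoc, h1, h2]⟩

/-- The corner of an idempotent is an algebra, with the idempotent as unit. -/
noncomputable instance cornerAlgebra {P : C} (hP : IsIdempotentElem P) : Algebra K hP.Corner :=
  letI : Module K hP.Corner := Function.Injective.module K
    (⟨⟨Subtype.val, rfl⟩, fun _ _ => rfl⟩ : hP.Corner →+ C) Subtype.val_injective fun _ _ => rfl
  Algebra.ofModule (fun k a b => Subtype.ext (smul_mul_assoc k a.1 b.1))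
    (fun k a b => Subtype.ext (mul_smul_comm k a.1 b.1))

/-- The inclusion of a corner. -/
def cornerVal (K : Type*) [CommRing K] [Algebra K C] {P : C} (hP : IsIdempotentElem P) :
    hP.Corner →ₙₐ[K] C where
  toFun := Subtype.val
  map_smul' _ _ := rfl
  map_zero' := rfl
  map_add' _ _ := rfl
  map_mul' _ _ := rfl

/-- The universal property of `A_{R,ω}`.  The homomorphism is unital as a map to the corner
of the idempotent `∑ E f`. -/
theorem IsRep.exists_hom (h : IsRep K deg L lam r ωc σc E X T) :
    ∃ φ : QAlg K deg L lam r ωc σc →ₙₐ[K] C,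
      ∀ x, φ (gen K deg L lam r ωc σc x) = repGen deg E X T x := by
  have hP := h.sum_idem
  let g : Gen deg → hP.Corner := fun x =>
    ⟨repGen deg E X T x, (Subsemigroup.mem_corner_iff hP).2 ⟨h.unit_repGen x, h.repGen_unit x⟩⟩
  let F : FreeAlgebra K (Gen deg) →ₐ[K] hP.Corner := FreeAlgebra.lift K g
  let Ψ : FreeAlgebra K (Gen deg) →ₙₐ[K] C := (cornerVal K hP).comp (F : _ →ₙₐ[K] _)
  have hΨ : ∀ x, Ψ (FreeAlgebra.ι K x) = repGen deg E X T x := fun x => by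
    exact congrArg (cornerVal K hP) (FreeAlgebra.lift_ι_apply (R := K) g x)
  have h1 : Ψ 1 = ∑ f, E f := by
    exact congrArg (cornerVal K hP) (map_one F)
  have hF : ∀ ⦃a b⦄, Rel K deg L lam r ωc σc a b → F a = F b := fun a b hab =>
    Subtype.ext (h.rel Ψ hΨ h1 hab)
  refine ⟨(cornerVal K hP).comp (RingQuot.liftAlgHom K ⟨F, hF⟩ : _ →ₙₐ[K] _), fun x => ?_⟩
  rw [← hΨ]
  exact congrArg (cornerVal K hP) (RingQuot.liftAlgHom_mkAlgHom_apply (S := K) F hF _)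

end


/-! ### Composition of arrows and of squares -/

namespace IsComp

variable {π : Type*} [Groupoid π] {f g h k fg gh : Arr π}

theorem tgt_eq_src (H : IsComp f g h) : f.tgt = g.src := by cases H; rfl

theorem src_eq (H : IsComp f g h) : h.src = f.src := by cases H; rfl

theorem tgt_eq (H : IsComp f g h) : h.tgt = g.tgt := by cases H; rfl

theorem unique (H : IsComp f g h) (H' : IsComp f g k) : h = k := by cases H; cases H'; rfl

theorem exists_of_eq (H : f.tgt = g.src) : ∃ h, IsComp f g h := by
  obtain ⟨a, b, f⟩ := f
  obtain ⟨b', c, g⟩ := g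
  obtain rfl : b = b' := H
  exact ⟨_, IsComp.mk f g⟩

theorem assoc_right (H : IsComp f g fg) (H' : IsComp fg h k) :
    ∃ gh, IsComp g h gh ∧ IsComp f gh k := by
  cases H with
  | mk f g => cases H' with
    | mk _ h => exact ⟨_, .mk g h, by rw [Category.assoc]; exact .mk f (g ≫ h)⟩

theorem assoc_left (H : IsComp g h gh) (H' : IsComp f gh k) :
    ∃ fg, IsComp f g fg ∧ IsComp fg h k := by
  cases H with
  | mk g h => cases H' with
    | mk f _ => exact ⟨_, .mk f g, by rw [← Category.assoc]; exact .mk (f ≫ g) h⟩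

theorem id_left_iff (a : π) : IsComp (Arr.id a) f h ↔ f = h ∧ f.src = a := by
  constructor
  · intro H
    obtain rfl : a = f.src := H.tgt_eq_src
    exact ⟨(IsComp.id_comp f).unique H, rfl⟩
  · rintro ⟨rfl, rfl⟩
    exact IsComp.id_comp f

theorem id_right_iff (a : π) : IsComp f (Arr.id a) h ↔ f = h ∧ f.tgt = a := by
  constructor
  · intro H
    obtain rfl : f.tgt = a := H.tgt_eq_src
    exact ⟨(IsComp.comp_id f).unique H, rfl⟩
  · rintro ⟨rfl, rfl⟩
    exact IsComp.comp_id f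

theorem inv_right (f : Arr π) : IsComp f f.inv (Arr.id f.src) := by
  have := IsComp.mk f.hom (Groupoid.inv f.hom)
  rwa [Groupoid.comp_inv] at this

theorem inv_left (f : Arr π) : IsComp f.inv f (Arr.id f.tgt) := by
  have := IsComp.mk (Groupoid.inv f.hom) f.hom
  rwa [Groupoid.inv_comp] at this

end IsComp

namespace Arr

variable {π : Type*} [Groupoid π]

theorem inv_inv (f : Arr π) : f.inv.inv = f := by simp [Arr.inv]

theorem inv_tgt (f : Arr π) : f.inv.tgt = f.src := rfl

theorem id_inv (a : π) : (Arr.id a).inv = Arr.id a := by simp [Arr.id, Arr.inv]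

theorem inv_injective : Function.Injective (Arr.inv : Arr π → Arr π) :=
  Function.LeftInverse.injective inv_inv

theorem id_injective : Function.Injective (Arr.id : π → Arr π) := fun _ _ h =>
  congrArg Arr.src h

/-- Inversion of arrows as a permutation. -/
def invEquiv (π : Type*) [Groupoid π] : Arr π ≃ Arr π := ⟨Arr.inv, Arr.inv, inv_inv, inv_inv⟩

end Arr

namespace Sq

variable {π : Type*} [Groupoid π]

theorem top_src (α : Sq π) : α.top.src = α.left.src := by
  obtain ⟨d, h1, h2⟩ := α.comm
  rw [← h1.src_eq, h2.src_eq]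

theorem top_tgt (α : Sq π) : α.top.tgt = α.right.src := by
  obtain ⟨d, h1, h2⟩ := α.comm
  exact h1.tgt_eq_src

theorem bot_src (α : Sq π) : α.bot.src = α.left.tgt := by
  obtain ⟨d, h1, h2⟩ := α.comm
  exact h2.tgt_eq_src.symm

theorem bot_tgt (α : Sq π) : α.bot.tgt = α.right.tgt := by
  obtain ⟨d, h1, h2⟩ := α.comm
  rw [← h1.tgt_eq, h2.tgt_eq]

theorem exists_hComp {α β : Sq π} {f g : Arr π} (h : α.right = β.left)
    (hf : IsComp α.top β.top f) (hg : IsComp α.bot β.bot g) :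
    ∃ γ : Sq π, HComp α β γ ∧ γ.top = f ∧ γ.bot = g := by
  obtain ⟨d, h1, h2⟩ := α.comm
  obtain ⟨d', h3, h4⟩ := β.comm
  -- `top α · (top β · right β) = top α · (left β · bot β) = (left α · bot α) · bot β`
  obtain ⟨k, hk⟩ := IsComp.exists_of_eq (f := f) (g := β.right) (by rw [hf.tgt_eq, top_tgt])
  obtain ⟨k', hk1, hk2⟩ := hf.assoc_right hk
  obtain rfl := hk1.unique h3
  obtain ⟨m, hm1, hm2⟩ := h4.assoc_left hk2
  rw [h] at h1
  obtain rfl := hm1.unique h1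
  obtain ⟨n, hn1, hn2⟩ := h2.assoc_right hm2
  obtain rfl := hn1.unique hg
  exact ⟨⟨α.left, β.right, f, n, k, hk, hn2⟩, ⟨h, rfl, rfl, hf, hg⟩, rfl, rfl⟩

theorem exists_vComp {α β : Sq π} (h : α.bot = β.top) : ∃ γ : Sq π, VComp α β γ := by
  obtain ⟨d, h1, h2⟩ := α.comm
  obtain ⟨d', h3, h4⟩ := β.comm
  obtain ⟨l, hl⟩ := IsComp.exists_of_eq (f := α.left) (g := β.left)
    (by rw [← bot_src, h, top_src])
  obtain ⟨r, hr⟩ := IsComp.exists_of_eq (f := α.right) (g := β.right)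
    (by rw [← bot_tgt, h, top_tgt])
  obtain ⟨k, hk⟩ := IsComp.exists_of_eq (f := α.top) (g := r) (by rw [hr.src_eq, top_tgt])
  obtain ⟨k', hk1, hk2⟩ := hr.assoc_left hk
  obtain rfl := hk1.unique h1
  obtain ⟨m, hm1, hm2⟩ := h2.assoc_right hk2
  rw [h] at hm1
  obtain rfl := hm1.unique h3
  obtain ⟨n, hn1, hn2⟩ := h4.assoc_left hm2
  obtain rfl := hn1.unique hl
  exact ⟨⟨n, r, α.top, β.bot, k, hk, hn2⟩, h, rfl, rfl, hl, hr⟩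

theorem VComp.iota {α β γ : Sq π} (h : VComp α β γ) : VComp β.iota α.iota γ.iota := by
  obtain ⟨h1, h2, h3, h4, h5⟩ := h
  exact ⟨congrArg Arr.inv h1.symm, congrArg Arr.inv h3, congrArg Arr.inv h2, h5.inv, h4.inv⟩

/-- Horizontal composites of vertical composites are vertical composites of horizontal ones. -/
theorem interchange {α₁ α₂ β₁ β₂ γ₁ γ₂ α β γ : Sq π} (hα : HComp α₁ α₂ α) (hβ : HComp β₁ β₂ β)
    (h1 : VComp α₁ β₁ γ₁) (h2 : VComp α₂ β₂ γ₂) (hγ : VComp α β γ) : HComp γ₁ γ₂ γ := by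
  obtain ⟨a1, a2, a3, a4, a5⟩ := hα
  obtain ⟨b1, b2, b3, b4, b5⟩ := hβ
  obtain ⟨c1, c2, c3, c4, c5⟩ := h1
  obtain ⟨d1, d2, d3, d4, d5⟩ := h2
  obtain ⟨e1, e2, e3, e4, e5⟩ := hγ
  refine ⟨?_, ?_, ?_, ?_, ?_⟩
  · rw [← a1, ← b1] at d4
    exact c5.unique d4
  · rw [a2, b2] at e4
    exact e4.unique c4
  · rw [a3, b3] at e5
    exact e5.unique d5
  · rw [c2, d2, e2]
    exact a4
  · rw [c3, d3, e3]
    exact b5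

theorem ext_of_between {i j : Arr π} {α β : Between i j} (h1 : α.1.top = β.1.top)
    (h2 : α.1.bot = β.1.bot) : α = β :=
  Subtype.ext (Sq.ext (α.2.1.trans β.2.1.symm) (α.2.2.trans β.2.2.symm) h1 h2)

end Sq

/-! ### The quantum algebra and its generators -/

section

variable (K : Type*) {π B : Type*} [Groupoid π] [Finite π] [∀ a b : π, Finite (a ⟶ b)]
    [Fintype B] [CommRing K] [Algebra ℂ K] (deg : B → Arr π)
    (L lam : ℂ) (r : ℕ → ℕ → Matrix (B × B) (B × B) ℂ) (ωc σc : ℕ → Matrix B B ℂ)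

/-- The unit `e f` of the quantum algebra. -/
noncomputable abbrev genE (f : Arr π) : QAlg K deg L lam r ωc σc := gen K deg L lam r ωc σc (.e f)

/-- The central element `ξ^±[n,m]` of the quantum algebra. -/
noncomputable abbrev genX (s : Bool) (n m : ℕ) : QAlg K deg L lam r ωc σc :=
  xiAll (gen K deg L lam r ωc σc) s n m

/-- The matrix element `T_x^y[n,m]` of the quantum algebra. -/
noncomputable abbrev genT (x y : B) (n m : ℕ) : QAlg K deg L lam r ωc σc :=
  matT (gen K deg L lam r ωc σc) x y n m

end

section

variable {K π B : Type*} [Groupoid π] [Finite π] [∀ a b : π, Finite (a ⟶ b)]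
    [Fintype B] [CommRing K] [Algebra ℂ K] {deg : B → Arr π}
    {L lam : ℂ} {r : ℕ → ℕ → Matrix (B × B) (B × B) ℂ} {ωc σc : ℕ → Matrix B B ℂ}

local notation "𝔸" => QAlg K deg L lam r ωc σc
local notation "𝕘" => gen K deg L lam r ωc σc
local notation "𝕖" => genE K deg L lam r ωc σc
local notation "𝕏" => genX K deg L lam r ωc σc
local notation "𝕋" => genT K deg L lam r ωc σc

/-- The projection from the free algebra. -/
noncomputable def proj : FreeAlgebra K (Gen deg) →ₐ[K] 𝔸 :=
  RingQuot.mkAlgHom K (Rel K deg L lam r ωc σc)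

local notation "𝕡" => (proj : FreeAlgebra K (Gen deg) →ₐ[K] QAlg K deg L lam r ωc σc)

theorem proj_rel {a b : FreeAlgebra K (Gen deg)} (h : Rel K deg L lam r ωc σc a b) : 𝕡 a = 𝕡 b :=
  RingQuot.mkAlgHom_rel K h

theorem proj_ι (x : Gen deg) : 𝕡 (FreeAlgebra.ι K x) = 𝕘 x := rfl

theorem genE_mul_self (f : Arr π) : 𝕖 f * 𝕖 f = 𝕖 f := by
  have := proj_rel (Rel.unit_idem (K := K) (L := L) (lam := lam) (r := r) (ωc := ωc) (σc := σc)
    (deg := deg) f)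
  rwa [map_mul] at this

theorem genE_orth (f g : Arr π) (h : f ≠ g) : 𝕖 f * 𝕖 g = 0 := by
  have := proj_rel (Rel.unit_orth (K := K) (L := L) (lam := lam) (r := r) (ωc := ωc) (σc := σc)
    (deg := deg) f g h)
  rwa [map_mul, map_zero] at this

theorem genE_sum : ∑ f, 𝕖 f = 1 := by
  have := proj_rel (Rel.unit_sum (K := K) (L := L) (lam := lam) (r := r) (ωc := ωc) (σc := σc)
    (deg := deg))
  rwa [map_sum, map_one] at this

theorem genE_top_mul (x : Gen deg) : 𝕖 x.degree.top * 𝕘 x = 𝕘 x := by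
  have := proj_rel (Rel.unit_mul (K := K) (L := L) (lam := lam) (r := r) (ωc := ωc) (σc := σc)
    (deg := deg) x)
  rwa [map_mul] at this

theorem mul_genE_bot (x : Gen deg) : 𝕘 x * 𝕖 x.degree.bot = 𝕘 x := by
  have := proj_rel (Rel.mul_unit (K := K) (L := L) (lam := lam) (r := r) (ωc := ωc) (σc := σc)
    (deg := deg) x)
  rwa [map_mul] at this

theorem proj_xiAll (s : Bool) (n m : ℕ) : 𝕡 (xiAll (FreeAlgebra.ι K) s n m) = 𝕏 s n m :=
  map_xiAll (𝕡 : FreeAlgebra K (Gen deg) →ₙₐ[K] 𝔸) (FreeAlgebra.ι K) s n m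

theorem genX_mul_gen (s : Bool) (n m : ℕ) (x : Gen deg) : 𝕏 s n m * 𝕘 x = 𝕘 x * 𝕏 s n m := by
  have := proj_rel (Rel.central (K := K) (L := L) (lam := lam) (r := r) (ωc := ωc) (σc := σc)
    (deg := deg) s n m x)
  rwa [map_mul, map_mul, proj_xiAll] at this

open scoped Classical in
theorem genE_mul_gen (f : Arr π) (x : Gen deg) :
    𝕖 f * 𝕘 x = if f = x.degree.top then 𝕘 x else 0 := by
  split_ifs with h
  · rw [h, genE_top_mul]
  · rw [← genE_top_mul x, ← mul_assoc, genE_orth _ _ h, zero_mul]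

open scoped Classical in
theorem gen_mul_genE (f : Arr π) (x : Gen deg) :
    𝕘 x * 𝕖 f = if x.degree.bot = f then 𝕘 x else 0 := by
  split_ifs with h
  · rw [← h, mul_genE_bot]
  · rw [← mul_genE_bot x, mul_assoc, genE_orth _ _ h, mul_zero]

theorem gen_xi (s : Bool) (f : Arr π) (n m : ℕ) : 𝕘 (.xi s f n m) = 𝕖 f * 𝕏 s n m := by
  classical
  simp only [genX, xiAll, xiOn, Finset.filter_true, Finset.mul_sum, genE_mul_gen]
  rw [Finset.sum_eq_single f]
  · simp [Gen.degree, Sq.idV]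
  · intro g _ hg
    exact if_neg (Ne.symm hg)
  · simp

theorem genE_mul_genT_mul_genE (f g : Arr π) (x y : B) (n m : ℕ) :
    𝕖 f * 𝕋 x y n m * 𝕖 g = open scoped Classical in
      ∑ α : Sq.Between (deg x) (deg y), if α.1.top = f ∧ α.1.bot = g then 𝕘 (.T x y α n m) else 0 := by
  classical
  simp only [genT, matT, Finset.mul_sum, Finset.sum_mul, genE_mul_gen, ite_mul, zero_mul,
    gen_mul_genE]
  refine Finset.sum_congr rfl fun α _ => ?_
  by_cases h1 : f = (Gen.T x y α n m).degree.top
  · rw [if_pos h1]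
    by_cases h2 : (Gen.T x y α n m).degree.bot = g
    · rw [if_pos h2, if_pos ⟨h1.symm, h2⟩]
    · rw [if_neg h2, if_neg fun h => h2 h.2]
  · rw [if_neg h1, if_neg fun h => h1 h.1.symm]

theorem gen_T (x y : B) (α : Sq.Between (deg x) (deg y)) (n m : ℕ) :
    𝕘 (.T x y α n m) = 𝕖 α.1.top * 𝕋 x y n m * 𝕖 α.1.bot := by
  classical
  rw [genE_mul_genT_mul_genE, Finset.sum_eq_single α]
  · simp
  · intro β _ hβ
    rw [if_neg]
    rintro ⟨h1, h2⟩
    exact hβ (Sq.ext_of_between h1 h2)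
  · simp

/-- Induction over the quantum algebra. -/
theorem qalg_induction {p : 𝔸 → Prop} (h0 : p 0) (hadd : ∀ a b, p a → p b → p (a + b))
    (hsmul : ∀ (k : K) a, p a → p (k • a)) (hmul : ∀ a b, p a → p b → p (a * b))
    (he : ∀ f, p (𝕖 f)) (hxi : ∀ s f n m, p (𝕘 (.xi s f n m))) (hT : ∀ x y n m, p (𝕋 x y n m))
    (a : 𝔸) : p a := by
  obtain ⟨a, rfl⟩ := RingQuot.mkAlgHom_surjective K (Rel K deg L lam r ωc σc) a
  change p (𝕡 a)
  have h1 : p 1 := by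
    rw [← genE_sum]
    exact Finset.sum_induction _ p hadd h0 fun f _ => he f
  induction a using FreeAlgebra.induction with
  | grade0 k =>
    rw [AlgHom.commutes, Algebra.algebraMap_eq_smul_one]
    exact hsmul k _ h1
  | grade1 x =>
    rw [proj_ι]
    cases x with
    | e f => exact he f
    | xi s f n m => exact hxi s f n m
    | T x y α n m =>
      rw [gen_T]
      exact hmul _ _ (hmul _ _ (he _) (hT _ _ _ _)) (he _)
  | mul a b ha hb => rw [map_mul]; exact hmul _ _ ha hb
  | add a b ha hb => rw [map_add]; exact hadd _ _ ha hb

theorem genX_comm (s : Bool) (n m : ℕ) (a : 𝔸) : 𝕏 s n m * a = a * 𝕏 s n m := by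
  induction a using qalg_induction with
  | h0 => simp
  | hadd a b ha hb => rw [mul_add, add_mul, ha, hb]
  | hsmul k a ha => rw [mul_smul_comm, smul_mul_assoc, ha]
  | hmul a b ha hb => rw [← mul_assoc, ha, mul_assoc, hb, mul_assoc]
  | he f => exact genX_mul_gen _ _ _ _
  | hxi s f n m => exact genX_mul_gen _ _ _ _
  | hT x y n m =>
    simp only [genT, matT, Finset.mul_sum, Finset.sum_mul]
    exact Finset.sum_congr rfl fun α _ => genX_mul_gen _ _ _ _

theorem xiOn_gen (s : Bool) (P : Arr π → Prop) : xiOn 𝕘 s P = fun n m =>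
    (open scoped Classical in ∑ f with P f, 𝕖 f) * 𝕏 s n m := by
  classical
  ext n m
  simp only [xiOn, gen_xi, Finset.sum_mul]

/-- The quantum algebra satisfies its own defining relations. -/
theorem isRep_gen : IsRep K deg L lam r ωc σc 𝕖 𝕏 𝕋 where
  idem := genE_mul_self
  orth := genE_orth
  unit_T x y n m := by rw [genE_sum, one_mul]
  T_unit x y n m := by rw [genE_sum, mul_one]
  unit_X s n m := by rw [genE_sum, one_mul]
  square f g x y n m h := by
    classical
    rw [genE_mul_genT_mul_genE]
    exact Finset.sum_eq_zero fun α _ => if_neg fun hα => h ⟨α, hα⟩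
  comm_E s n m f := genX_comm _ _ _ _
  comm_X s n m s' n' m' := genX_comm _ _ _ _
  comm_T s n m x y n' m' := genX_comm _ _ _ _
  inv s := by
    classical
    ext d
    have h := proj_rel (Rel.xi_inv (K := K) (L := L) (lam := lam) (r := r) (ωc := ωc) (σc := σc)
      (deg := deg) s d)
    have h2 := mapSer_xiAll_mul (𝕡 : _ →ₙₐ[K] 𝔸) (FreeAlgebra.ι K (X := Gen deg)) s (!s)
    rw [genE_sum, map_one, MvPowerSeries.coeff_one]
    rw [MvPowerSeries.coeff_one, apply_ite 𝕡, map_one, map_zero] at h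
    rw [← h]
    exact (congrArg (MvPowerSeries.coeff d) h2).symm
  rtt x y z w := by
    ext d
    have h := proj_rel (Rel.rtt (K := K) (L := L) (lam := lam) (r := r) (ωc := ωc) (σc := σc)
      (deg := deg) x y z w d)
    have h1 := mapSer_rtt_left (r := r) (𝕡 : _ →ₙₐ[K] 𝔸) (FreeAlgebra.ι K (X := Gen deg)) x y z w
    have h2 := mapSer_rtt_right (r := r) (𝕡 : _ →ₙₐ[K] 𝔸) (FreeAlgebra.ι K (X := Gen deg)) x y z w
    exact (congrArg (MvPowerSeries.coeff d) h1).symm.trans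
      (h.trans (congrArg (MvPowerSeries.coeff d) h2))
  omega x y := by
    ext d
    have h := proj_rel (Rel.omega (K := K) (L := L) (lam := lam) (r := r) (ωc := ωc) (σc := σc)
      (deg := deg) x y d)
    have h1 := mapSer_omega_left (L := L) (lam := lam) (ωc := ωc) (𝕡 : _ →ₙₐ[K] 𝔸)
      (FreeAlgebra.ι K (X := Gen deg)) x y
    have h2 := mapSer_xiOn_mul (𝕡 : _ →ₙₐ[K] 𝔸) (FreeAlgebra.ι K (X := Gen deg)) true
      (fun f => f.src = (deg x).src) ωc x y
    have h3 : ser (xiOn 𝕘 true fun f => f.src = (deg x).src) =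
      MvPowerSeries.C (srcSum 𝕖 (deg x).src) * ser (𝕏 true) := by
        rw [xiOn_gen, ser_C_mul]; rfl
    rw [← h3]
    exact (congrArg (MvPowerSeries.coeff d) h1).symm.trans
      (h.trans (congrArg (MvPowerSeries.coeff d) h2))
  sigma z w := by
    ext d
    have h := proj_rel (Rel.sigma (K := K) (L := L) (lam := lam) (r := r) (ωc := ωc) (σc := σc)
      (deg := deg) z w d)
    have h1 := mapSer_sigma_left (L := L) (lam := lam) (σc := σc) (𝕡 : _ →ₙₐ[K] 𝔸)
      (FreeAlgebra.ι K (X := Gen deg)) z w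
    have h2 := mapSer_xiOn_mul (𝕡 : _ →ₙₐ[K] 𝔸) (FreeAlgebra.ι K (X := Gen deg)) true
      (fun f => f.tgt = (deg z).src) σc z w
    have h3 : ser (xiOn 𝕘 true fun f => f.tgt = (deg z).src) =
      MvPowerSeries.C (tgtSum 𝕖 (deg z).src) * ser (𝕏 true) := by
        rw [xiOn_gen, ser_C_mul]; rfl
    rw [← h3]
    exact (congrArg (MvPowerSeries.coeff d) h1).symm.trans
      (h.trans (congrArg (MvPowerSeries.coeff d) h2))

/-- The universal property in terms of `e f`, `ξ^±_f` and `T_x^y`. -/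
theorem IsRep.exists_hom' {C : Type*} [Ring C] [Algebra K C] {E : Arr π → C}
    {X : Bool → ℕ → ℕ → C} {T : B → B → ℕ → ℕ → C} (h : IsRep K deg L lam r ωc σc E X T) :
    ∃ φ : 𝔸 →ₙₐ[K] C, (∀ f, φ (𝕖 f) = E f) ∧
      (∀ s f n m, φ (𝕘 (.xi s f n m)) = E f * X s n m) ∧
      (∀ s n m, φ (𝕏 s n m) = X s n m) ∧ ∀ x y n m, φ (𝕋 x y n m) = T x y n m := by
  obtain ⟨φ, hφ⟩ := h.exists_hom
  refine ⟨φ, fun f => hφ _, fun s f n m => hφ _, fun s n m => ?_, fun x y n m => ?_⟩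
  · rw [genX, map_xiAll]
    simp only [hφ]
    exact h.xiAll_repGen s n m
  · rw [genT, map_matT]
    simp only [hφ]
    exact h.matT_repGen x y n m

end


/-! ### The convolution algebra of the groupoid and the counit -/

section

variable {π M : Type*} [Groupoid π] [Finite π] [∀ a b : π, Finite (a ⟶ b)] [AddCommMonoid M]

open scoped Classical in
/-- Associativity of composition in terms of indicator functions. -/
theorem sum_comp_left (u v t w : Arr π) (c : M) :
    (∑ p, if IsComp p t w then (if IsComp u v p then c else 0) else 0) =
      ∑ p, if IsComp u p w then (if IsComp v t p then c else 0) else 0 := by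
  by_cases h : ∃ p, IsComp u v p ∧ IsComp p t w
  · obtain ⟨p, h1, h2⟩ := h
    obtain ⟨q, h3, h4⟩ := h1.assoc_right h2
    rw [Finset.sum_eq_single p, Finset.sum_eq_single q]
    · simp [h1, h2, h3, h4]
    · intro q' _ hq'
      rw [if_neg (c := IsComp v t q') fun h => hq' (h.unique h3), ite_self]
    · simp
    · intro q' _ hq'
      rw [if_neg (c := IsComp u v q') fun h => hq' (h.unique h1), ite_self]
    · simp
  · rw [Finset.sum_eq_zero, Finset.sum_eq_zero]
    · intro q _
      by_cases h3 : IsComp u q w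
      · rw [if_pos h3, if_neg]
        intro h4
        obtain ⟨p, h5, h6⟩ := h4.assoc_left h3
        exact h ⟨p, h5, h6⟩
      · rw [if_neg h3]
    · intro q _
      by_cases h3 : IsComp q t w
      · rw [if_pos h3, if_neg fun h4 => h ⟨q, h4, h3⟩]
      · rw [if_neg h3]

/-- Decompositions of an arrow into three factors can be formed from the left or from the right. -/
theorem sum_isComp_assoc (F : Arr π → Arr π → Arr π → M) (w : Arr π) : open scoped Classical in
    ∑ q : Arr π × Arr π with IsComp q.1 q.2 w, ∑ q' : Arr π × Arr π with IsComp q'.1 q'.2 q.1,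
      F q'.1 q'.2 q.2 =
    ∑ q : Arr π × Arr π with IsComp q.1 q.2 w, ∑ q' : Arr π × Arr π with IsComp q'.1 q'.2 q.2,
      F q.1 q'.1 q'.2 := by
  classical
  simp only [Finset.sum_filter, ← Finset.univ_product_univ, Finset.sum_product]
  have e (p : Prop) (G : Arr π → Arr π → M) : (if p then ∑ x, ∑ y, G x y else 0) =
      ∑ x, ∑ y, if p then G x y else 0 := by split_ifs <;> simp
  simp only [e]
  calc _ = ∑ x, ∑ y, ∑ t, ∑ p, if IsComp p t w then (if IsComp x y p then F x y t else 0) else 0 := by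
        rw [Finset.sum_comm]
        refine (Finset.sum_congr rfl fun t _ => ?_).trans (Finset.sum_comm.trans
          (Finset.sum_congr rfl fun x _ => Finset.sum_comm))
        rw [Finset.sum_comm]
        exact Finset.sum_congr rfl fun x _ => Finset.sum_comm
    _ = ∑ x, ∑ y, ∑ t, ∑ p, if IsComp x p w then (if IsComp y t p then F x y t else 0) else 0 := by
        simp only [sum_comp_left]
    _ = _ := by
        refine Finset.sum_congr rfl fun x _ => ?_
        rw [Finset.sum_comm (γ := Arr π)]
        rw [Finset.sum_comm]
        refine (Finset.sum_congr rfl fun y _ => Finset.sum_comm).trans Finset.sum_comm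

end

/-- The convolution algebra of the groupoid `π`: functions on arrows, multiplied like formal sums of
arrows.  This is the algebra structure of the horizontal unit `I_h`. -/
def ConvAlg (K π : Type*) [Groupoid π] : Type _ := Arr π → K

namespace ConvAlg

variable {K π : Type*} [Groupoid π] [Finite π] [∀ a b : π, Finite (a ⟶ b)] [CommRing K]

instance : AddCommGroup (ConvAlg K π) := inferInstanceAs (AddCommGroup (Arr π → K))

instance : Module K (ConvAlg K π) := inferInstanceAs (Module K (Arr π → K))

@[ext]
theorem ext {f g : ConvAlg K π} (h : ∀ u, f u = g u) : f = g := funext h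

open scoped Classical in
noncomputable instance : Mul (ConvAlg K π) :=
  ⟨fun f g w => ∑ q : Arr π × Arr π with IsComp q.1 q.2 w, f q.1 * g q.2⟩

open scoped Classical in
noncomputable instance : One (ConvAlg K π) := ⟨fun u => if ∃ a, u = Arr.id a then 1 else 0⟩

open scoped Classical in
theorem mul_apply (f g : ConvAlg K π) (w : Arr π) :
    (f * g) w = ∑ q : Arr π × Arr π with IsComp q.1 q.2 w, f q.1 * g q.2 := rfl

open scoped Classical in
theorem mul_apply' (f g : ConvAlg K π) (w : Arr π) :
    (f * g) w = ∑ u, ∑ v, if IsComp u v w then f u * g v else 0 := by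
  rw [mul_apply, Finset.sum_filter, ← Finset.univ_product_univ, Finset.sum_product]

open scoped Classical in
theorem one_apply (u : Arr π) : (1 : ConvAlg K π) u = if ∃ a, u = Arr.id a then 1 else 0 := rfl

theorem add_apply (f g : ConvAlg K π) (u : Arr π) : (f + g) u = f u + g u := rfl

theorem zero_apply (u : Arr π) : (0 : ConvAlg K π) u = 0 := rfl

theorem smul_apply (k : K) (f : ConvAlg K π) (u : Arr π) : (k • f) u = k * f u := rfl

theorem mul_assoc' (f g h : ConvAlg K π) : f * g * h = f * (g * h) := by
  classical
  ext w
  simp only [mul_apply, Finset.sum_mul, Finset.mul_sum, mul_assoc]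
  exact sum_isComp_assoc (fun u v t => f u * (g v * h t)) w

open scoped Classical in
/-- The basis element `1_u` of `I_h`. -/
noncomputable def single (K : Type*) {π : Type*} [Groupoid π] [CommRing K] (u : Arr π) :
    ConvAlg K π := Pi.single u 1

open scoped Classical in
theorem single_apply (u v : Arr π) : single K u v = if v = u then 1 else 0 :=
  Pi.single_apply u 1 v

open scoped Classical in
theorem single_mul_apply (u : Arr π) (f : ConvAlg K π) (w : Arr π) :
    (single K u * f) w = ∑ v, if IsComp u v w then f v else 0 := by
  rw [mul_apply', Finset.sum_eq_single u]
  · simp [single_apply]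
  · intro v _ hv
    simp [single_apply, hv]
  · simp

theorem single_mul_single {u v w : Arr π} (h : IsComp u v w) :
    single K u * single K v = single K w := by
  classical
  ext t
  rw [single_mul_apply, Finset.sum_eq_single v, single_apply v, if_pos rfl, single_apply]
  · refine if_congr ⟨fun h' => h'.unique h, fun h' => h' ▸ h⟩ rfl rfl
  · intro v' _ hv'
    rw [single_apply, if_neg hv', ite_self]
  · simp

theorem single_mul_single_of_ne {u v : Arr π} (h : u.tgt ≠ v.src) :
    single K u * single K v = 0 := by
  classical
  ext t
  rw [single_mul_apply, Finset.sum_eq_single v, if_neg fun h' => h h'.tgt_eq_src]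
  · rfl
  · intro v' _ hv'
    rw [single_apply, if_neg hv', ite_self]
  · simp

theorem one_mul' (f : ConvAlg K π) : 1 * f = f := by
  classical
  ext w
  rw [mul_apply', Finset.sum_eq_single (Arr.id w.src), Finset.sum_eq_single w,
    if_pos (IsComp.id_comp w), one_apply, if_pos ⟨_, rfl⟩, one_mul]
  · intro v _ hv
    rw [if_neg]
    intro h
    exact hv ((IsComp.id_left_iff _).1 h).1
  · simp
  · intro u _ hu
    refine Finset.sum_eq_zero fun v _ => ?_
    split_ifs with h
    · rw [one_apply, if_neg, zero_mul]
      rintro ⟨a, rfl⟩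
      obtain ⟨rfl, rfl⟩ := (IsComp.id_left_iff _).1 h
      exact hu rfl
    · rfl
  · simp

theorem mul_one' (f : ConvAlg K π) : f * 1 = f := by
  classical
  ext w
  rw [mul_apply', Finset.sum_eq_single w, Finset.sum_eq_single (Arr.id w.tgt),
    if_pos (IsComp.comp_id w), one_apply, if_pos ⟨_, rfl⟩, mul_one]
  · intro v _ hv
    split_ifs with h
    · rw [one_apply, if_neg, mul_zero]
      rintro ⟨a, rfl⟩
      obtain ⟨_, rfl⟩ := (IsComp.id_right_iff _).1 h
      exact hv rfl
    · rfl
  · simp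
  · intro u _ hu
    refine Finset.sum_eq_zero fun v _ => ?_
    split_ifs with h
    · rw [one_apply, if_neg, mul_zero]
      rintro ⟨a, rfl⟩
      exact hu ((IsComp.id_right_iff _).1 h).1
    · rfl
  · simp

noncomputable instance : Ring (ConvAlg K π) where
  __ := (inferInstance : AddCommGroup (ConvAlg K π))
  left_distrib f g h := by
    ext w
    simp only [mul_apply, add_apply, mul_add, Finset.sum_add_distrib]
  right_distrib f g h := by
    ext w
    simp only [mul_apply, add_apply, add_mul, Finset.sum_add_distrib]
  zero_mul f := by
    ext w
    simp only [mul_apply, zero_apply, zero_mul, Finset.sum_const_zero]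
  mul_zero f := by
    ext w
    simp only [mul_apply, zero_apply, mul_zero, Finset.sum_const_zero]
  mul_assoc := mul_assoc'
  one_mul := one_mul'
  mul_one := mul_one'

noncomputable instance : Algebra K (ConvAlg K π) :=
  Algebra.ofModule
    (fun k f g => by
      ext w
      simp only [mul_apply, smul_apply, Finset.mul_sum, mul_assoc])
    (fun k f g => by
      ext w
      simp only [mul_apply, smul_apply, Finset.mul_sum, mul_left_comm])

end ConvAlg

section

variable {K π B : Type*} [Groupoid π] [Finite π] [∀ a b : π, Finite (a ⟶ b)]
    [Fintype B] [CommRing K] [Algebra ℂ K] {deg : B → Arr π}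
    {L lam : ℂ} {r : ℕ → ℕ → Matrix (B × B) (B × B) ℂ} {ωc σc : ℕ → Matrix B B ℂ}

open ConvAlg

/-- The coefficients of an `R`-matrix preserve the degree on `V ⊗ V`. -/
def GradedR (deg : B → Arr π) (r : ℕ → ℕ → Matrix (B × B) (B × B) ℂ) : Prop :=
  ∀ n m z w x y, r n m (z, w) (x, y) ≠ 0 →
    ∃ d, IsComp (deg x) (deg y) d ∧ IsComp (deg z) (deg w) d

/-- The coefficients of an inner product pair degrees that are inverse to each other. -/
def GradedForm (deg : B → Arr π) (c : ℕ → Matrix B B ℂ) : Prop :=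
  ∀ k x y, c k x y ≠ 0 → deg y = (deg x).inv

theorem GradedR.serR_eq_zero {C : Type*} [Ring C] [Algebra K C] (h : GradedR deg r) {x y z w : B}
    (hn : ¬ ∃ d, IsComp (deg x) (deg y) d ∧ IsComp (deg z) (deg w) d) :
    serR K C r (z, w) (x, y) = 0 := by
  ext d
  rw [serR, coeff_serU₁₂]
  have : r (d 0) (d 1) (z, w) (x, y) = 0 := by
    by_contra h0
    exact hn (h _ _ _ _ _ _ h0)
  simp [this]

theorem GradedForm.serMat_eq_zero {C : Type*} [Ring C] [Algebra K C] {c : ℕ → Matrix B B ℂ}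
    (h : GradedForm deg c) {x y : B} (hn : deg y ≠ (deg x).inv) : serMat K C c x y = 0 := by
  ext d
  rw [serMat, coeff_serP]
  have : c (d 0) x y = 0 := by
    by_contra h0
    exact hn (h _ _ _ h0)
  simp [this]

theorem ser_const {C : Type*} [Ring C] (a : C) :
    ser (fun n m => if n = 0 ∧ m = 0 then a else 0) = MvPowerSeries.C a := by
  classical
  ext d
  rw [coeff_ser, MvPowerSeries.coeff_C]
  exact if_congr ⟨fun h => by ext i; fin_cases i; exacts [h.1, h.2], fun h => by simp [h]⟩ rfl rfl

theorem sigmaUnit_eq (K : Type*) [CommRing K] (f : Arr π) : sigmaUnit K f =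
    open scoped Classical in if f = Arr.id f.src then single K f else 0 := by
  classical
  funext u
  rw [sigmaUnit]
  by_cases h : f = Arr.id f.src
  · rw [if_pos h, single_apply]
    exact if_congr ⟨fun h' => h'.1.symm, fun h' => ⟨h'.symm, _, h⟩⟩ rfl rfl
  · rw [if_neg h, if_neg]
    · rfl
    · rintro ⟨_, a, ha⟩
      exact h (by rw [ha]; rfl)

theorem sigmaUnit_id (K : Type*) [CommRing K] (a : π) :
    sigmaUnit K (Arr.id a) = single K (Arr.id a) := by
  rw [sigmaUnit_eq]
  exact if_pos rfl

theorem sigmaUnit_of_ne (K : Type*) [CommRing K] {f : Arr π} (h : ∀ a, f ≠ Arr.id a) :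
    sigmaUnit K f = 0 := by
  rw [sigmaUnit_eq]
  exact if_neg (h _)

/-- The values of the counit on the units `e f`. -/
noncomputable def counitE (K : Type*) [CommRing K] (f : Arr π) : ConvAlg K π := sigmaUnit K f

open scoped Classical in
/-- The values of the counit on the central elements. -/
noncomputable def counitX (K π : Type*) [Groupoid π] [Finite π] [∀ a b : π, Finite (a ⟶ b)]
    [CommRing K] (_ : Bool) (n m : ℕ) : ConvAlg K π := if n = 0 ∧ m = 0 then 1 else 0

open scoped Classical in
/-- The values of the counit on the matrix elements. -/
noncomputable def counitT (K : Type*) [CommRing K] (deg : B → Arr π) (x y : B) (n m : ℕ) :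
    ConvAlg K π := if n = 0 ∧ m = 0 then (if x = y then single K (deg x) else 0) else 0

theorem counitE_id (a : π) : counitE K (Arr.id a) = single K (Arr.id a) := sigmaUnit_id K a

theorem counitE_of_ne {f : Arr π} (h : ∀ a, f ≠ Arr.id a) : counitE K f = 0 := sigmaUnit_of_ne K h

theorem counitE_sum : ∑ f : Arr π, counitE K f = 1 := by
  classical
  ext u
  have : (∑ f : Arr π, counitE K f) u = ∑ f : Arr π, counitE K f u := Finset.sum_apply u _ _
  rw [this, one_apply, Finset.sum_eq_single u]
  · exact if_congr ⟨fun h => h.2, fun h => ⟨rfl, h⟩⟩ rfl rfl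
  · intro f _ hf
    exact if_neg fun h => hf h.1
  · simp

open scoped Classical in
theorem counitE_mul_single (a : Arr π) (u : Arr π) :
    counitE K a * single K u = if a = Arr.id u.src then single K u else 0 := by
  split_ifs with h
  · rw [h, counitE_id, single_mul_single (IsComp.id_comp u)]
  · by_cases h' : ∃ b, a = Arr.id b
    · obtain ⟨b, rfl⟩ := h'
      rw [counitE_id, single_mul_single_of_ne]
      rintro rfl
      exact h rfl
    · rw [counitE_of_ne (by simpa using h'), zero_mul]

open scoped Classical in
theorem single_mul_counitE (a : Arr π) (u : Arr π) :
    single K u * counitE K a = if a = Arr.id u.tgt then single K u else 0 := by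
  split_ifs with h
  · rw [h, counitE_id, single_mul_single (IsComp.comp_id u)]
  · by_cases h' : ∃ b, a = Arr.id b
    · obtain ⟨b, rfl⟩ := h'
      rw [counitE_id, single_mul_single_of_ne]
      intro h'
      exact h (congrArg Arr.id h'.symm)
    · rw [counitE_of_ne (by simpa using h'), mul_zero]

theorem srcSum_counitE (c : π) : srcSum (counitE K) c = single K (Arr.id c) := by
  classical
  rw [srcSum, Finset.sum_eq_single (Arr.id c), counitE_id]
  · intro f hf hne
    apply counitE_of_ne
    rintro a rfl
    exact hne (congrArg Arr.id (Finset.mem_filter.1 hf).2)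
  · intro h
    exact (h (Finset.mem_filter.2 ⟨Finset.mem_univ _, rfl⟩)).elim

theorem tgtSum_counitE (c : π) : tgtSum (counitE K) c = single K (Arr.id c) := by
  classical
  rw [tgtSum, Finset.sum_eq_single (Arr.id c), counitE_id]
  · intro f hf hne
    apply counitE_of_ne
    rintro a rfl
    exact hne (congrArg Arr.id (Finset.mem_filter.1 hf).2)
  · intro h
    exact (h (Finset.mem_filter.2 ⟨Finset.mem_univ _, rfl⟩)).elim

theorem ser_counitX (s : Bool) : ser (counitX K π s) = 1 := by
  rw [← map_one MvPowerSeries.C, ← ser_const]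
  rfl

open scoped Classical in
theorem ser_counitT (x y : B) : ser (counitT K deg x y) =
    if x = y then MvPowerSeries.C (single K (deg x)) else 0 := by
  have : ser (counitT K deg x y) = MvPowerSeries.C (if x = y then single K (deg x) else 0) :=
    ser_const _
  rw [this]
  split_ifs
  · rfl
  · exact map_zero _

/-- The counit data satisfy the relations, since `R` and `ω` preserve degrees. -/
theorem isRep_counit (hr : GradedR deg r) (hω : GradedForm deg ωc) (hσ : GradedForm deg σc) :
    IsRep K deg L lam r ωc σc (counitE K) (counitX K π) (counitT K deg) := by
  classical
  exact {
    idem := fun f => by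
      by_cases h : ∃ a, f = Arr.id a
      · obtain ⟨a, rfl⟩ := h
        rw [counitE_id]
        exact single_mul_single (IsComp.id_comp (Arr.id a))
      · rw [counitE_of_ne (by simpa using h), mul_zero]
    orth := fun f g hfg => by
      by_cases h : ∃ a, f = Arr.id a
      · obtain ⟨a, rfl⟩ := h
        rw [counitE_id, single_mul_counitE]
        exact if_neg (Ne.symm hfg)
      · rw [counitE_of_ne (by simpa using h), zero_mul]
    unit_T := fun x y n m => by rw [counitE_sum, one_mul]
    T_unit := fun x y n m => by rw [counitE_sum, mul_one]
    unit_X := fun s n m => by rw [counitE_sum, one_mul]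
    square := fun f g x y n m h => by
      rw [counitT]
      by_cases h0 : (n = 0 ∧ m = 0) ∧ x = y
      · obtain ⟨h0, rfl⟩ := h0
        rw [if_pos h0, if_pos rfl, counitE_mul_single]
        split_ifs with h1
        · rw [single_mul_counitE, if_neg]
          intro h2
          exact h ⟨⟨Sq.idH (deg x), rfl, rfl⟩, h1.symm, h2.symm⟩
        · rw [zero_mul]
      · have : (if n = 0 ∧ m = 0 then (if x = y then single K (deg x) else 0) else 0) = 0 := by
          split_ifs with h1 h2
          · exact absurd ⟨h1, h2⟩ h0
          · rfl
          · rfl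
        rw [this, mul_zero, zero_mul]
    comm_E := fun s n m f => by rw [counitX]; split_ifs <;> simp
    comm_X := fun s n m s' n' m' => by rw [counitX]; split_ifs <;> simp
    comm_T := fun s n m x y n' m' => by rw [counitX]; split_ifs <;> simp
    inv := fun s => by rw [ser_counitX, ser_counitX, counitE_sum, one_mul, map_one]
    rtt := fun x y z w => by
      simp only [← substU₁_ser, ← substU₂_ser, ser_counitT, apply_ite (substU₁ _),
        apply_ite (substU₂ _), substU₁_C, substU₂_C, map_zero, mul_ite, ite_mul, mul_zero, zero_mul,
        Finset.sum_ite_eq, Finset.sum_ite_eq', Finset.mem_univ, if_true]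
      by_cases h : ∃ d, IsComp (deg x) (deg y) d ∧ IsComp (deg z) (deg w) d
      · obtain ⟨d, h1, h2⟩ := h
        rw [mul_assoc, ← map_mul, ← map_mul, single_mul_single h1, single_mul_single h2, serR_comm]
      · rw [hr.serR_eq_zero h, mul_zero, zero_mul, zero_mul]
    omega := fun x y => by
      simp only [ser_shift, ser_counitT, ser_counitX, apply_ite (shiftHom K L lam), shiftHom_C,
        map_zero, mul_ite, ite_mul, mul_zero, zero_mul,
        Finset.sum_ite_eq, Finset.mem_univ, if_true, srcSum_counitE, mul_one]
      by_cases h : deg y = (deg x).inv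
      · rw [mul_assoc, ← map_mul, h, single_mul_single (IsComp.inv_right _), serMat_comm]
      · rw [hω.serMat_eq_zero h, zero_mul, zero_mul, mul_zero]
    sigma := fun z w => by
      simp only [ser_shift, ser_counitT, ser_counitX, apply_ite (shiftHom K L lam), shiftHom_C,
        map_zero, mul_ite, ite_mul, mul_zero, zero_mul,
        Finset.sum_ite_eq', Finset.mem_univ, if_true, tgtSum_counitE, mul_one]
      by_cases h : deg w = (deg z).inv
      · rw [← map_mul, h, single_mul_single (IsComp.inv_right _)]
      · rw [hσ.serMat_eq_zero h, mul_zero, mul_zero] }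

end


/-! ### The coproduct -/

section Series

open Finset.HasAntidiagonal (antidiagonal)

theorem sum_antidiagonal_fin_two {M : Type*} [AddCommMonoid M] (d : Fin 2 →₀ ℕ)
    (F : ℕ → ℕ → ℕ → ℕ → M) :
    ∑ e ∈ antidiagonal d, F (e.1 0) (e.1 1) (e.2 0) (e.2 1) =
      ∑ a ∈ antidiagonal (d 0), ∑ b ∈ antidiagonal (d 1), F a.1 b.1 a.2 b.2 := by
  rw [← Finset.sum_product']
  refine Finset.sum_nbij' (fun e => ((e.1 0, e.2 0), (e.1 1, e.2 1)))
    (fun q => (Finsupp.equivFunOnFinite.symm ![q.1.1, q.2.1],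
      Finsupp.equivFunOnFinite.symm ![q.1.2, q.2.2])) ?_ ?_ ?_ ?_ ?_
  · rintro ⟨a, b⟩ h
    simp only [Finset.HasAntidiagonal.mem_antidiagonal, Finset.mem_product] at h ⊢
    rw [← h]
    exact ⟨rfl, rfl⟩
  · rintro ⟨⟨a, b⟩, ⟨a', b'⟩⟩ h
    simp only [Finset.HasAntidiagonal.mem_antidiagonal, Finset.mem_product] at h ⊢
    ext i
    fin_cases i
    · exact h.1
    · exact h.2
  · rintro ⟨a, b⟩ _
    ext i <;> fin_cases i <;> rfl
  · rintro ⟨⟨a, b⟩, ⟨a', b'⟩⟩ _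
    rfl
  · rintro ⟨a, b⟩ _
    rfl

theorem ser_mul_ser {A : Type*} [Ring A] (s t : ℕ → ℕ → A) :
    ser s * ser t = ser fun n m =>
      ∑ a ∈ antidiagonal n, ∑ b ∈ antidiagonal m, s a.1 b.1 * t a.2 b.2 := by
  classical
  ext d
  rw [MvPowerSeries.coeff_mul, coeff_ser]
  exact sum_antidiagonal_fin_two d fun n m n' m' => s n m * t n' m'

theorem ser_sum {A ι : Type*} [Ring A] (s : Finset ι) (t : ι → ℕ → ℕ → A) :
    ser (fun n m => ∑ i ∈ s, t i n m) = ∑ i ∈ s, ser (t i) := by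
  ext d
  rw [map_sum]
  rfl

variable {A C : Type*} [Ring A] [Ring C] (i : A →+* C)

theorem map_ser (t : ℕ → ℕ → A) : MvPowerSeries.map i (ser t) = ser fun n m => i (t n m) := rfl

theorem map_serU₁ (t : ℕ → ℕ → A) :
    MvPowerSeries.map i (serU₁ t) = serU₁ fun n m => i (t n m) := by
  ext d
  rw [MvPowerSeries.coeff_map, coeff_serU₁, coeff_serU₁]
  split_ifs <;> simp

theorem map_serU₂ (t : ℕ → ℕ → A) :
    MvPowerSeries.map i (serU₂ t) = serU₂ fun n m => i (t n m) := by
  ext d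
  rw [MvPowerSeries.coeff_map, coeff_serU₂, coeff_serU₂]
  split_ifs <;> simp

variable {K : Type*} [CommRing K] [Algebra ℂ K] [Algebra K A] [Algebra K C] (j : A →ₐ[K] C)

theorem algHom_scal (c : ℂ) : j (scal K A c) = scal K C c := by simp [scal]

theorem map_serMat {B : Type*} (c : ℕ → Matrix B B ℂ) (x y : B) :
    MvPowerSeries.map (j : A →+* C) (serMat K A c x y) = serMat K C c x y := by
  ext d
  rw [MvPowerSeries.coeff_map, serMat, serMat, coeff_serP, coeff_serP]
  split_ifs
  · exact algHom_scal j _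
  · exact map_zero j

theorem map_serR {B : Type*} (r : ℕ → ℕ → Matrix (B × B) (B × B) ℂ) (x y : B × B) :
    MvPowerSeries.map (j : A →+* C) (serR K A r x y) = serR K C r x y := by
  ext d
  rw [MvPowerSeries.coeff_map, serR, serR, coeff_serU₁₂, coeff_serU₁₂]
  split_ifs
  · exact algHom_scal j _
  · exact map_zero j

theorem map_shiftHom (L c : ℂ) (φ : MvPowerSeries (Fin 2) A) :
    MvPowerSeries.map (j : A →+* C) (shiftHom K L c φ) =
      shiftHom K L c (MvPowerSeries.map (j : A →+* C) φ) := by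
  ext d
  rw [MvPowerSeries.coeff_map, coeff_shiftHom, coeff_shiftHom, MvPowerSeries.coeff_map]
  exact map_smul j _ _

end Series

/-- The matrix of products `a_x^z b_y^w`, with rows `(x, y)` and columns `(z, w)`. -/
def pairMat {B W : Type*} [Mul W] (a b : Matrix B B W) : Matrix (B × B) (B × B) W :=
  fun p q => a p.1 q.1 * b p.2 q.2

theorem pairMat_mul {B W : Type*} [Fintype B] [Ring W] {a₁ a₂ b₁ b₂ : Matrix B B W}
    (h : ∀ x y z w, a₂ x y * b₁ z w = b₁ z w * a₂ x y) :
    pairMat a₁ a₂ * pairMat b₁ b₂ = pairMat (a₁ * b₁) (a₂ * b₂) := by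
  ext p q
  simp only [Matrix.mul_apply, pairMat, Fintype.sum_prod_type, Finset.sum_mul, Finset.mul_sum]
  rw [Finset.sum_comm]
  refine Finset.sum_congr rfl fun k _ => Finset.sum_congr rfl fun l _ => ?_
  rw [mul_assoc, ← mul_assoc (a₂ _ _), h, mul_assoc, mul_assoc]

/-- The relation `R T T = T T R` in terms of matrices. -/
theorem rtt_iff_pairMat {B W : Type*} [Fintype B] [Ring W] {a b : Matrix B B W}
    {R : B × B → B × B → W} (hR : ∀ p q w, R p q * w = w * R p q) :
    (∀ x y z w, ∑ z', ∑ w', R (z, w) (z', w') * a x z' * b y w' =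
      ∑ x', ∑ y', b x' z * a y' w * R (x', y') (x, y)) ↔
    pairMat a b * (Matrix.of R).transpose = (Matrix.of R).transpose * pairMat b a := by
  have h1 : ∀ x y z w, ∑ z', ∑ w', R (z, w) (z', w') * a x z' * b y w' =
      (pairMat a b * (Matrix.of R).transpose) (x, y) (z, w) := fun x y z w => by
    simp only [Matrix.mul_apply, pairMat, Fintype.sum_prod_type, Matrix.transpose_apply,
      Matrix.of_apply, mul_assoc, hR]
  have h2 : ∀ x y z w, ∑ x', ∑ y', b x' z * a y' w * R (x', y') (x, y) =
      ((Matrix.of R).transpose * pairMat b a) (x, y) (z, w) := fun x y z w => by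
    simp only [Matrix.mul_apply, pairMat, Fintype.sum_prod_type, Matrix.transpose_apply,
      Matrix.of_apply, hR]
  simp only [h1, h2]
  constructor
  · intro h
    ext ⟨x, y⟩ ⟨z, w⟩
    exact h x y z w
  · intro h x y z w
    rw [h]


section

variable {K π B C : Type*} [Groupoid π] [Finite π] [∀ a b : π, Finite (a ⟶ b)]
    [Fintype B] [CommRing K] [Algebra ℂ K] [Ring C] [Algebra K C] {deg : B → Arr π}
    {L lam : ℂ} {r : ℕ → ℕ → Matrix (B × B) (B × B) ℂ} {ωc σc : ℕ → Matrix B B ℂ}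
    {E : Arr π → C} {X : Bool → ℕ → ℕ → C} {T : B → B → ℕ → ℕ → C}

theorem IsRep.E_mul_T (h : IsRep K deg L lam r ωc σc E X T) {f : Arr π} {x y : B} (n m : ℕ)
    (hf : ¬ (f.src = (deg x).src ∧ f.tgt = (deg y).src)) : E f * T x y n m = 0 := by
  rw [← h.T_unit, ← mul_assoc, Finset.mul_sum]
  refine Finset.sum_eq_zero fun g _ => h.square f g x y n m ?_
  rintro ⟨⟨α, h1, h2⟩, rfl, rfl⟩
  exact hf ⟨by rw [α.top_src, h1], by rw [α.top_tgt, h2]⟩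

theorem IsRep.T_mul_E (h : IsRep K deg L lam r ωc σc E X T) {g : Arr π} {x y : B} (n m : ℕ)
    (hg : ¬ (g.src = (deg x).tgt ∧ g.tgt = (deg y).tgt)) : T x y n m * E g = 0 := by
  rw [← h.unit_T, Finset.sum_mul, Finset.sum_mul]
  refine Finset.sum_eq_zero fun f _ => h.square f g x y n m ?_
  rintro ⟨⟨α, h1, h2⟩, rfl, rfl⟩
  exact hg ⟨by rw [α.bot_src, h1], by rw [α.bot_tgt, h2]⟩

/-- A sum of orthogonal idempotents acts as the identity or as zero on an element that is
supported on one fibre of the map `p`. -/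
theorem sum_fibre_mul {ι P : Type*} [Fintype ι] [DecidableEq P] (E : ι → C) (p : ι → P) (a : C)
    (c₀ : P) (h1 : (∑ f, E f) * a = a) (h0 : ∀ f, p f ≠ c₀ → E f * a = 0) (c : P) :
    (∑ f with p f = c, E f) * a = if c = c₀ then a else 0 := by
  rw [Finset.sum_mul]
  split_ifs with hc
  · rw [Finset.sum_filter]
    conv_rhs => rw [← h1, Finset.sum_mul]
    refine Finset.sum_congr rfl fun f _ => ?_
    split_ifs with hf
    · rfl
    · rw [h0 f (hc ▸ hf)]
  · exact Finset.sum_eq_zero fun f hf => h0 f ((Finset.mem_filter.1 hf).2 ▸ hc)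

theorem mul_sum_fibre {ι P : Type*} [Fintype ι] [DecidableEq P] (E : ι → C) (p : ι → P) (a : C)
    (c₀ : P) (h1 : a * (∑ f, E f) = a) (h0 : ∀ f, p f ≠ c₀ → a * E f = 0) (c : P) :
    a * (∑ f with p f = c, E f) = if c = c₀ then a else 0 := by
  rw [Finset.mul_sum]
  split_ifs with hc
  · rw [Finset.sum_filter]
    conv_rhs => rw [← h1, Finset.mul_sum]
    refine Finset.sum_congr rfl fun f _ => ?_
    split_ifs with hf
    · rfl
    · rw [h0 f (hc ▸ hf)]
  · exact Finset.sum_eq_zero fun f hf => h0 f ((Finset.mem_filter.1 hf).2 ▸ hc)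

open scoped Classical in
theorem IsRep.srcSum_mul_T (h : IsRep K deg L lam r ωc σc E X T) (x y : B) (n m : ℕ) (c : π) :
    srcSum E c * T x y n m = if c = (deg x).src then T x y n m else 0 :=
  sum_fibre_mul E Arr.src _ _ (h.unit_T x y n m) (fun _ hf => h.E_mul_T n m fun h' => hf h'.1) c

open scoped Classical in
theorem IsRep.tgtSum_mul_T (h : IsRep K deg L lam r ωc σc E X T) (x y : B) (n m : ℕ) (c : π) :
    tgtSum E c * T x y n m = if c = (deg y).src then T x y n m else 0 :=
  sum_fibre_mul E Arr.tgt _ _ (h.unit_T x y n m) (fun _ hf => h.E_mul_T n m fun h' => hf h'.2) c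

open scoped Classical in
theorem IsRep.T_mul_srcSum (h : IsRep K deg L lam r ωc σc E X T) (x y : B) (n m : ℕ) (c : π) :
    T x y n m * srcSum E c = if c = (deg x).tgt then T x y n m else 0 :=
  mul_sum_fibre E Arr.src _ _ (h.T_unit x y n m) (fun _ hf => h.T_mul_E n m fun h' => hf h'.1) c

open scoped Classical in
theorem IsRep.T_mul_tgtSum (h : IsRep K deg L lam r ωc σc E X T) (x y : B) (n m : ℕ) (c : π) :
    T x y n m * tgtSum E c = if c = (deg y).tgt then T x y n m else 0 :=
  mul_sum_fibre E Arr.tgt _ _ (h.T_unit x y n m) (fun _ hf => h.T_mul_E n m fun h' => hf h'.2) c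

/-- The matrix of the series `T_x^y(u)`. -/
def serT (T : B → B → ℕ → ℕ → C) : Matrix B B (MvPowerSeries (Fin 2) C) :=
  Matrix.of fun x y => ser (T x y)

/-- A matrix of complex series in `p`. -/
def matP (K C : Type*) [CommRing K] [Algebra ℂ K] [Ring C] [Algebra K C] (c : ℕ → Matrix B B ℂ) :
    Matrix B B (MvPowerSeries (Fin 2) C) := Matrix.of (serMat K C c)

/-- The relation of `ω` with `T` in terms of matrices. -/
theorem omega_iff_matrix {M M' : Matrix B B (MvPowerSeries (Fin 2) C)}
    {D : B → B → MvPowerSeries (Fin 2) C} :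
    (∀ x y, ∑ z : B, ∑ w : B, serMat K C ωc z w * M x z * M' y w = D x y) ↔
      M * matP K C ωc * M'.transpose = Matrix.of D := by
  have : ∀ x y, ∑ z : B, ∑ w : B, serMat K C ωc z w * M x z * M' y w =
      (M * matP K C ωc * M'.transpose) x y := fun x y => by
    simp only [Matrix.mul_apply, Finset.sum_mul, Matrix.transpose_apply, matP, Matrix.of_apply,
      serMat_comm]
    exact Finset.sum_comm
  simp only [this]
  exact ⟨fun h => by ext1 x y; exact h x y, fun h x y => by rw [h]; rfl⟩

/-- The relation of `σ` with `T` in terms of matrices. -/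
theorem sigma_iff_matrix {M M' : Matrix B B (MvPowerSeries (Fin 2) C)}
    {D : B → B → MvPowerSeries (Fin 2) C} :
    (∀ z w, ∑ x : B, ∑ y : B, M x z * M' y w * serMat K C σc x y = D z w) ↔
      M.transpose * matP K C σc * M' = Matrix.of D := by
  have : ∀ z w, ∑ x : B, ∑ y : B, M x z * M' y w * serMat K C σc x y =
      (M.transpose * matP K C σc * M') z w := fun x y => by
    simp only [Matrix.mul_apply, Finset.sum_mul, Matrix.transpose_apply, matP, Matrix.of_apply]
    rw [Finset.sum_comm]
    refine Finset.sum_congr rfl fun w _ => Finset.sum_congr rfl fun z _ => ?_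
    rw [mul_assoc, ← serMat_comm, mul_assoc]
  simp only [this]
  exact ⟨fun h => by ext1 x y; exact h x y, fun h x y => by rw [h]; rfl⟩

theorem IsRep.omega_matrix (h : IsRep K deg L lam r ωc σc E X T) :
    (serT T).map (shiftHom K L lam) * matP K C ωc * (serT T).transpose = Matrix.of fun x y =>
      MvPowerSeries.C (srcSum E (deg x).src) * ser (X true) * serMat K C ωc x y :=
  omega_iff_matrix.1 h.omega

theorem IsRep.sigma_matrix (h : IsRep K deg L lam r ωc σc E X T) :
    (serT T).transpose * matP K C σc * (serT T).map (shiftHom K L lam) = Matrix.of fun x y =>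
      MvPowerSeries.C (tgtSum E (deg x).src) * ser (X true) * serMat K C σc x y :=
  sigma_iff_matrix.1 h.sigma

/-- Representations are transported by unital homomorphisms. -/
theorem IsRep.map {A : Type*} [Ring A] [Algebra K A] {E : Arr π → A} {X : Bool → ℕ → ℕ → A}
    {T : B → B → ℕ → ℕ → A} (h : IsRep K deg L lam r ωc σc E X T) (i : A →ₐ[K] C) :
    IsRep K deg L lam r ωc σc (fun f => i (E f)) (fun s n m => i (X s n m))
      (fun x y n m => i (T x y n m)) where
  idem f := by rw [← map_mul, h.idem]
  orth f g hfg := by rw [← map_mul, h.orth f g hfg, map_zero]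
  unit_T x y n m := by rw [← map_sum, ← map_mul, h.unit_T]
  T_unit x y n m := by rw [← map_sum, ← map_mul, h.T_unit]
  unit_X s n m := by rw [← map_sum, ← map_mul, h.unit_X]
  square f g x y n m hf := by rw [← map_mul, ← map_mul, h.square f g x y n m hf, map_zero]
  comm_E s n m f := by rw [← map_mul, h.comm_E, map_mul]
  comm_X s n m s' n' m' := by rw [← map_mul, h.comm_X, map_mul]
  comm_T s n m x y n' m' := by rw [← map_mul, h.comm_T, map_mul]
  inv s := by
    have := congrArg (MvPowerSeries.map (i : A →+* C)) (h.inv s)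
    simp only [map_mul, map_ser, MvPowerSeries.map_C, map_sum] at this
    simpa using this
  rtt x y z w := by
    have := congrArg (MvPowerSeries.map (i : A →+* C)) (h.rtt x y z w)
    simpa only [map_mul, map_sum, map_serR, map_serU₁, map_serU₂, RingHom.coe_coe] using this
  omega x y := by
    have := congrArg (MvPowerSeries.map (i : A →+* C)) (h.omega x y)
    simp only [map_mul, map_sum, map_serMat, map_ser, ser_shift, map_shiftHom, MvPowerSeries.map_C,
      srcSum] at this
    simpa [srcSum, ser_shift] using this
  sigma x y := by
    have := congrArg (MvPowerSeries.map (i : A →+* C)) (h.sigma x y)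
    simp only [map_mul, map_sum, map_serMat, map_ser, ser_shift, map_shiftHom, MvPowerSeries.map_C,
      tgtSum] at this
    simpa [tgtSum, ser_shift] using this

end


section

variable {K π B A C : Type*} [Groupoid π] [Finite π] [∀ a b : π, Finite (a ⟶ b)]
    [Fintype B] [CommRing K] [Algebra ℂ K] [Ring A] [Algebra K A] [Ring C] [Algebra K C]
    {deg : B → Arr π}
    {L lam : ℂ} {r : ℕ → ℕ → Matrix (B × B) (B × B) ℂ} {ωc σc : ℕ → Matrix B B ℂ}
    {E : Arr π → A} {X : Bool → ℕ → ℕ → A} {T : B → B → ℕ → ℕ → A}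

open Finset.HasAntidiagonal (antidiagonal)

open scoped Classical in
/-- The convolution of `E` with itself, for two homomorphisms `i` and `j`. -/
noncomputable def convE (i j : A →ₐ[K] C) (E : Arr π → A) (f : Arr π) : C :=
  ∑ q : Arr π × Arr π with IsComp q.1 q.2 f, i (E q.1) * j (E q.2)

/-- The convolution of `X` with itself, before it is cut down to composable arrows. -/
noncomputable def convXX (i j : A →ₐ[K] C) (X : Bool → ℕ → ℕ → A) (s : Bool) (n m : ℕ) : C :=
  ∑ a ∈ antidiagonal n, ∑ b ∈ antidiagonal m, i (X s a.1 b.1) * j (X s a.2 b.2)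

/-- The convolution of `X` with itself. -/
noncomputable def convX (i j : A →ₐ[K] C) (E : Arr π → A) (X : Bool → ℕ → ℕ → A) (s : Bool)
    (n m : ℕ) : C := (∑ f, convE i j E f) * convXX i j X s n m

/-- The convolution of `T` with itself. -/
noncomputable def convT (i j : A →ₐ[K] C) (T : B → B → ℕ → ℕ → A) (x y : B) (n m : ℕ) : C :=
  ∑ k, ∑ a ∈ antidiagonal n, ∑ b ∈ antidiagonal m, i (T x k a.1 b.1) * j (T k y a.2 b.2)

variable {i j : A →ₐ[K] C}

theorem ser_convXX (s : Bool) : ser (convXX i j X s) =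
    (ser fun n m => i (X s n m)) * ser fun n m => j (X s n m) := by
  rw [ser_mul_ser]
  rfl

theorem ser_convT (x y : B) : ser (convT i j T x y) =
    ∑ k, (ser fun n m => i (T x k n m)) * ser fun n m => j (T k y n m) := by
  simp only [ser_mul_ser]
  exact ser_sum Finset.univ _

open scoped Classical in
/-- Summing over the arrows `h` with a property and their decompositions is summing over the
composable pairs whose composite has this property. -/
theorem sum_isComp {M : Type*} [AddCommMonoid M] (F : Arr π → Arr π → M) {p : Arr π → Prop}
    {p' : Arr π → Arr π → Prop} (hp : ∀ f g h, IsComp f g h → (p h ↔ p' f g)) :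
    ∑ h with p h, ∑ q : Arr π × Arr π with IsComp q.1 q.2 h, F q.1 q.2 =
      ∑ f, ∑ g, if f.tgt = g.src ∧ p' f g then F f g else 0 := by
  simp only [Finset.sum_filter, Fintype.sum_prod_type]
  calc _ = ∑ h, ∑ f, ∑ g, if p h ∧ IsComp f g h then F f g else 0 := by
        refine Finset.sum_congr rfl fun h _ => ?_
        by_cases hh : p h <;> simp [hh]
    _ = ∑ f, ∑ g, ∑ h, if p h ∧ IsComp f g h then F f g else 0 := by
        rw [Finset.sum_comm]
        exact Finset.sum_congr rfl fun f _ => Finset.sum_comm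
    _ = _ := by
        refine Finset.sum_congr rfl fun f _ => Finset.sum_congr rfl fun g _ => ?_
        by_cases hfg : f.tgt = g.src
        · obtain ⟨h, hh⟩ := IsComp.exists_of_eq hfg
          rw [Finset.sum_eq_single h]
          · exact if_congr ⟨fun h' => ⟨hfg, (hp _ _ _ hh).1 h'.1⟩,
              fun h' => ⟨(hp _ _ _ hh).2 h'.2, hh⟩⟩ rfl rfl
          · intro h' _ hne
            exact if_neg fun h'' => hne (h''.2.unique hh)
          · simp
        · rw [if_neg fun h' => hfg h'.1]
          exact Finset.sum_eq_zero fun h _ => if_neg fun h' => hfg h'.2.tgt_eq_src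

/-- The idempotent of the convolution selects pairs of composable arrows. -/
theorem sum_convE : ∑ f, convE i j E f = ∑ g, i (E g) * j (srcSum E g.tgt) := by
  classical
  have := sum_isComp (fun f g => i (E f) * j (E g)) (p := fun _ => True) (p' := fun _ _ => True)
    fun _ _ _ _ => Iff.rfl
  simp only [Finset.filter_true, and_true] at this
  refine this.trans (Finset.sum_congr rfl fun f _ => ?_)
  rw [srcSum, map_sum, Finset.mul_sum, Finset.sum_filter]
  exact Finset.sum_congr rfl fun g _ => if_congr eq_comm rfl rfl

theorem sum_convE' : ∑ f, convE i j E f = ∑ g, i (tgtSum E g.src) * j (E g) := by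
  classical
  have := sum_isComp (fun f g => i (E f) * j (E g)) (p := fun _ => True) (p' := fun _ _ => True)
    fun _ _ _ _ => Iff.rfl
  simp only [Finset.filter_true, and_true] at this
  refine (this.trans Finset.sum_comm).trans (Finset.sum_congr rfl fun f _ => ?_)
  rw [tgtSum, map_sum, Finset.sum_mul, Finset.sum_filter]

theorem mul_mul_mul_of_comm (hij : ∀ a b, i a * j b = j b * i a) (a b a' b' : A) :
    i a * j b * (i a' * j b') = i (a * a') * j (b * b') := by
  rw [mul_assoc, ← mul_assoc (j b), ← hij a' b, map_mul, map_mul, mul_assoc, mul_assoc]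

/-- For an element of the first copy, the idempotent of the convolution restricts the second copy
to the arrows whose source is the target of the top arrow of the element. -/
theorem sum_convE_mul_left (hij : ∀ a b, i a * j b = j b * i a) {a : A} {c₀ : π}
    (ha : ∀ c, tgtSum E c * a = open scoped Classical in if c = c₀ then a else 0) :
    (∑ f, convE i j E f) * i a = i a * j (srcSum E c₀) := by
  classical
  rw [sum_convE', Finset.sum_mul, srcSum, map_sum, Finset.mul_sum, Finset.sum_filter]
  refine Finset.sum_congr rfl fun g _ => ?_
  rw [mul_assoc, ← hij, ← mul_assoc, ← map_mul, ha]
  split_ifs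
  · rfl
  · rw [map_zero, zero_mul]

theorem sum_convE_mul_right {b : A} {c₀ : π}
    (hb : ∀ c, srcSum E c * b = open scoped Classical in if c = c₀ then b else 0) :
    (∑ f, convE i j E f) * j b = i (tgtSum E c₀) * j b := by
  classical
  rw [sum_convE, Finset.sum_mul, tgtSum, map_sum, Finset.sum_mul, Finset.sum_filter]
  refine Finset.sum_congr rfl fun g _ => ?_
  rw [mul_assoc, ← map_mul, hb]
  split_ifs
  · rfl
  · rw [map_zero, mul_zero]

theorem mul_sum_convE_left {a : A} {c₀ : π}
    (ha : ∀ c, a * tgtSum E c = open scoped Classical in if c = c₀ then a else 0) :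
    i a * (∑ f, convE i j E f) = i a * j (srcSum E c₀) := by
  classical
  rw [sum_convE', Finset.mul_sum, srcSum, map_sum, Finset.mul_sum, Finset.sum_filter]
  refine Finset.sum_congr rfl fun g _ => ?_
  rw [← mul_assoc, ← map_mul, ha]
  split_ifs
  · rfl
  · rw [map_zero, zero_mul]

section

theorem IsRep.convE_mul_convE (h : IsRep K deg L lam r ωc σc E X T)
    (hij : ∀ a b, i a * j b = j b * i a) (f g : Arr π) :
    convE i j E f * convE i j E g = open scoped Classical in if f = g then convE i j E f else 0 := by
  classical
  have key : ∀ q q' : Arr π × Arr π, i (E q.1) * j (E q.2) * (i (E q'.1) * j (E q'.2)) =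
      if q = q' then i (E q.1) * j (E q.2) else 0 := fun q q' => by
    rw [mul_mul_mul_of_comm hij, orth_ite h.idem h.orth, orth_ite h.idem h.orth]
    by_cases h1 : q.1 = q'.1 <;> by_cases h2 : q.2 = q'.2 <;> simp [h1, h2, Prod.ext_iff]
  simp only [convE, Finset.sum_mul, Finset.mul_sum, key]
  split_ifs with hfg
  · subst hfg
    refine Finset.sum_congr rfl fun q hq => ?_
    rw [Finset.sum_ite_eq', if_pos hq]
  · refine Finset.sum_eq_zero fun q hq => ?_
    rw [Finset.sum_ite_eq', if_neg]
    intro hq'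
    exact hfg ((Finset.mem_filter.1 hq').2.unique (Finset.mem_filter.1 hq).2)

theorem IsRep.sum_convE_mul_self (h : IsRep K deg L lam r ωc σc E X T)
    (hij : ∀ a b, i a * j b = j b * i a) :
    (∑ f, convE i j E f) * (∑ f, convE i j E f) = ∑ f, convE i j E f := by
  classical
  simp [Finset.sum_mul, Finset.mul_sum, h.convE_mul_convE hij]

theorem IsRep.srcSum_convE (h : IsRep K deg L lam r ωc σc E X T)
    (hij : ∀ a b, i a * j b = j b * i a) (c : π) :
    srcSum (convE i j E) c = (∑ f, convE i j E f) * i (srcSum E c) := by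
  classical
  have := sum_isComp (fun f g => i (E f) * j (E g)) (p := fun f => f.src = c)
    (p' := fun f _ => f.src = c) fun f g h hc => by rw [hc.src_eq]
  rw [sum_convE, Finset.sum_mul]
  refine this.trans (Finset.sum_congr rfl fun f _ => ?_)
  rw [mul_assoc, ← hij, ← mul_assoc, ← map_mul]
  by_cases hf : f.src = c
  · have e : E f * srcSum E c = E f := by
      simp [srcSum, Finset.mul_sum, orth_ite h.idem h.orth, hf]
    rw [e, srcSum, map_sum, Finset.mul_sum, Finset.sum_filter]
    exact Finset.sum_congr rfl fun g _ => if_congr (by rw [eq_comm]; exact and_iff_left hf) rfl rfl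
  · have e : E f * srcSum E c = 0 := by
      simp [srcSum, Finset.mul_sum, orth_ite h.idem h.orth, hf]
    simp [e, hf]

theorem IsRep.tgtSum_convE (h : IsRep K deg L lam r ωc σc E X T) (c : π) :
    tgtSum (convE i j E) c = (∑ f, convE i j E f) * j (tgtSum E c) := by
  classical
  have := sum_isComp (fun f g => i (E f) * j (E g)) (p := fun f => f.tgt = c)
    (p' := fun _ g => g.tgt = c) fun f g h hc => by rw [hc.tgt_eq]
  rw [sum_convE', Finset.sum_mul]
  refine this.trans (Finset.sum_comm.trans (Finset.sum_congr rfl fun f _ => ?_))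
  rw [mul_assoc, ← map_mul]
  by_cases hf : f.tgt = c
  · have e : E f * tgtSum E c = E f := by
      simp [tgtSum, Finset.mul_sum, orth_ite h.idem h.orth, hf]
    rw [e, tgtSum, map_sum, Finset.sum_mul, Finset.sum_filter]
    exact Finset.sum_congr rfl fun g _ => if_congr (and_iff_left hf) rfl rfl
  · have e : E f * tgtSum E c = 0 := by
      simp [tgtSum, Finset.mul_sum, orth_ite h.idem h.orth, hf]
    simp [e, hf]

theorem convXX_comm (hij : ∀ a b, i a * j b = j b * i a) {a b : A}
    (ha : ∀ s n m, X s n m * a = a * X s n m) (hb : ∀ s n m, X s n m * b = b * X s n m)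
    (s : Bool) (n m : ℕ) :
    convXX i j X s n m * (i a * j b) = i a * j b * convXX i j X s n m := by
  simp only [convXX, Finset.sum_mul, Finset.mul_sum, mul_mul_mul_of_comm hij, ha, hb]

theorem IsRep.convXX_comm_convE (h : IsRep K deg L lam r ωc σc E X T)
    (hij : ∀ a b, i a * j b = j b * i a) (s : Bool) (n m : ℕ) (f : Arr π) :
    convXX i j X s n m * convE i j E f = convE i j E f * convXX i j X s n m := by
  simp only [convE, Finset.sum_mul, Finset.mul_sum]
  exact Finset.sum_congr rfl fun q _ => convXX_comm hij (fun s n m => h.comm_E s n m _)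
    (fun s n m => h.comm_E s n m _) s n m

theorem IsRep.convXX_comm_sum (h : IsRep K deg L lam r ωc σc E X T)
    (hij : ∀ a b, i a * j b = j b * i a) (s : Bool) (n m : ℕ) :
    convXX i j X s n m * (∑ f, convE i j E f) = (∑ f, convE i j E f) * convXX i j X s n m := by
  simp only [Finset.sum_mul, Finset.mul_sum, h.convXX_comm_convE hij]

theorem IsRep.convXX_comm_convXX (h : IsRep K deg L lam r ωc σc E X T)
    (hij : ∀ a b, i a * j b = j b * i a) (s : Bool) (n m : ℕ) (s' : Bool) (n' m' : ℕ) :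
    convXX i j X s n m * convXX i j X s' n' m' = convXX i j X s' n' m' * convXX i j X s n m := by
  conv_lhs => rw [convXX.eq_1 i j X s']
  conv_rhs => rw [convXX.eq_1 i j X s']
  simp only [Finset.sum_mul, Finset.mul_sum]
  exact Finset.sum_congr rfl fun _ _ => Finset.sum_congr rfl fun _ _ =>
    convXX_comm hij (fun s n m => h.comm_X s n m _ _ _) (fun s n m => h.comm_X s n m _ _ _) s n m

theorem IsRep.convXX_comm_convT (h : IsRep K deg L lam r ωc σc E X T)
    (hij : ∀ a b, i a * j b = j b * i a) (s : Bool) (n m : ℕ) (x y : B) (n' m' : ℕ) :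
    convXX i j X s n m * convT i j T x y n' m' = convT i j T x y n' m' * convXX i j X s n m := by
  simp only [convT, Finset.sum_mul, Finset.mul_sum]
  exact Finset.sum_congr rfl fun _ _ => Finset.sum_congr rfl fun _ _ => Finset.sum_congr rfl
    fun _ _ => convXX_comm hij (fun s n m => h.comm_T s n m _ _ _ _)
      (fun s n m => h.comm_T s n m _ _ _ _) s n m

theorem IsRep.sum_convE_mul_convT (h : IsRep K deg L lam r ωc σc E X T)
    (hij : ∀ a b, i a * j b = j b * i a) (x y : B) (n m : ℕ) :
    (∑ f, convE i j E f) * convT i j T x y n m = convT i j T x y n m := by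
  classical
  rw [convT, Finset.mul_sum]
  simp only [Finset.mul_sum _ _ (∑ f, convE i j E f)]
  refine Finset.sum_congr rfl fun k _ => Finset.sum_congr rfl fun a _ => Finset.sum_congr rfl
    fun b _ => ?_
  rw [← mul_assoc, sum_convE_mul_left hij (h.tgtSum_mul_T x k a.1 b.1), mul_assoc, ← map_mul,
    h.srcSum_mul_T, if_pos rfl]

theorem IsRep.convT_mul_sum_convE (h : IsRep K deg L lam r ωc σc E X T)
    (hij : ∀ a b, i a * j b = j b * i a) (x y : B) (n m : ℕ) :
    convT i j T x y n m * (∑ f, convE i j E f) = convT i j T x y n m := by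
  classical
  simp only [convT, Finset.sum_mul]
  refine Finset.sum_congr rfl fun k _ => Finset.sum_congr rfl fun a _ => Finset.sum_congr rfl
    fun b _ => ?_
  rw [hij, mul_assoc, mul_sum_convE_left (h.T_mul_tgtSum x k a.1 b.1), hij _ (srcSum _ _),
    ← mul_assoc, ← map_mul, h.T_mul_srcSum, if_pos rfl]

theorem IsRep.convT_square (h : IsRep K deg L lam r ωc σc E X T)
    (hij : ∀ a b, i a * j b = j b * i a) (f g : Arr π) (x y : B) (n m : ℕ)
    (hfg : ¬ ∃ α : Sq.Between (deg x) (deg y), α.1.top = f ∧ α.1.bot = g) :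
    convE i j E f * convT i j T x y n m * convE i j E g = 0 := by
  classical
  simp only [convT, Finset.mul_sum, Finset.sum_mul _ _ (convE i j E g)]
  refine Finset.sum_eq_zero fun k _ => Finset.sum_eq_zero fun a _ => Finset.sum_eq_zero
    fun b _ => ?_
  simp only [convE, Finset.sum_mul, Finset.mul_sum, mul_mul_mul_of_comm hij]
  refine Finset.sum_eq_zero fun q hq => Finset.sum_eq_zero fun q' hq' => ?_
  simp only [Finset.mem_filter, Finset.mem_univ, true_and] at hq hq'
  by_cases h1 : ∃ α : Sq.Between (deg x) (deg k), α.1.top = q'.1 ∧ α.1.bot = q.1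
  · by_cases h2 : ∃ α : Sq.Between (deg k) (deg y), α.1.top = q'.2 ∧ α.1.bot = q.2
    · obtain ⟨⟨α, hα, hα'⟩, hα1, hα2⟩ := h1
      obtain ⟨⟨β, hβ, hβ'⟩, hβ1, hβ2⟩ := h2
      obtain ⟨γ, ⟨-, h3, h4, -⟩, h5, h6⟩ := Sq.exists_hComp (α := α) (β := β)
        (hα'.trans hβ.symm) (by rw [hα1, hβ1]; exact hq') (by rw [hα2, hβ2]; exact hq)
      exact (hfg ⟨⟨γ, h3.trans hα, h4.trans hβ'⟩, h5, h6⟩).elim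
    · rw [h.square _ _ _ _ _ _ h2, map_zero, mul_zero]
  · rw [h.square _ _ _ _ _ _ h1, map_zero, zero_mul]

/-- The matrix of the series `T_x^y(u₁)`. -/
def serT₁ (T : B → B → ℕ → ℕ → C) : Matrix B B (MvPowerSeries (Fin 3) C) :=
  Matrix.of fun x y => serU₁ (T x y)

/-- The matrix of the series `T_x^y(u₂)`. -/
def serT₂ (T : B → B → ℕ → ℕ → C) : Matrix B B (MvPowerSeries (Fin 3) C) :=
  Matrix.of fun x y => serU₂ (T x y)

theorem serT₁_eq_map (T : B → B → ℕ → ℕ → C) : serT₁ T = (serT T).map (substU₁ C) := by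
  ext1 x y
  exact (substU₁_ser _).symm

theorem serT₂_eq_map (T : B → B → ℕ → ℕ → C) : serT₂ T = (serT T).map (substU₂ C) := by
  ext1 x y
  exact (substU₂_ser _).symm

theorem IsRep.rtt_matrix {E : Arr π → C} {X : Bool → ℕ → ℕ → C} {T : B → B → ℕ → ℕ → C}
    (h : IsRep K deg L lam r ωc σc E X T) :
    pairMat (serT₁ T) (serT₂ T) * (Matrix.of (serR K C r)).transpose =
      (Matrix.of (serR K C r)).transpose * pairMat (serT₂ T) (serT₁ T) :=
  (rtt_iff_pairMat fun p q w => serR_comm r p q w).1 h.rtt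

theorem serT_convT : serT (convT i j T) =
    serT (fun x y n m => i (T x y n m)) * serT fun x y n m => j (T x y n m) := by
  ext1 x y
  exact ser_convT x y

theorem ser_convX (s : Bool) : ser (convX i j E X s) = MvPowerSeries.C (∑ f, convE i j E f) *
    ((ser fun n m => i (X s n m)) * ser fun n m => j (X s n m)) := by
  rw [← ser_convXX, ← ser_C_mul]
  rfl

theorem mul_ser_comm (hij : ∀ a b, i a * j b = j b * i a) (s t : ℕ → ℕ → A) :
    (ser fun n m => i (s n m)) * (ser fun n m => j (t n m)) =
      (ser fun n m => j (t n m)) * ser fun n m => i (s n m) :=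
  ser_commute fun _ _ => hij _ _

theorem serU_comm (hij : ∀ a b, i a * j b = j b * i a) (x y z w : B) :
    serT₂ (fun x y n m => i (T x y n m)) x y * serT₁ (fun x y n m => j (T x y n m)) z w =
      serT₁ (fun x y n m => j (T x y n m)) z w * serT₂ (fun x y n m => i (T x y n m)) x y := by
  refine ser_commute fun d e => ?_
  simp only [serT₁, serT₂, Matrix.of_apply, coeff_serU₁, coeff_serU₂]
  split_ifs <;> simp [hij]

theorem serU_comm' (hij : ∀ a b, i a * j b = j b * i a) (x y z w : B) :
    serT₁ (fun x y n m => i (T x y n m)) x y * serT₂ (fun x y n m => j (T x y n m)) z w =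
      serT₂ (fun x y n m => j (T x y n m)) z w * serT₁ (fun x y n m => i (T x y n m)) x y := by
  refine ser_commute fun d e => ?_
  simp only [serT₁, serT₂, Matrix.of_apply, coeff_serU₁, coeff_serU₂]
  split_ifs <;> simp [hij]

theorem IsRep.rtt_conv (h : IsRep K deg L lam r ωc σc E X T)
    (hij : ∀ a b, i a * j b = j b * i a) :
    pairMat (serT₁ (convT i j T)) (serT₂ (convT i j T)) * (Matrix.of (serR K C r)).transpose =
      (Matrix.of (serR K C r)).transpose *
        pairMat (serT₂ (convT i j T)) (serT₁ (convT i j T)) := by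
  have e₁ := congrArg (fun M => M.map (substU₁ C)) (serT_convT (i := i) (j := j) (T := T))
  have e₂ := congrArg (fun M => M.map (substU₂ C)) (serT_convT (i := i) (j := j) (T := T))
  simp only [Matrix.map_mul, ← serT₁_eq_map] at e₁
  simp only [Matrix.map_mul, ← serT₂_eq_map] at e₂
  rw [e₁, e₂, ← pairMat_mul (serU_comm hij), ← pairMat_mul (serU_comm' hij), mul_assoc,
    (h.map j).rtt_matrix, ← mul_assoc, (h.map i).rtt_matrix, mul_assoc]

theorem IsRep.srcSum_convE_mul_sum (h : IsRep K deg L lam r ωc σc E X T)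
    (hij : ∀ a b, i a * j b = j b * i a) (c : π) :
    srcSum (convE i j E) c * (∑ f, convE i j E f) = srcSum (convE i j E) c := by
  classical
  rw [srcSum, Finset.sum_mul]
  exact Finset.sum_congr rfl fun f _ => by simp [Finset.mul_sum, h.convE_mul_convE hij]

theorem IsRep.tgtSum_convE_mul_sum (h : IsRep K deg L lam r ωc σc E X T)
    (hij : ∀ a b, i a * j b = j b * i a) (c : π) :
    tgtSum (convE i j E) c * (∑ f, convE i j E f) = tgtSum (convE i j E) c := by
  classical
  rw [tgtSum, Finset.sum_mul]
  exact Finset.sum_congr rfl fun f _ => by simp [Finset.mul_sum, h.convE_mul_convE hij]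

theorem map_srcSum (i : A →ₐ[K] C) (E : Arr π → A) (c : π) :
    srcSum (fun f => i (E f)) c = i (srcSum E c) := (map_sum i _ _).symm

theorem map_tgtSum (i : A →ₐ[K] C) (E : Arr π → A) (c : π) :
    tgtSum (fun f => i (E f)) c = i (tgtSum E c) := (map_sum i _ _).symm

theorem serT_conv_transpose (hij : ∀ a b, i a * j b = j b * i a) :
    (serT (convT i j T)).transpose = (serT fun x y n m => j (T x y n m)).transpose *
      (serT fun x y n m => i (T x y n m)).transpose := by
  rw [serT_convT]
  ext1 x y
  simp only [Matrix.transpose_apply, Matrix.mul_apply]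
  exact Finset.sum_congr rfl fun k _ => mul_ser_comm hij _ _

/-- The relation for `T(u+λ) ω T(u)ᵗ` holds for a product `T = T₁ T₂` of commuting copies: the
relation of `T₂` is used in the middle of `T₁ (T₂ ω T₂ᵗ) T₁ᵗ`, and then that of `T₁`.  The
idempotents left by the first step combine into that of the convolution. -/
theorem IsRep.omega_conv (h : IsRep K deg L lam r ωc σc E X T)
    (hij : ∀ a b, i a * j b = j b * i a) :
    (serT (convT i j T)).map (shiftHom K L lam) * matP K C ωc * (serT (convT i j T)).transpose =
      Matrix.of fun x y => MvPowerSeries.C (srcSum (convE i j E) (deg x).src) *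
        ser (convX i j E X true) * serMat K C ωc x y := by
  classical
  have hK : ∀ x k, shiftHom K L lam (ser fun n m => i (T x k n m)) *
      MvPowerSeries.C (j (srcSum E (deg k).src)) =
      MvPowerSeries.C (∑ f, convE i j E f) * shiftHom K L lam (ser fun n m => i (T x k n m)) :=
    fun x k => by
      have : (ser fun n m => i (T x k n m)) * MvPowerSeries.C (j (srcSum E (deg k).src)) =
          MvPowerSeries.C (∑ f, convE i j E f) * (ser fun n m => i (T x k n m)) := by
        ext d
        rw [MvPowerSeries.coeff_mul_C, MvPowerSeries.coeff_C_mul, coeff_ser,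
          sum_convE_mul_left hij (h.tgtSum_mul_T _ _ _ _)]
      have := congrArg (shiftHom K L lam) this
      rwa [map_mul, map_mul, shiftHom_C, shiftHom_C] at this
  have hi := (h.map i).omega_matrix
  have hj := (h.map j).omega_matrix
  simp only [map_srcSum] at hi hj
  rw [serT_conv_transpose hij, serT_convT, Matrix.map_mul, ← mul_assoc,
    mul_assoc (Matrix.map _ _) (Matrix.map _ _), mul_assoc (Matrix.map _ _) (_ * matP K C ωc), hj]
  ext1 x y
  rw [Matrix.of_apply, ser_convX, h.srcSum_convE hij]
  have hi' := congrFun (congrFun hi x) y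
  rw [Matrix.of_apply] at hi'
  trans MvPowerSeries.C (∑ f, convE i j E f) *
    ((serT fun x y n m => i (T x y n m)).map (shiftHom K L lam) * matP K C ωc *
      (serT fun x y n m => i (T x y n m)).transpose) x y * ser fun n m => j (X true n m)
  · simp only [Matrix.mul_apply, Finset.sum_mul, Finset.mul_sum]
    refine Finset.sum_congr rfl fun k _ => Finset.sum_congr rfl fun l _ => ?_
    simp only [Matrix.map_apply, Matrix.transpose_apply, serT, matP, Matrix.of_apply]
    rw [← mul_assoc, ← mul_assoc, hK]
    simp only [mul_assoc]
    rw [mul_ser_comm hij, serMat_comm, serMat_comm, mul_assoc]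
  · rw [hi', ← h.srcSum_convE hij, ← mul_assoc (MvPowerSeries.C (srcSum _ _)), ← map_mul,
      h.srcSum_convE_mul_sum hij, h.srcSum_convE hij, map_mul]
    simp only [mul_assoc]
    rw [serMat_comm]

/-- As for `ω`, but in `T(u)ᵗ σ T(u+λ)` it is the relation of the first factor that is used first.
-/
theorem IsRep.sigma_conv (h : IsRep K deg L lam r ωc σc E X T)
    (hij : ∀ a b, i a * j b = j b * i a) :
    (serT (convT i j T)).transpose * matP K C σc * (serT (convT i j T)).map (shiftHom K L lam) =
      Matrix.of fun x y => MvPowerSeries.C (tgtSum (convE i j E) (deg x).src) *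
        ser (convX i j E X true) * serMat K C σc x y := by
  classical
  have hK : ∀ k x, (ser fun n m => j (T k x n m)) *
      MvPowerSeries.C (i (tgtSum E (deg k).src)) =
      MvPowerSeries.C (∑ f, convE i j E f) * (ser fun n m => j (T k x n m)) :=
    fun k x => by
      ext d
      rw [MvPowerSeries.coeff_mul_C, MvPowerSeries.coeff_C_mul, coeff_ser,
        sum_convE_mul_right (h.srcSum_mul_T _ _ _ _), hij]
  have hi := (h.map i).sigma_matrix
  have hj := (h.map j).sigma_matrix
  simp only [map_tgtSum] at hi hj
  rw [serT_conv_transpose hij, serT_convT, Matrix.map_mul, ← mul_assoc,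
    mul_assoc (Matrix.transpose _) (Matrix.transpose _),
    mul_assoc (Matrix.transpose _) (_ * matP K C σc), hi]
  ext1 x y
  rw [Matrix.of_apply, ser_convX, h.tgtSum_convE]
  have hj' := congrFun (congrFun hj x) y
  rw [Matrix.of_apply] at hj'
  have hX : ∀ φ : ℕ → ℕ → A, (ser fun n m => i (X true n m)) *
    shiftHom K L lam (ser fun n m => j (φ n m)) =
      shiftHom K L lam (ser fun n m => j (φ n m)) * ser fun n m => i (X true n m) := fun φ =>
    ser_commute fun d e => by
      rw [coeff_shiftHom, coeff_ser, coeff_ser, mul_smul_comm, smul_mul_assoc, hij]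
  trans MvPowerSeries.C (∑ f, convE i j E f) *
    ((serT fun x y n m => j (T x y n m)).transpose * matP K C σc *
      (serT fun x y n m => j (T x y n m)).map (shiftHom K L lam)) x y * ser fun n m => i (X true n m)
  · simp only [Matrix.mul_apply, Finset.sum_mul, Finset.mul_sum]
    refine Finset.sum_congr rfl fun k _ => Finset.sum_congr rfl fun l _ => ?_
    simp only [Matrix.map_apply, Matrix.transpose_apply, serT, matP, Matrix.of_apply]
    rw [← mul_assoc, ← mul_assoc, hK]
    simp only [mul_assoc]
    rw [← hX, serMat_comm, serMat_comm, mul_assoc]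
  · rw [hj', ← h.tgtSum_convE, ← mul_assoc (MvPowerSeries.C (tgtSum _ _)), ← map_mul,
      h.tgtSum_convE_mul_sum hij, h.tgtSum_convE, map_mul]
    simp only [mul_assoc]
    rw [serMat_comm, ← mul_assoc (ser fun n m => j (X true n m)), ← mul_ser_comm hij,
      mul_assoc]

/-- The product of two commuting copies of a representation, for the comultiplication of matrix
elements. -/
theorem IsRep.conv (h : IsRep K deg L lam r ωc σc E X T) (h1 : ∑ f, E f = 1)
    (hij : ∀ a b, i a * j b = j b * i a) :
    IsRep K deg L lam r ωc σc (convE i j E) (convX i j E X) (convT i j T) where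
  idem f := by classical rw [h.convE_mul_convE hij, if_pos rfl]
  orth f g hfg := by classical rw [h.convE_mul_convE hij, if_neg hfg]
  unit_T := h.sum_convE_mul_convT hij
  T_unit := h.convT_mul_sum_convE hij
  unit_X s n m := by rw [convX, ← mul_assoc, h.sum_convE_mul_self hij]
  square := h.convT_square hij
  comm_E s n m f := by
    classical
    have e1 : (∑ g, convE i j E g) * convE i j E f = convE i j E f := by
      simp [Finset.sum_mul, h.convE_mul_convE hij]
    have e2 : convE i j E f * (∑ g, convE i j E g) = convE i j E f := by
      simp [Finset.mul_sum, h.convE_mul_convE hij]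
    rw [convX, mul_assoc, h.convXX_comm_convE hij, ← mul_assoc, e1, ← mul_assoc, e2]
  comm_X s n m s' n' m' := by
    rw [convX, convX, mul_assoc, ← mul_assoc (convXX _ _ _ _ _ _), h.convXX_comm_sum hij,
      mul_assoc (∑ f, convE i j E f) (convXX _ _ _ _ _ _), h.convXX_comm_convXX hij s,
      mul_assoc (∑ f, convE i j E f), ← mul_assoc (convXX _ _ _ s' _ _) (∑ f, convE i j E f),
      h.convXX_comm_sum hij s', mul_assoc _ (convXX _ _ _ s' _ _)]
  comm_T s n m x y n' m' := by
    rw [convX, mul_assoc, h.convXX_comm_convT hij, ← mul_assoc, h.sum_convE_mul_convT hij,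
      ← mul_assoc, h.convT_mul_sum_convE hij]
  inv s := by
    have hi := (h.map i).inv s
    have hj := (h.map j).inv s
    simp only [← map_sum, h1, map_one] at hi hj
    rw [ser_convX, ser_convX]
    have e : ((ser fun n m => i (X s n m)) * ser fun n m => j (X s n m)) *
        MvPowerSeries.C (∑ f, convE i j E f) = MvPowerSeries.C (∑ f, convE i j E f) *
        ((ser fun n m => i (X s n m)) * ser fun n m => j (X s n m)) := by
      ext d
      rw [← ser_convXX, MvPowerSeries.coeff_mul_C, MvPowerSeries.coeff_C_mul, coeff_ser,
        h.convXX_comm_sum hij]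
    rw [mul_assoc, ← mul_assoc _ (MvPowerSeries.C _) (_ * _), e, mul_assoc, ← mul_assoc,
      ← map_mul, h.sum_convE_mul_self hij, mul_assoc (ser _),
      ← mul_assoc (ser fun n m => j (X s n m)), ← mul_ser_comm hij, mul_assoc (ser _), hj, mul_one,
      hi, mul_one]
  rtt := (rtt_iff_pairMat (a := serT₁ _) (b := serT₂ _) fun p q w => serR_comm r p q w).2
    (h.rtt_conv hij)
  omega := omega_iff_matrix.2 (h.omega_conv hij)
  sigma := sigma_iff_matrix.2 (h.sigma_conv hij)

end

end


/-! ### Inverses of matrices with noncommuting entries -/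

section Matrices

variable {B W : Type*} [Fintype B] [Ring W]

/-- The matrix of products `b_y^w a_x^z`, with rows `(x, y)` and columns `(z, w)`. -/
def revPairMat (a b : Matrix B B W) : Matrix (B × B) (B × B) W :=
  fun p q => b p.2 q.2 * a p.1 q.1

theorem transpose_mul_of_comm {c M : Matrix B B W}
    (hc : ∀ x y w, c x y * w = w * c x y) : (c * M).transpose = M.transpose * c.transpose := by
  ext x y
  simp only [Matrix.transpose_apply, Matrix.mul_apply, hc]

theorem transpose_mul_of_comm' {c M : Matrix B B W}
    (hc : ∀ x y w, c x y * w = w * c x y) : (M * c).transpose = c.transpose * M.transpose := by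
  ext x y
  simp only [Matrix.transpose_apply, Matrix.mul_apply, hc]

/-- The inner products, of `a₂` and `b₂`, give idempotents `p`, which the entries of `a₁` absorb or
annihilate. -/
theorem pairMat_mul_revPairMat [DecidableEq B] {a₁ a₂ b₁ b₂ : Matrix B B W} {p : B → W}
    {comp : B → B → Prop} [∀ x y, Decidable (comp x y)]
    (h₁ : a₁ * b₁ = Matrix.diagonal p) (h₂ : a₂ * b₂ = Matrix.diagonal p)
    (hp : ∀ x k y, a₁ x k * p y = if comp x y then a₁ x k else 0) :
    pairMat a₁ a₂ * revPairMat b₁ b₂ =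
      Matrix.diagonal fun i => if comp i.1 i.2 then p i.1 else 0 := by
  ext ⟨x, y⟩ ⟨z, w⟩
  have e2 : ∀ y w, ∑ l, a₂ y l * b₂ l w = if y = w then p y else 0 := fun y w => by
    rw [← Matrix.mul_apply, h₂, Matrix.diagonal_apply]
  have e1 : ∀ y w, ∑ l, a₁ y l * b₁ l w = if y = w then p y else 0 := fun y w => by
    rw [← Matrix.mul_apply, h₁, Matrix.diagonal_apply]
  calc _ = ∑ k, a₁ x k * (∑ l, a₂ y l * b₂ l w) * b₁ k z := by
        simp only [Matrix.mul_apply, pairMat, revPairMat, Fintype.sum_prod_type, Finset.mul_sum,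
          Finset.sum_mul, mul_assoc]
    _ = _ := by
        rw [e2, Matrix.diagonal_apply]
        by_cases hy : y = w
        · subst hy
          by_cases hc : comp x y <;> simp [hp, hc, e1]
        · simp [hy]

theorem revPairMat_mul_pairMat [DecidableEq B] {a₁ a₂ b₁ b₂ : Matrix B B W} {q : B → W}
    {comp : B → B → Prop} [∀ x y, Decidable (comp x y)]
    (h₁ : b₁ * a₁ = Matrix.diagonal q) (h₂ : b₂ * a₂ = Matrix.diagonal q)
    (hq : ∀ x l w, q x * a₂ l w = if comp x w then a₂ l w else 0) :
    revPairMat b₁ b₂ * pairMat a₁ a₂ =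
      Matrix.diagonal fun i => if comp i.1 i.2 then q i.2 else 0 := by
  ext ⟨x, y⟩ ⟨z, w⟩
  have e2 : ∀ y w, ∑ l, b₂ y l * a₂ l w = if y = w then q y else 0 := fun y w => by
    rw [← Matrix.mul_apply, h₂, Matrix.diagonal_apply]
  have e1 : ∀ y w, ∑ l, b₁ y l * a₁ l w = if y = w then q y else 0 := fun y w => by
    rw [← Matrix.mul_apply, h₁, Matrix.diagonal_apply]
  calc _ = ∑ l, b₂ y l * ((∑ k, b₁ x k * a₁ k z) * a₂ l w) := by
        simp only [Matrix.mul_apply, pairMat, revPairMat, Fintype.sum_prod_type, Finset.mul_sum,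
          Finset.sum_mul, mul_assoc]
        exact Finset.sum_comm
    _ = _ := by
        rw [e1, Matrix.diagonal_apply]
        by_cases hx : x = z
        · subst hx
          by_cases hc : comp x w
          · by_cases hy : y = w
            · subst hy
              simp [hq, hc, e2]
            · simp [hq, hc, e2, hy]
          · by_cases hy : y = w
            · subst hy
              simp [hq, hc]
            · simp [hq, hc, hy]
        · simp [hx]

/-- If `Q` intertwines the products `a₁ a₂` and `a₂ a₁`, then it intertwines the opposite products
of the inverse matrices `b₁` and `b₂`.  The products `a b` and `b a` are only required to be
diagonal, with entries that act as the identity where this is needed. -/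
theorem intertwine_inverse [DecidableEq B] {Q : Matrix (B × B) (B × B) W}
    {a₁ a₂ b₁ b₂ : Matrix B B W} {p q : B → W} {comp : B → B → Prop}
    (hQ : ∀ i j w, Q i j * w = w * Q i j)
    (hQ0 : ∀ x y z w, ¬ (comp x y ∧ comp z w ∧ p x = p z ∧ q y = q w) → Q (x, y) (z, w) = 0)
    (h : Q * pairMat a₁ a₂ = pairMat a₂ a₁ * Q)
    (hab₁ : a₁ * b₁ = Matrix.diagonal p) (hab₂ : a₂ * b₂ = Matrix.diagonal p)
    (hba₁ : b₁ * a₁ = Matrix.diagonal q) (hba₂ : b₂ * a₂ = Matrix.diagonal q)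
    (hp : ∀ x k y, a₁ x k * p y = open scoped Classical in if comp x y then a₁ x k else 0)
    (hq : ∀ x l w, q x * a₁ l w = open scoped Classical in if comp x w then a₁ l w else 0)
    (hqb : ∀ x y, q x * b₂ x y = b₂ x y) (hbp : ∀ x y, b₂ x y * p y = b₂ x y) :
    Q * revPairMat b₁ b₂ = revPairMat b₂ b₁ * Q := by
  classical
  have h1 := pairMat_mul_revPairMat hab₁ hab₂ hp
  have h2 := revPairMat_mul_pairMat hba₂ hba₁ hq
  have key : revPairMat b₂ b₁ * Q * Matrix.diagonal (fun i => if comp i.1 i.2 then p i.1 else 0) =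
      Matrix.diagonal (fun i => if comp i.1 i.2 then q i.2 else 0) * (Q * revPairMat b₁ b₂) := by
    rw [← h1, ← h2, mul_assoc, ← mul_assoc Q, h]
    simp only [mul_assoc]
  have e1 : revPairMat b₂ b₁ * Q * Matrix.diagonal (fun i => if comp i.1 i.2 then p i.1 else 0) =
      revPairMat b₂ b₁ * Q := by
    ext i ⟨z, w⟩
    rw [Matrix.mul_diagonal, Matrix.mul_apply, Finset.sum_mul]
    refine Finset.sum_congr rfl fun ⟨x, y⟩ _ => ?_
    by_cases h0 : comp x y ∧ comp z w ∧ p x = p z ∧ q y = q w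
    · rw [if_pos h0.2.1, ← h0.2.2.1, mul_assoc, hQ, ← mul_assoc]
      congr 1
      rw [revPairMat, mul_assoc, hbp]
    · rw [hQ0 _ _ _ _ h0, mul_zero, zero_mul]
  have e2 : Matrix.diagonal (fun i => if comp i.1 i.2 then q i.2 else 0) * (Q * revPairMat b₁ b₂) =
      Q * revPairMat b₁ b₂ := by
    ext ⟨x, y⟩ i
    rw [Matrix.diagonal_mul, Matrix.mul_apply, Finset.mul_sum]
    refine Finset.sum_congr rfl fun ⟨z, w⟩ _ => ?_
    by_cases h0 : comp x y ∧ comp z w ∧ p x = p z ∧ q y = q w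
    · rw [if_pos h0.1, h0.2.2.2, ← mul_assoc, ← hQ, mul_assoc]
      congr 1
      rw [revPairMat, ← mul_assoc, hqb]
    · rw [hQ0 _ _ _ _ h0, zero_mul, mul_zero]
  rw [← e2, ← key, e1]

/-- The matrix `ζ c Mᵗ d`. -/
def twist (ζ : W) (c d M : Matrix B B W) : Matrix B B W :=
  Matrix.of fun x y => ζ * (c * M.transpose * d) x y

theorem twist_apply (ζ : W) (c d M : Matrix B B W) (x y : B) :
    twist ζ c d M x y = ζ * ∑ k, ∑ l, c x l * M k l * d k y := by
  simp only [twist, Matrix.of_apply, Matrix.mul_apply, Matrix.transpose_apply, Finset.sum_mul]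

theorem twist_eq_smul (ζ : W) (c d M : Matrix B B W) :
    twist ζ c d M = ζ • (c * M.transpose * d) := rfl

theorem mul_smul_of_comm {ζ : W} (hζ : ∀ w, ζ * w = w * ζ) (M N : Matrix B B W) :
    M * (ζ • N) = ζ • (M * N) := by
  ext x y
  simp only [Matrix.mul_apply, Matrix.smul_apply, smul_eq_mul, Finset.mul_sum]
  refine Finset.sum_congr rfl fun k _ => ?_
  rw [← mul_assoc, ← hζ, mul_assoc]

theorem transpose_twist {ζ : W} {c d M : Matrix B B W}
    (hc : ∀ x y w, c x y * w = w * c x y) (hd : ∀ x y w, d x y * w = w * d x y) :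
    (twist ζ c d M).transpose = ζ • (d.transpose * M * c.transpose) := by
  rw [twist_eq_smul, Matrix.transpose_smul, transpose_mul_of_comm' hd, transpose_mul_of_comm hc,
    Matrix.transpose_transpose, mul_assoc]

/-- Twisting with the transposed matrices and the inverse scalar undoes a twist. -/
theorem twist_twist [DecidableEq B] {ζ ζ' : W} {c d M : Matrix B B W}
    (hζ' : ∀ w, ζ' * w = w * ζ') (h1 : ζ * ζ' = 1)
    (hc : ∀ x y w, c x y * w = w * c x y) (hd : ∀ x y w, d x y * w = w * d x y) (hcd : c * d = 1) :
    twist ζ c d (twist ζ' c.transpose d.transpose M) = M := by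
  rw [twist_eq_smul, transpose_twist (c := c.transpose) (d := d.transpose)
      (fun x y => hc y x) (fun x y => hd y x),
    Matrix.transpose_transpose, Matrix.transpose_transpose, mul_smul_of_comm hζ',
    Matrix.smul_mul, smul_smul, h1, one_smul, mul_assoc d, ← mul_assoc, hcd, one_mul, mul_assoc,
    hcd, mul_one]

theorem twist_map {W' : Type*} [Ring W'] (φ : W →+* W') (ζ : W) (c d M : Matrix B B W) :
    (twist ζ c d M).map φ = twist (φ ζ) (c.map φ) (d.map φ) (M.map φ) := by
  ext x y
  simp only [Matrix.map_apply, twist_apply, map_mul, map_sum]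

theorem mul_twist_mul {ζ : W} {c d M : Matrix B B W} (hζ : ∀ w, ζ * w = w * ζ)
    (hc : ∀ x y w, c x y * w = w * c x y) (hd : ∀ x y w, d x y * w = w * d x y) (a b : W)
    (x y : B) : a * twist ζ c d M x y * b = ζ * ∑ k, ∑ l, c x l * (a * M k l * b) * d k y := by
  rw [twist_apply, ← mul_assoc a, ← hζ, mul_assoc, mul_assoc]
  congr 1
  simp only [Finset.sum_mul, Finset.mul_sum]
  refine Finset.sum_congr rfl fun k _ => Finset.sum_congr rfl fun l _ => ?_
  rw [mul_assoc _ (d k y) b, hd k y b, ← mul_assoc, ← mul_assoc, ← mul_assoc, ← hc, ← mul_assoc,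
    ← mul_assoc]

theorem mul_diagonal_of_comm [DecidableEq B] {c : Matrix B B W} {a a' : B → W}
    (hc : ∀ x y w, c x y * w = w * c x y) (h : ∀ x k, c x k = 0 ∨ a k = a' x) :
    c * Matrix.diagonal a = Matrix.diagonal a' * c := by
  ext x k
  rw [Matrix.mul_diagonal, Matrix.diagonal_mul, hc]
  rcases h x k with h | h
  · rw [h, mul_zero, mul_zero]
  · rw [h]

theorem of_mul_eq_diagonal_mul [DecidableEq B] (a : B → W) (c : Matrix B B W) :
    (Matrix.of fun x y => a x * c x y) = Matrix.diagonal a * c := by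
  ext x y
  rw [Matrix.diagonal_mul]
  rfl

end Matrices


/-! ### The antipode and its inverse -/

section

variable {K π B A : Type*} [Groupoid π] [Finite π] [∀ a b : π, Finite (a ⟶ b)]
    [Fintype B] [CommRing K] [Algebra ℂ K] [Ring A] [Algebra K A]
    {deg : B → Arr π}
    {L lam : ℂ} {r : ℕ → ℕ → Matrix (B × B) (B × B) ℂ} {ωc σc : ℕ → Matrix B B ℂ}
    {E : Arr π → A} {X : Bool → ℕ → ℕ → A} {T : B → B → ℕ → ℕ → A}

open MulOpposite (op)

open scoped Classical in
theorem IsRep.serT_mul_srcSum (h : IsRep K deg L lam r ωc σc E X T) (x y : B) (c : π) :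
    serT T x y * MvPowerSeries.C (srcSum E c) = if c = (deg x).tgt then serT T x y else 0 := by
  ext d
  rw [MvPowerSeries.coeff_mul_C, serT, Matrix.of_apply, coeff_ser, h.T_mul_srcSum]
  split_ifs <;> rfl

open scoped Classical in
theorem IsRep.serT_mul_tgtSum (h : IsRep K deg L lam r ωc σc E X T) (x y : B) (c : π) :
    serT T x y * MvPowerSeries.C (tgtSum E c) = if c = (deg y).tgt then serT T x y else 0 := by
  ext d
  rw [MvPowerSeries.coeff_mul_C, serT, Matrix.of_apply, coeff_ser, h.T_mul_tgtSum]
  split_ifs <;> rfl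

open scoped Classical in
theorem IsRep.srcSum_mul_serT (h : IsRep K deg L lam r ωc σc E X T) (x y : B) (c : π) :
    MvPowerSeries.C (srcSum E c) * serT T x y = if c = (deg x).src then serT T x y else 0 := by
  ext d
  rw [MvPowerSeries.coeff_C_mul, serT, Matrix.of_apply, coeff_ser, h.srcSum_mul_T]
  split_ifs <;> rfl

open scoped Classical in
theorem IsRep.tgtSum_mul_serT (h : IsRep K deg L lam r ωc σc E X T) (x y : B) (c : π) :
    MvPowerSeries.C (tgtSum E c) * serT T x y = if c = (deg y).src then serT T x y else 0 := by
  ext d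
  rw [MvPowerSeries.coeff_C_mul, serT, Matrix.of_apply, coeff_ser, h.tgtSum_mul_T]
  split_ifs <;> rfl

/-- The values of the antipode on `T_x^y(u)`, the matrix `ξ⁻(u-λ) ω T(u-λ)ᵗ σ`. -/
noncomputable def antiT (K : Type*) [CommRing K] [Algebra ℂ K] [Algebra K A] (L lam : ℂ)
    (ωc σc : ℕ → Matrix B B ℂ) (X : Bool → ℕ → ℕ → A) (T : B → B → ℕ → ℕ → A) :
    Matrix B B (MvPowerSeries (Fin 2) A) :=
  twist (shiftHom K L (-lam) (ser (X false))) (matP K A ωc) (matP K A σc)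
    ((serT T).map (shiftHom K L (-lam)))

/-- The values of the inverse of the antipode on `T_x^y(u)`, the matrix `ξ⁻(u) ωᵗ T(u+λ)ᵗ σᵗ`. -/
noncomputable def antiInvT (K : Type*) [CommRing K] [Algebra ℂ K] [Algebra K A] (L lam : ℂ)
    (ωc σc : ℕ → Matrix B B ℂ) (X : Bool → ℕ → ℕ → A) (T : B → B → ℕ → ℕ → A) :
    Matrix B B (MvPowerSeries (Fin 2) A) :=
  twist (ser (X false)) (matP K A ωc).transpose (matP K A σc).transpose
    ((serT T).map (shiftHom K L lam))

theorem matP_comm (c : ℕ → Matrix B B ℂ) (x y : B) (w : MvPowerSeries (Fin 2) A) :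
    matP K A c x y * w = w * matP K A c x y := serMat_comm c x y w

theorem matP_map_shiftHom (c : ℕ → Matrix B B ℂ) (s : ℂ) :
    (matP K A c).map (shiftHom K L s) = matP K A c := by
  ext1 x y
  simp only [Matrix.map_apply, matP, Matrix.of_apply, serMat, shiftHom_serP]

theorem map_shiftHom_map (M : Matrix B B (MvPowerSeries (Fin 2) A)) (s t : ℂ) :
    (M.map (shiftHom K L s)).map (shiftHom K L t) = M.map (shiftHom K L (t + s)) := by
  ext1 x y
  exact shiftHom_add (K := K) L t s _

theorem map_shiftHom_zero (M : Matrix B B (MvPowerSeries (Fin 2) A)) :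
    M.map (shiftHom K L 0) = M := by
  ext1 x y
  exact shiftHom_zero (K := K) L _

theorem GradedForm.matP_eq_zero {c : ℕ → Matrix B B ℂ} (h : GradedForm deg c) {x y : B}
    (hn : deg y ≠ (deg x).inv) : matP K A c x y = 0 := h.serMat_eq_zero hn

section

theorem ser_X_comm (hX : ∀ s n m a, X s n m * a = a * X s n m) (s : Bool)
    (w : MvPowerSeries (Fin 2) A) : ser (X s) * w = w * ser (X s) :=
  ser_commute fun _ _ => hX _ _ _ _

theorem shift_X_comm (hX : ∀ s n m a, X s n m * a = a * X s n m) (s : Bool) (t : ℂ)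
    (w : MvPowerSeries (Fin 2) A) :
    shiftHom K L t (ser (X s)) * w = w * shiftHom K L t (ser (X s)) :=
  ser_commute fun _ _ => by
    rw [coeff_shiftHom, smul_mul_assoc, mul_smul_comm, coeff_ser, hX]

theorem IsRep.ser_X_mul (h : IsRep K deg L lam r ωc σc E X T) (h1 : ∑ f, E f = 1) (s : Bool) :
    ser (X s) * ser (X (!s)) = 1 := by rw [h.inv, h1, map_one]

theorem IsRep.omega_diagonal [DecidableEq B] (h : IsRep K deg L lam r ωc σc E X T) (s : ℂ) :
    (serT T).map (shiftHom K L (lam + s)) * matP K A ωc *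
        ((serT T).map (shiftHom K L s)).transpose =
      Matrix.diagonal (fun x => MvPowerSeries.C (srcSum E (deg x).src) *
        shiftHom K L s (ser (X true))) * matP K A ωc := by
  have := congrArg (fun M => M.map (shiftHom K L s)) h.omega_matrix
  rw [Matrix.map_mul, Matrix.map_mul, map_shiftHom_map, matP_map_shiftHom, add_comm s,
    Matrix.transpose_map] at this
  rw [this, ← of_mul_eq_diagonal_mul]
  ext1 x y
  simp only [Matrix.map_apply, Matrix.of_apply, map_mul, shiftHom_C, serMat, shiftHom_serP, matP]

theorem IsRep.sigma_diagonal [DecidableEq B] (h : IsRep K deg L lam r ωc σc E X T) (s : ℂ) :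
    ((serT T).map (shiftHom K L s)).transpose * matP K A σc *
        (serT T).map (shiftHom K L (lam + s)) =
      Matrix.diagonal (fun x => MvPowerSeries.C (tgtSum E (deg x).src) *
        shiftHom K L s (ser (X true))) * matP K A σc := by
  have := congrArg (fun M => M.map (shiftHom K L s)) h.sigma_matrix
  rw [Matrix.map_mul, Matrix.map_mul, map_shiftHom_map, matP_map_shiftHom, add_comm s,
    Matrix.transpose_map] at this
  rw [this, ← of_mul_eq_diagonal_mul]
  ext1 x y
  simp only [Matrix.map_apply, Matrix.of_apply, map_mul, shiftHom_C, serMat, shiftHom_serP, matP]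

theorem smul_diagonal_cancel {W : Type*} [Ring W] [DecidableEq B] {ζ ζ' : W} {a : B → W}
    (h : ζ * ζ' = 1) (hζ : ∀ w, ζ' * w = w * ζ') :
    ζ • Matrix.diagonal (fun x => a x * ζ') = Matrix.diagonal a := by
  rw [← Matrix.diagonal_smul]
  congr 1
  ext x
  rw [Pi.smul_apply, smul_eq_mul, ← hζ, ← mul_assoc, h, one_mul]

/-- The relation of `ω` at `u-λ` says that the matrix `antiT` is a right inverse of `T(u)`, up to
idempotents. -/
theorem IsRep.serT_mul_antiT [DecidableEq B] (h : IsRep K deg L lam r ωc σc E X T)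
    (h1 : ∑ f, E f = 1) (hX : ∀ s n m a, X s n m * a = a * X s n m)
    (hωσ : matP K A ωc * matP K A σc = 1) :
    serT T * antiT K L lam ωc σc X T =
      Matrix.diagonal fun x => MvPowerSeries.C (srcSum E (deg x).src) := by
  have e := h.omega_diagonal (-lam)
  rw [add_neg_cancel, map_shiftHom_zero] at e
  rw [antiT, twist_eq_smul, mul_smul_of_comm (shift_X_comm hX _ _), ← mul_assoc, ← mul_assoc, e,
    mul_assoc, hωσ, mul_one]
  refine smul_diagonal_cancel ?_ (shift_X_comm hX _ _)
  rw [← map_mul]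
  exact (congrArg _ (h.ser_X_mul h1 false)).trans (map_one _)

/-- The relation of `σ` at `u-λ` says that the matrix `antiT` is a left inverse of `T(u)`, up to
idempotents. -/
theorem IsRep.antiT_mul_serT [DecidableEq B] (h : IsRep K deg L lam r ωc σc E X T)
    (h1 : ∑ f, E f = 1) (hX : ∀ s n m a, X s n m * a = a * X s n m) (hω : GradedForm deg ωc)
    (hωσ : matP K A ωc * matP K A σc = 1) :
    antiT K L lam ωc σc X T * serT T =
      Matrix.diagonal fun x => MvPowerSeries.C (tgtSum E (deg x).tgt) := by
  have e := h.sigma_diagonal (-lam)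
  rw [add_neg_cancel, map_shiftHom_zero] at e
  rw [antiT, twist_eq_smul, Matrix.smul_mul, mul_assoc, mul_assoc, ← mul_assoc _ (matP K A σc), e,
    ← mul_assoc, mul_diagonal_of_comm (matP_comm ωc) (a' := fun x =>
      MvPowerSeries.C (tgtSum E (deg x).tgt) * shiftHom K L (-lam) (ser (X true))), mul_assoc, hωσ,
    mul_one]
  · refine smul_diagonal_cancel ?_ (shift_X_comm hX _ _)
    rw [← map_mul]
    exact (congrArg _ (h.ser_X_mul h1 false)).trans (map_one _)
  · intro x k
    by_cases hk : deg k = (deg x).inv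
    · right
      rw [hk]
      rfl
    · exact Or.inl (hω.matP_eq_zero hk)

theorem transpose_antiInvT : (antiInvT K L lam ωc σc X T).transpose =
    ser (X false) • (matP K A σc * (serT T).map (shiftHom K L lam) * matP K A ωc) := by
  rw [antiInvT, transpose_twist (fun x y => matP_comm ωc y x) (fun x y => matP_comm σc y x),
    Matrix.transpose_transpose, Matrix.transpose_transpose]

/-- The relation of `ω` at `u` says that the transpose of `antiInvT` is a left inverse of the
transpose of `T(u)`, up to idempotents. -/
theorem IsRep.antiInvT_mul_serT [DecidableEq B] (h : IsRep K deg L lam r ωc σc E X T)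
    (h1 : ∑ f, E f = 1) (hX : ∀ s n m a, X s n m * a = a * X s n m) (hσ : GradedForm deg σc)
    (hσω : matP K A σc * matP K A ωc = 1) :
    (antiInvT K L lam ωc σc X T).transpose * (serT T).transpose =
      Matrix.diagonal fun x => MvPowerSeries.C (srcSum E (deg x).tgt) := by
  have e := h.omega_diagonal 0
  rw [add_zero, map_shiftHom_zero] at e
  rw [transpose_antiInvT, Matrix.smul_mul, mul_assoc, mul_assoc, ← mul_assoc _ (matP K A ωc), e,
    ← mul_assoc, mul_diagonal_of_comm (matP_comm σc) (a' := fun x =>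
      MvPowerSeries.C (srcSum E (deg x).tgt) * shiftHom K L 0 (ser (X true))), mul_assoc, hσω,
    mul_one, shiftHom_zero]
  · exact smul_diagonal_cancel (h.ser_X_mul h1 false) (ser_X_comm hX true)
  · intro x k
    by_cases hk : deg k = (deg x).inv
    · right
      rw [hk]
      rfl
    · exact Or.inl (hσ.matP_eq_zero hk)

theorem IsRep.serT_mul_antiInvT [DecidableEq B] (h : IsRep K deg L lam r ωc σc E X T)
    (h1 : ∑ f, E f = 1) (hX : ∀ s n m a, X s n m * a = a * X s n m)
    (hσω : matP K A σc * matP K A ωc = 1) :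
    (serT T).transpose * (antiInvT K L lam ωc σc X T).transpose =
      Matrix.diagonal fun x => MvPowerSeries.C (tgtSum E (deg x).src) := by
  have e := h.sigma_diagonal 0
  rw [add_zero, map_shiftHom_zero] at e
  rw [transpose_antiInvT, mul_smul_of_comm (ser_X_comm hX _), ← mul_assoc, ← mul_assoc, e,
    mul_assoc, hσω, mul_one, shiftHom_zero]
  exact smul_diagonal_cancel (h.ser_X_mul h1 false) (ser_X_comm hX true)

/-- A family with the relations of `A_{R,ω}` in the opposite algebra, built from a matrix `N` over
the algebra. -/
theorem IsRep.anti (h : IsRep K deg L lam r ωc σc E X T) (h1 : ∑ f, E f = 1)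
    (hX : ∀ s n m a, X s n m * a = a * X s n m) {N : Matrix B B (MvPowerSeries (Fin 2) A)}
    (hsq : ∀ f g x y, (¬ ∃ α : Sq.Between (deg x) (deg y), α.1.top = f ∧ α.1.bot = g) →
      MvPowerSeries.C (E g.inv) * N x y * MvPowerSeries.C (E f.inv) = 0)
    (hrtt : (Matrix.of (serR K A r)).transpose *
        revPairMat (N.map (substU₂ A)) (N.map (substU₁ A)) =
      revPairMat (N.map (substU₁ A)) (N.map (substU₂ A)) * (Matrix.of (serR K A r)).transpose)
    (hω : ∀ x y, (N * (matP K A ωc).transpose * (N.map (shiftHom K L lam)).transpose) y x =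
      serMat K A ωc x y * ser (X false) * MvPowerSeries.C (tgtSum E (deg x).src))
    (hσ : ∀ z w, ((N.map (shiftHom K L lam)).transpose * (matP K A σc).transpose * N) w z =
      serMat K A σc z w * ser (X false) * MvPowerSeries.C (srcSum E (deg z).src)) :
    IsRep K deg L lam r ωc σc (fun f => op (E f.inv)) (fun s n m => op (X (!s) n m))
      (fun x y n m => op (unser (N x y) n m)) := by
  have hsum : ∑ f : Arr π, op (E f.inv) = 1 := by
    rw [← Finset.op_sum, Fintype.sum_equiv (Arr.invEquiv π) (fun f => E f.inv) E fun _ => rfl, h1]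
    rfl
  have hN : ∀ x y, ser (fun n m => op (unser (N x y) n m)) = opSer (N x y) := fun x y => by
    rw [← opSer_ser, ser_unser]
  have hN₁ : ∀ x y, serU₁ (fun n m => op (unser (N x y) n m)) = opSer (substU₁ A (N x y)) :=
    fun x y => by rw [← opSer_serU₁, ← substU₁_ser, ser_unser]
  have hN₂ : ∀ x y, serU₂ (fun n m => op (unser (N x y) n m)) = opSer (substU₂ A (N x y)) :=
    fun x y => by rw [← opSer_serU₂, ← substU₂_ser, ser_unser]
  have hXop : ∀ s, ser (fun n m => op (X s n m)) = opSer (ser (X s)) := fun s => rfl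
  have hsrc : ∀ c, srcSum (fun f : Arr π => op (E f.inv)) c = op (tgtSum E c) := fun c => by
    classical
    rw [srcSum, tgtSum, Finset.op_sum, Finset.sum_filter, Finset.sum_filter]
    exact Fintype.sum_equiv (Arr.invEquiv π) _ _ fun f => rfl
  have htgt : ∀ c, tgtSum (fun f : Arr π => op (E f.inv)) c = op (srcSum E c) := fun c => by
    classical
    rw [srcSum, tgtSum, Finset.op_sum, Finset.sum_filter, Finset.sum_filter]
    exact Fintype.sum_equiv (Arr.invEquiv π) _ _ fun f => rfl
  refine ⟨fun f => ?_, fun f g hfg => ?_, fun x y n m => ?_, fun x y n m => ?_, fun s n m => ?_,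
    fun f g x y n m hfg => ?_, fun s n m f => ?_, fun s n m s' n' m' => ?_,
    fun s n m x y n' m' => ?_, fun s => ?_, fun x y z w => ?_, fun x y => ?_, fun z w => ?_⟩
  · rw [← MulOpposite.op_mul, h.idem]
  · rw [← MulOpposite.op_mul, h.orth _ _ fun e => hfg (Arr.inv_injective e).symm]
    rfl
  · rw [hsum, one_mul]
  · rw [hsum, mul_one]
  · rw [hsum, one_mul]
  · rw [← MulOpposite.op_mul, ← MulOpposite.op_mul, MulOpposite.op_eq_zero_iff, ← mul_assoc]
    have := congrArg (MvPowerSeries.coeff (Finsupp.equivFunOnFinite.symm ![n, m]))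
      (hsq f g x y hfg)
    rwa [MvPowerSeries.coeff_mul_C, MvPowerSeries.coeff_C_mul] at this
  · rw [← MulOpposite.op_mul, ← MulOpposite.op_mul, hX]
  · rw [← MulOpposite.op_mul, ← MulOpposite.op_mul, hX]
  · rw [← MulOpposite.op_mul, ← MulOpposite.op_mul, hX]
  · rw [hXop, hXop, ← opSer_mul, ser_X_comm hX, h.inv, opSer_C, hsum, h1]
    rfl
  · have := congrArg opSer (congrFun (congrFun hrtt (x, y)) (z, w)).symm
    simpa only [Matrix.mul_apply, revPairMat, Fintype.sum_prod_type, Matrix.transpose_apply,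
      Matrix.of_apply, opSer_sum, opSer_mul, opSer_serR, Matrix.map_apply, ← hN₁, ← hN₂,
      ← mul_assoc] using this
  · have := congrArg opSer (hω x y)
    simp only [Matrix.mul_apply, Matrix.transpose_apply, opSer_sum, opSer_mul, Matrix.map_apply,
      opSer_shiftHom, ← hN, opSer_C, ← hsrc, ← hXop, matP, Matrix.of_apply, opSer_serMat,
      Finset.mul_sum] at this
    rw [← mul_assoc] at this
    refine Eq.trans ?_ this
    refine Finset.sum_congr rfl fun k _ => Finset.sum_congr rfl fun l _ => ?_
    rw [ser_shift, serMat_comm, mul_assoc]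
  · have := congrArg opSer (hσ z w)
    simp only [Matrix.mul_apply, Matrix.transpose_apply, opSer_sum, opSer_mul, Matrix.map_apply,
      opSer_shiftHom, ← hN, opSer_C, ← htgt, ← hXop, matP, Matrix.of_apply, opSer_serMat,
      Finset.mul_sum] at this
    rw [← mul_assoc] at this
    refine Eq.trans ?_ this
    refine Finset.sum_congr rfl fun k _ => Finset.sum_congr rfl fun l _ => ?_
    rw [ser_shift, mul_assoc, ← serMat_comm]

/-- The components of `c T(u)ᵗ d` for graded forms `c` and `d`. -/
theorem IsRep.twist_square (h : IsRep K deg L lam r ωc σc E X T)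
    {ζ : MvPowerSeries (Fin 2) A} {c d : Matrix B B (MvPowerSeries (Fin 2) A)}
    (hζ : ∀ w, ζ * w = w * ζ)
    (hc : ∀ x y w, c x y * w = w * c x y) (hd : ∀ x y w, d x y * w = w * d x y)
    (hc0 : ∀ x y, deg y ≠ (deg x).inv → c x y = 0) (hd0 : ∀ x y, deg y ≠ (deg x).inv → d x y = 0)
    (s : ℂ) (f g : Arr π) (x y : B)
    (hfg : ¬ ∃ α : Sq.Between (deg x) (deg y), α.1.top = f ∧ α.1.bot = g) :
    MvPowerSeries.C (E g.inv) * twist ζ c d ((serT T).map (shiftHom K L s)) x y *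
      MvPowerSeries.C (E f.inv) = 0 := by
  rw [mul_twist_mul hζ hc hd]
  refine mul_eq_zero_of_right _ (Finset.sum_eq_zero fun k _ => Finset.sum_eq_zero fun l _ => ?_)
  by_cases h1 : deg l = (deg x).inv
  · by_cases h2 : deg y = (deg k).inv
    · have : MvPowerSeries.C (E g.inv) * serT T k l * MvPowerSeries.C (E f.inv) = 0 := by
        ext e
        rw [MvPowerSeries.coeff_mul_C, MvPowerSeries.coeff_C_mul, serT, Matrix.of_apply, coeff_ser,
          h.square _ _ _ _ _ _ ?_]
        · rfl
        · rintro ⟨⟨α, h3, h4⟩, h5, h6⟩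
          refine hfg ⟨⟨α.iota, ?_, ?_⟩, ?_, ?_⟩
          · exact (congrArg Arr.inv (h4.trans h1)).trans (Arr.inv_inv _)
          · exact (congrArg Arr.inv h3).trans h2.symm
          · exact (congrArg Arr.inv h6).trans f.inv_inv
          · exact (congrArg Arr.inv h5).trans g.inv_inv
      have := congrArg (shiftHom K L s) this
      rw [map_mul, map_mul, shiftHom_C, shiftHom_C, map_zero] at this
      rw [Matrix.map_apply, this, mul_zero, zero_mul]
    · rw [hd0 _ _ h2, mul_zero]
  · rw [hc0 _ _ h1, zero_mul, zero_mul]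

/-- Elements that act as the identity on all entries that contribute to a twisted matrix act as the
identity on its entries. -/
theorem twist_absorb {W : Type*} [Ring W] {ζ : W} {c d M : Matrix B B W} (hζ : ∀ w, ζ * w = w * ζ)
    (hc : ∀ x y w, c x y * w = w * c x y) (hd : ∀ x y w, d x y * w = w * d x y) {a b : W} {x y : B}
    (h : ∀ k l, c x l = 0 ∨ d k y = 0 ∨ a * M k l * b = M k l) :
    a * twist ζ c d M x y * b = twist ζ c d M x y := by
  rw [mul_twist_mul hζ hc hd, twist_apply]
  congr 1
  refine Finset.sum_congr rfl fun k _ => Finset.sum_congr rfl fun l _ => ?_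
  rcases h k l with h | h | h
  · rw [h, zero_mul, zero_mul, zero_mul, zero_mul]
  · rw [h, mul_zero, mul_zero]
  · rw [h]

theorem IsRep.tgtSum_mul_shift (h : IsRep K deg L lam r ωc σc E X T) (s : ℂ) {x y : B} {c : π}
    (hc : c = (deg y).src) : MvPowerSeries.C (tgtSum E c) * (serT T).map (shiftHom K L s) x y =
      (serT T).map (shiftHom K L s) x y := by
  classical
  have := congrArg (shiftHom K L s) (h.tgtSum_mul_serT x y c)
  rwa [if_pos hc, map_mul, shiftHom_C] at this

theorem IsRep.srcSum_mul_shift (h : IsRep K deg L lam r ωc σc E X T) (s : ℂ) {x y : B} {c : π}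
    (hc : c = (deg x).src) : MvPowerSeries.C (srcSum E c) * (serT T).map (shiftHom K L s) x y =
      (serT T).map (shiftHom K L s) x y := by
  classical
  have := congrArg (shiftHom K L s) (h.srcSum_mul_serT x y c)
  rwa [if_pos hc, map_mul, shiftHom_C] at this

theorem IsRep.shift_mul_srcSum (h : IsRep K deg L lam r ωc σc E X T) (s : ℂ) {x y : B} {c : π}
    (hc : c = (deg x).tgt) :
    (serT T).map (shiftHom K L s) x y * MvPowerSeries.C (srcSum E c) =
      (serT T).map (shiftHom K L s) x y := by
  classical
  have := congrArg (shiftHom K L s) (h.serT_mul_srcSum x y c)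
  rwa [if_pos hc, map_mul, shiftHom_C] at this

theorem IsRep.shift_mul_tgtSum (h : IsRep K deg L lam r ωc σc E X T) (s : ℂ) {x y : B} {c : π}
    (hc : c = (deg y).tgt) :
    (serT T).map (shiftHom K L s) x y * MvPowerSeries.C (tgtSum E c) =
      (serT T).map (shiftHom K L s) x y := by
  classical
  have := congrArg (shiftHom K L s) (h.serT_mul_tgtSum x y c)
  rwa [if_pos hc, map_mul, shiftHom_C] at this

/-- The intertwining relation for inverse matrices, for series with spectral parameters. -/
theorem intertwine_inverse_series [DecidableEq B]
    {Q : Matrix (B × B) (B × B) (MvPowerSeries (Fin 3) A)}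
    {M N : Matrix B B (MvPowerSeries (Fin 2) A)} {p q : B → A}
    (φ₁ φ₂ : MvPowerSeries (Fin 2) A →+* MvPowerSeries (Fin 3) A)
    (hφ₁ : ∀ a, φ₁ (MvPowerSeries.C a) = MvPowerSeries.C a)
    (hφ₂ : ∀ a, φ₂ (MvPowerSeries.C a) = MvPowerSeries.C a)
    (hQ : ∀ i j w, Q i j * w = w * Q i j)
    (hQ0 : ∀ x y z w, ¬ ((deg x).tgt = (deg y).src ∧ (deg z).tgt = (deg w).src ∧ p x = p z ∧
      q y = q w) → Q (x, y) (z, w) = 0)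
    (h : Q * pairMat (M.map φ₁) (M.map φ₂) = pairMat (M.map φ₂) (M.map φ₁) * Q)
    (hMN : M * N = Matrix.diagonal fun x => MvPowerSeries.C (p x))
    (hNM : N * M = Matrix.diagonal fun x => MvPowerSeries.C (q x))
    (hp : ∀ x k y, M x k * MvPowerSeries.C (p y) =
      open scoped Classical in if (deg y).src = (deg x).tgt then M x k else 0)
    (hq : ∀ x l w, MvPowerSeries.C (q x) * M l w =
      open scoped Classical in if (deg x).tgt = (deg w).src then M l w else 0)
    (hqN : ∀ x y, MvPowerSeries.C (q x) * N x y = N x y)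
    (hNp : ∀ x y, N x y * MvPowerSeries.C (p y) = N x y) :
    Q * revPairMat (N.map φ₁) (N.map φ₂) = revPairMat (N.map φ₂) (N.map φ₁) * Q := by
  classical
  have hd : ∀ (φ : MvPowerSeries (Fin 2) A →+* MvPowerSeries (Fin 3) A)
      (_ : ∀ a, φ (MvPowerSeries.C a) = MvPowerSeries.C a) (p : B → A),
      (Matrix.diagonal fun x => MvPowerSeries.C (p x)).map φ =
        Matrix.diagonal fun x => MvPowerSeries.C (p x) := fun φ hφ p => by
    rw [Matrix.diagonal_map (map_zero φ)]
    congr 1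
    ext1 x
    exact hφ _
  refine intertwine_inverse (p := fun x => MvPowerSeries.C (p x))
    (q := fun x => MvPowerSeries.C (q x)) (comp := fun x y => (deg x).tgt = (deg y).src) hQ ?_ h
    ?_ ?_ ?_ ?_ ?_ ?_ ?_ ?_
  · intro x y z w hn
    refine hQ0 x y z w fun h' => hn ⟨h'.1, h'.2.1, ?_, ?_⟩
    · rw [h'.2.2.1]
    · rw [h'.2.2.2]
  · rw [← Matrix.map_mul, hMN, hd φ₁ hφ₁]
  · rw [← Matrix.map_mul, hMN, hd φ₂ hφ₂]
  · rw [← Matrix.map_mul, hNM, hd φ₁ hφ₁]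
  · rw [← Matrix.map_mul, hNM, hd φ₂ hφ₂]
  · intro x k y
    have := congrArg φ₁ (hp x k y)
    rw [map_mul, hφ₁, apply_ite φ₁, map_zero] at this
    exact this.trans (if_congr eq_comm rfl rfl)
  · intro x l w
    have := congrArg φ₁ (hq x l w)
    rwa [map_mul, hφ₁, apply_ite φ₁, map_zero] at this
  · intro x y
    have := congrArg φ₂ (hqN x y)
    rwa [map_mul, hφ₂] at this
  · intro x y
    have := congrArg φ₂ (hNp x y)
    rwa [map_mul, hφ₂] at this

theorem GradedR.serR_eq_zero' {x y z w : B} (hr : GradedR deg r)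
    (hn : ¬ ((deg x).tgt = (deg y).src ∧ (deg z).tgt = (deg w).src ∧ (deg x).src = (deg z).src ∧
      (deg y).tgt = (deg w).tgt)) : serR K A r (z, w) (x, y) = 0 := by
  refine hr.serR_eq_zero ?_
  rintro ⟨d, h1, h2⟩
  exact hn ⟨h1.tgt_eq_src, h2.tgt_eq_src, by rw [← h1.src_eq, h2.src_eq],
    by rw [← h1.tgt_eq, h2.tgt_eq]⟩

theorem of_serR_comm (i j : B × B) (w : MvPowerSeries (Fin 3) A) :
    Matrix.of (serR K A r) i j * w = w * Matrix.of (serR K A r) i j := serR_comm r i j w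

/-- The values of the antipode satisfy the relations in the opposite algebra.  Since `antiT` is
inverse to `T(u)`, the exchange relation follows by inverting that of `T`, without any symmetry of
`R`; the relations with `ω` and `σ` hold since `antiT` at `u+λ` is the transpose of `T(u)` up to
`ω`, `σ` and `ξ⁻`. -/
theorem IsRep.isRep_antiT (h : IsRep K deg L lam r ωc σc E X T)
    (h1 : ∑ f, E f = 1) (hX : ∀ s n m a, X s n m * a = a * X s n m) (hr : GradedR deg r)
    (hω : GradedForm deg ωc) (hσ : GradedForm deg σc)
    (hωσ : ∀ [DecidableEq B], matP K A ωc * matP K A σc = 1)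
    (hσω : ∀ [DecidableEq B], matP K A σc * matP K A ωc = 1) :
    IsRep K deg L lam r ωc σc (fun f => op (E f.inv)) (fun s n m => op (X (!s) n m))
      (fun x y n m => op (unser (antiT K L lam ωc σc X T x y) n m)) := by
  classical
  have hMN := h.serT_mul_antiT h1 hX hωσ
  have hNM := h.antiT_mul_serT h1 hX hω hωσ
  have hshift : (antiT K L lam ωc σc X T).map (shiftHom K L lam) =
      twist (ser (X false)) (matP K A ωc) (matP K A σc) (serT T) := by
    rw [antiT, twist_map, matP_map_shiftHom, matP_map_shiftHom, map_shiftHom_map, shiftHom_add,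
      add_neg_cancel, map_shiftHom_zero, shiftHom_zero]
  have hshift' : ((antiT K L lam ωc σc X T).map (shiftHom K L lam)).transpose =
      ser (X false) • ((matP K A σc).transpose * serT T * (matP K A ωc).transpose) := by
    rw [hshift, transpose_twist (matP_comm ωc) (matP_comm σc)]
  have hT : (matP K A ωc).transpose * (matP K A σc).transpose = 1 := by
    rw [← transpose_mul_of_comm (matP_comm σc), hσω, Matrix.transpose_one]
  refine h.anti h1 hX (fun f g x y hfg => ?_) ?_ (fun x y => ?_) fun z w => ?_
  · exact h.twist_square (shift_X_comm hX _ _) (matP_comm _) (matP_comm _)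
      (fun _ _ hn => hω.matP_eq_zero hn) (fun _ _ hn => hσ.matP_eq_zero hn) _ f g x y hfg
  · refine intertwine_inverse_series (deg := deg) (M := serT T) (p := fun x => srcSum E (deg x).src)
      (q := fun x => tgtSum E (deg x).tgt) (substU₂ A) (substU₁ A) substU₂_C substU₁_C
      (fun i j => of_serR_comm j i) ?_ ?_ hMN hNM ?_ ?_ ?_ ?_
    · intro x y z w hn
      refine hr.serR_eq_zero' fun h' => hn ⟨h'.1, h'.2.1, ?_, ?_⟩
      · rw [h'.2.2.1]
      · rw [h'.2.2.2]
    · rw [← serT₁_eq_map, ← serT₂_eq_map]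
      exact h.rtt_matrix.symm
    · exact fun x k y => h.serT_mul_srcSum x k _
    · exact fun x l w => h.tgtSum_mul_serT l w _
    · intro x y
      have := twist_absorb (a := MvPowerSeries.C (tgtSum E (deg x).tgt)) (b := 1) (x := x) (y := y)
        (M := (serT T).map (shiftHom K L (-lam))) (shift_X_comm (K := K) (L := L) hX false (-lam))
        (matP_comm (K := K) (A := A) ωc) (matP_comm (K := K) (A := A) σc) fun k l => ?_
      · rwa [mul_one] at this
      · by_cases hl : deg l = (deg x).inv
        · rw [mul_one, h.tgtSum_mul_shift _ (by rw [hl]; rfl)]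
          exact Or.inr (Or.inr rfl)
        · exact Or.inl (hω.matP_eq_zero hl)
    · intro x y
      have := twist_absorb (b := MvPowerSeries.C (srcSum E (deg y).src)) (a := 1) (x := x) (y := y)
        (M := (serT T).map (shiftHom K L (-lam))) (shift_X_comm (K := K) (L := L) hX false (-lam))
        (matP_comm (K := K) (A := A) ωc) (matP_comm (K := K) (A := A) σc) fun k l => ?_
      · rwa [one_mul] at this
      · by_cases hl : deg y = (deg k).inv
        · rw [one_mul, h.shift_mul_srcSum _ (by rw [hl]; rfl)]
          exact Or.inr (Or.inr rfl)
        · exact Or.inr (Or.inl (hσ.matP_eq_zero hl))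
  · rw [hshift', mul_smul_of_comm (ser_X_comm hX _), ← mul_assoc, ← mul_assoc,
      mul_assoc _ (matP K A ωc).transpose, hT, mul_one, hNM, Matrix.smul_apply,
      Matrix.diagonal_mul, smul_eq_mul, Matrix.transpose_apply]
    by_cases hy : deg y = (deg x).inv
    · rw [hy, Arr.inv_tgt, ← matP_comm, ser_X_comm hX, mul_assoc, ← ser_X_comm hX, ← mul_assoc]
      rfl
    · rw [hω.matP_eq_zero hy, hω.serMat_eq_zero hy, mul_zero, mul_zero, zero_mul, zero_mul]
  · rw [hshift', Matrix.smul_mul, Matrix.smul_mul, mul_assoc _ _ (matP K A σc).transpose, hT,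
      mul_one, mul_assoc, hMN, Matrix.smul_apply, Matrix.mul_diagonal, smul_eq_mul, ← mul_assoc,
      ser_X_comm hX]
    rfl

/-- The values of the inverse of the antipode satisfy the relations in the opposite algebra, by the
same argument applied to the transpose of `T(u)`. -/
theorem IsRep.isRep_antiInvT (h : IsRep K deg L lam r ωc σc E X T)
    (h1 : ∑ f, E f = 1) (hX : ∀ s n m a, X s n m * a = a * X s n m) (hr : GradedR deg r)
    (hω : GradedForm deg ωc) (hσ : GradedForm deg σc)
    (hωσ : ∀ [DecidableEq B], matP K A ωc * matP K A σc = 1)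
    (hσω : ∀ [DecidableEq B], matP K A σc * matP K A ωc = 1) :
    IsRep K deg L lam r ωc σc (fun f => op (E f.inv)) (fun s n m => op (X (!s) n m))
      (fun x y n m => op (unser (antiInvT K L lam ωc σc X T x y) n m)) := by
  classical
  have hMN := h.serT_mul_antiInvT h1 hX hσω
  have hNM := h.antiInvT_mul_serT h1 hX hσ hσω
  have hω' : ∀ x y, deg y ≠ (deg x).inv → (matP K A ωc).transpose x y = 0 := fun x y hn =>
    hω.matP_eq_zero fun hn' => hn (by rw [hn', Arr.inv_inv])
  have hσ' : ∀ x y, deg y ≠ (deg x).inv → (matP K A σc).transpose x y = 0 := fun x y hn =>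
    hσ.matP_eq_zero fun hn' => hn (by rw [hn', Arr.inv_inv])
  have hT : (matP K A σc).transpose * (matP K A ωc).transpose = 1 := by
    rw [← transpose_mul_of_comm (matP_comm ωc), hωσ, Matrix.transpose_one]
  have hN : antiInvT K L lam ωc σc X T = ser (X false) • ((matP K A ωc).transpose *
      ((serT T).transpose.map (shiftHom K L lam)) * (matP K A σc).transpose) := by
    rw [antiInvT, twist_eq_smul, Matrix.transpose_map]
  have hd : ∀ p : B → A, (Matrix.diagonal fun x => MvPowerSeries.C (p x)).map (shiftHom K L lam) =
      Matrix.diagonal fun x => MvPowerSeries.C (p x) := fun p => by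
    rw [Matrix.diagonal_map (map_zero _)]
    congr 1
    ext1 x
    exact shiftHom_C _ _ _
  refine h.anti h1 hX (fun f g x y hfg => ?_) ?_ (fun x y => ?_) fun z w => ?_
  · exact h.twist_square (ser_X_comm hX _) (fun x y => matP_comm _ y x) (fun x y => matP_comm _ y x)
      hω' hσ' _ f g x y hfg
  · have e := intertwine_inverse_series (deg := deg) (M := (serT T).transpose)
      (N := (antiInvT K L lam ωc σc X T).transpose) (Q := Matrix.of (serR K A r))
      (p := fun x => tgtSum E (deg x).src)
      (q := fun x => srcSum E (deg x).tgt) (substU₁ A) (substU₂ A) substU₁_C substU₂_C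
      of_serR_comm ?_ ?_ hMN hNM ?_ ?_ ?_ ?_
    · have e' := congrArg Matrix.transpose e
      rw [transpose_mul_of_comm of_serR_comm, transpose_mul_of_comm' of_serR_comm] at e'
      exact e'.symm
    · intro x y z w hn
      refine hr.serR_eq_zero' fun h' => hn ⟨h'.2.1, h'.1, ?_, ?_⟩
      · rw [h'.2.2.1]
      · rw [h'.2.2.2]
    · have e' := congrArg Matrix.transpose h.rtt_matrix
      rw [transpose_mul_of_comm' (fun i j => of_serR_comm j i),
        transpose_mul_of_comm (fun i j => of_serR_comm j i), Matrix.transpose_transpose,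
        serT₁_eq_map, serT₂_eq_map] at e'
      exact e'
    · exact fun x k y => h.serT_mul_tgtSum k x _
    · exact fun x l w => h.srcSum_mul_serT w l _
    · intro x y
      have := twist_absorb (a := MvPowerSeries.C (srcSum E (deg x).tgt)) (b := 1) (x := y) (y := x)
        (M := (serT T).map (shiftHom K L lam)) (ser_X_comm hX false)
        (fun x y => matP_comm (K := K) (A := A) ωc y x)
        (fun x y => matP_comm (K := K) (A := A) σc y x) fun k l => ?_
      · rwa [mul_one] at this
      · by_cases hl : deg x = (deg k).inv
        · rw [mul_one, h.srcSum_mul_shift _ (by rw [hl]; rfl)]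
          exact Or.inr (Or.inr rfl)
        · exact Or.inr (Or.inl (hσ' _ _ hl))
    · intro x y
      have := twist_absorb (b := MvPowerSeries.C (tgtSum E (deg y).src)) (a := 1) (x := y) (y := x)
        (M := (serT T).map (shiftHom K L lam)) (ser_X_comm hX false)
        (fun x y => matP_comm (K := K) (A := A) ωc y x)
        (fun x y => matP_comm (K := K) (A := A) σc y x) fun k l => ?_
      · rwa [one_mul] at this
      · by_cases hl : deg l = (deg y).inv
        · rw [one_mul, h.shift_mul_tgtSum _ (by rw [hl]; rfl)]
          exact Or.inr (Or.inr rfl)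
        · exact Or.inl (hω' _ _ hl)
  · rw [← Matrix.transpose_map]
    nth_rw 1 [hN]
    rw [Matrix.smul_mul, Matrix.smul_mul, mul_assoc _ (matP K A σc).transpose, hT, mul_one,
      mul_assoc, ← Matrix.map_mul, hMN, hd, Matrix.smul_apply, Matrix.mul_diagonal, smul_eq_mul,
      ← mul_assoc, ser_X_comm hX]
    rfl
  · rw [← Matrix.transpose_map]
    nth_rw 2 [hN]
    rw [mul_smul_of_comm (ser_X_comm hX _), mul_assoc, ← mul_assoc (matP K A σc).transpose,
      ← mul_assoc (matP K A σc).transpose, hT, one_mul, ← mul_assoc, ← Matrix.map_mul, hNM, hd,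
      Matrix.smul_apply, Matrix.diagonal_mul, smul_eq_mul, Matrix.transpose_apply]
    by_cases hw : deg w = (deg z).inv
    · rw [hw, Arr.inv_tgt, ← matP_comm, ser_X_comm hX, mul_assoc, ← ser_X_comm hX, ← mul_assoc]
      rfl
    · rw [hσ.matP_eq_zero hw, hσ.serMat_eq_zero hw, mul_zero, mul_zero, zero_mul, zero_mul]

end

end


/-! ### Coassociativity -/

open Finset.HasAntidiagonal

section

variable {M : Type*} [AddCommMonoid M]

theorem sum_antidiagonal_assoc (n : ℕ) (F : ℕ → ℕ → ℕ → M) :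
    ∑ a ∈ antidiagonal n, ∑ a' ∈ antidiagonal a.1, F a'.1 a'.2 a.2 =
      ∑ a ∈ antidiagonal n, ∑ a' ∈ antidiagonal a.2, F a.1 a'.1 a'.2 := by
  rw [Finset.sum_sigma', Finset.sum_sigma']
  refine Finset.sum_nbij' (fun x => ⟨(x.2.1, x.2.2 + x.1.2), (x.2.2, x.1.2)⟩)
    (fun x => ⟨(x.1.1 + x.2.1, x.2.2), (x.1.1, x.2.1)⟩) ?_ ?_ ?_ ?_ ?_
  all_goals
    rintro ⟨⟨i, j⟩, ⟨k, l⟩⟩ h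
    simp only [Finset.mem_sigma, mem_antidiagonal] at h
    obtain ⟨rfl, rfl⟩ := h
    simp [add_assoc]

theorem sum_antidiagonal_assoc₂ (n m : ℕ) (F : ℕ → ℕ → ℕ → ℕ → ℕ → ℕ → M) :
    ∑ a ∈ antidiagonal n, ∑ b ∈ antidiagonal m, ∑ a' ∈ antidiagonal a.1, ∑ b' ∈ antidiagonal b.1,
      F a'.1 a'.2 a.2 b'.1 b'.2 b.2 =
    ∑ a ∈ antidiagonal n, ∑ b ∈ antidiagonal m, ∑ a' ∈ antidiagonal a.2, ∑ b' ∈ antidiagonal b.2,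
      F a.1 a'.1 a'.2 b.1 b'.1 b'.2 := by
  calc _ = ∑ a ∈ antidiagonal n, ∑ a' ∈ antidiagonal a.1, ∑ b ∈ antidiagonal m,
        ∑ b' ∈ antidiagonal b.1, F a'.1 a'.2 a.2 b'.1 b'.2 b.2 :=
        Finset.sum_congr rfl fun a _ => Finset.sum_comm
    _ = ∑ a ∈ antidiagonal n, ∑ a' ∈ antidiagonal a.2, ∑ b ∈ antidiagonal m,
        ∑ b' ∈ antidiagonal b.1, F a.1 a'.1 a'.2 b'.1 b'.2 b.2 :=
        sum_antidiagonal_assoc n fun i j k => ∑ b ∈ antidiagonal m, ∑ b' ∈ antidiagonal b.1,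
          F i j k b'.1 b'.2 b.2
    _ = ∑ a ∈ antidiagonal n, ∑ a' ∈ antidiagonal a.2, ∑ b ∈ antidiagonal m,
        ∑ b' ∈ antidiagonal b.2, F a.1 a'.1 a'.2 b.1 b'.1 b'.2 := by
        refine Finset.sum_congr rfl fun a _ => Finset.sum_congr rfl fun a' _ => ?_
        exact sum_antidiagonal_assoc m fun i j k => F a.1 a'.1 a'.2 i j k
    _ = _ := Finset.sum_congr rfl fun a _ => Finset.sum_comm

end

section

variable {K A C D : Type*} [CommRing K] [Ring A] [Algebra K A] [Ring C] [Algebra K C] [Ring D]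
  [Algebra K D]

theorem rTensor_mul_of_mul {φ : A →ₗ[K] C} (hφ : ∀ a b, φ (a * b) = φ a * φ b)
    (X Y : A ⊗[K] D) : φ.rTensor D (X * Y) = φ.rTensor D X * φ.rTensor D Y := by
  induction X with
  | zero => simp
  | add X X' h h' => rw [add_mul, map_add, h, h', map_add, add_mul]
  | tmul a d =>
    induction Y with
    | zero => simp
    | add Y Y' h h' => rw [mul_add, map_add, h, h', map_add, mul_add]
    | tmul a' d' => simp [hφ]

theorem lTensor_mul_of_mul {φ : A →ₗ[K] C} (hφ : ∀ a b, φ (a * b) = φ a * φ b)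
    (X Y : D ⊗[K] A) : φ.lTensor D (X * Y) = φ.lTensor D X * φ.lTensor D Y := by
  induction X with
  | zero => simp
  | add X X' h h' => rw [add_mul, map_add, h, h', map_add, add_mul]
  | tmul a d =>
    induction Y with
    | zero => simp
    | add Y Y' h h' => rw [mul_add, map_add, h, h', map_add, mul_add]
    | tmul a' d' => simp [hφ]

end

section

variable {K π B : Type*} [Groupoid π] [Finite π] [∀ a b : π, Finite (a ⟶ b)]
    [Fintype B] [CommRing K] [Algebra ℂ K] {deg : B → Arr π}
    {L lam : ℂ} {r : ℕ → ℕ → Matrix (B × B) (B × B) ℂ} {ωc σc : ℕ → Matrix B B ℂ}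

local notation "𝔸" => QAlg K deg L lam r ωc σc
local notation "𝕘" => gen K deg L lam r ωc σc
local notation "𝕖" => genE K deg L lam r ωc σc
local notation "𝕏" => genX K deg L lam r ωc σc
local notation "𝕋" => genT K deg L lam r ωc σc

open scoped Classical in
/-- `Δ` is multiplicative and has the values of the coproduct on generators. -/
structure IsComul (Δ : 𝔸 →ₗ[K] 𝔸 ⊗[K] 𝔸) : Prop where
  mul : ∀ a b, Δ (a * b) = Δ a * Δ b
  map_e : ∀ f, Δ (𝕖 f) = ∑ q : Arr π × Arr π with IsComp q.1 q.2 f, 𝕖 q.1 ⊗ₜ[K] 𝕖 q.2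
  map_xi : ∀ s f n m, Δ (𝕘 (.xi s f n m)) = ∑ q : Arr π × Arr π with IsComp q.1 q.2 f,
    ∑ a ∈ antidiagonal n, ∑ b ∈ antidiagonal m,
      𝕘 (.xi s q.1 a.1 b.1) ⊗ₜ[K] 𝕘 (.xi s q.2 a.2 b.2)
  map_T : ∀ x y n m, Δ (𝕋 x y n m) = ∑ z : B, ∑ a ∈ antidiagonal n, ∑ b ∈ antidiagonal m,
    𝕋 x z a.1 b.1 ⊗ₜ[K] 𝕋 z y a.2 b.2

theorem exists_isComul : ∃ Δ : 𝔸 →ₗ[K] 𝔸 ⊗[K] 𝔸, IsComul Δ := by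
  classical
  let i : 𝔸 →ₐ[K] 𝔸 ⊗[K] 𝔸 := Algebra.TensorProduct.includeLeft
  let j : 𝔸 →ₐ[K] 𝔸 ⊗[K] 𝔸 := Algebra.TensorProduct.includeRight
  have hij : ∀ a b : 𝔸, i a * j b = j b * i a := fun a b => by simp [i, j]
  have hg : IsRep K deg L lam r ωc σc 𝕖 𝕏 𝕋 := isRep_gen
  obtain ⟨Δ, h1, h2, h3, h4⟩ := (hg.conv (C := 𝔸 ⊗[K] 𝔸) (i := i) (j := j) genE_sum hij).exists_hom'
  refine ⟨(Δ : 𝔸 →ₗ[K] 𝔸 ⊗[K] 𝔸), map_mul Δ, fun f => (h1 f).trans ?_,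
    fun s f n m => (h2 s f n m).trans ?_, fun x y n m => (h4 x y n m).trans ?_⟩
  · simp [convE, i, j]
  · have := hg.convE_mul_convE (C := 𝔸 ⊗[K] 𝔸) (i := i) (j := j) hij
    rw [convX, ← mul_assoc, Finset.mul_sum]
    simp only [this, Finset.sum_ite_eq, Finset.mem_univ, if_true]
    simp only [convE, convXX, Finset.sum_mul, Finset.mul_sum, gen_xi]
    refine (Finset.sum_congr rfl fun a _ => Finset.sum_comm).trans (Finset.sum_comm.trans ?_)
    simp [i, j]
  · simp [convT, i, j]

/-- Both sides are multiplicative, so it suffices to compare them on the generators. -/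
theorem IsComul.coassoc {Δ : 𝔸 →ₗ[K] 𝔸 ⊗[K] 𝔸} (h : IsComul Δ) :
    (TensorProduct.assoc K 𝔸 𝔸 𝔸).toLinearMap ∘ₗ Δ.rTensor 𝔸 ∘ₗ Δ = Δ.lTensor 𝔸 ∘ₗ Δ := by
  classical
  have hmul (X Y : 𝔸 ⊗[K] 𝔸 ⊗[K] 𝔸) : TensorProduct.assoc K 𝔸 𝔸 𝔸 (X * Y) =
      TensorProduct.assoc K 𝔸 𝔸 𝔸 X * TensorProduct.assoc K 𝔸 𝔸 𝔸 Y :=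
    map_mul (Algebra.TensorProduct.assoc K K K 𝔸 𝔸 𝔸) X Y
  ext a
  simp only [LinearMap.comp_apply, LinearEquiv.coe_coe]
  induction a using qalg_induction with
  | h0 => simp
  | hadd a b ha hb => simp only [map_add, ha, hb]
  | hsmul k a ha => simp only [map_smul, ha]
  | hmul a b ha hb =>
    rw [h.mul, rTensor_mul_of_mul (C := 𝔸 ⊗[K] 𝔸) h.mul, hmul, ha, hb,
      lTensor_mul_of_mul (C := 𝔸 ⊗[K] 𝔸) h.mul]
  | he f =>
    simp only [h.map_e, map_sum, LinearMap.rTensor_tmul, LinearMap.lTensor_tmul,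
      TensorProduct.sum_tmul, TensorProduct.tmul_sum, TensorProduct.assoc_tmul]
    exact sum_isComp_assoc (fun u v t => 𝕖 u ⊗ₜ[K] (𝕖 v ⊗ₜ[K] 𝕖 t)) f
  | hxi s f n m =>
    simp only [h.map_xi, map_sum, LinearMap.rTensor_tmul, LinearMap.lTensor_tmul,
      TensorProduct.sum_tmul, TensorProduct.tmul_sum, TensorProduct.assoc_tmul]
    let F (u v t : Arr π) (i j k i' j' k' : ℕ) : 𝔸 ⊗[K] (𝔸 ⊗[K] 𝔸) :=
      𝕘 (.xi s u i i') ⊗ₜ[K] (𝕘 (.xi s v j j') ⊗ₜ[K] 𝕘 (.xi s t k k'))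
    calc _ = ∑ q : Arr π × Arr π with IsComp q.1 q.2 f,
        ∑ q' : Arr π × Arr π with IsComp q'.1 q'.2 q.1,
        ∑ a ∈ antidiagonal n, ∑ b ∈ antidiagonal m, ∑ a' ∈ antidiagonal a.1,
        ∑ b' ∈ antidiagonal b.1, F q'.1 q'.2 q.2 a'.1 a'.2 a.2 b'.1 b'.2 b.2 := by
          refine Finset.sum_congr rfl fun q _ => Eq.trans ?_ Finset.sum_comm
          exact Finset.sum_congr rfl fun a _ => Finset.sum_comm
      _ = ∑ q : Arr π × Arr π with IsComp q.1 q.2 f,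
        ∑ q' : Arr π × Arr π with IsComp q'.1 q'.2 q.2,
        ∑ a ∈ antidiagonal n, ∑ b ∈ antidiagonal m, ∑ a' ∈ antidiagonal a.2,
        ∑ b' ∈ antidiagonal b.2, F q.1 q'.1 q'.2 a.1 a'.1 a'.2 b.1 b'.1 b'.2 := by
          rw [← sum_isComp_assoc (fun u v t => ∑ a ∈ antidiagonal n, ∑ b ∈ antidiagonal m,
            ∑ a' ∈ antidiagonal a.2, ∑ b' ∈ antidiagonal b.2, F u v t a.1 a'.1 a'.2 b.1 b'.1 b'.2)]
          exact Finset.sum_congr rfl fun q _ => Finset.sum_congr rfl fun q' _ =>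
            sum_antidiagonal_assoc₂ n m _
      _ = _ := by
          refine Finset.sum_congr rfl fun q _ => Eq.trans Finset.sum_comm ?_
          exact Finset.sum_congr rfl fun a _ => Finset.sum_comm
  | hT x y n m =>
    simp only [h.map_T, map_sum, LinearMap.rTensor_tmul, LinearMap.lTensor_tmul,
      TensorProduct.sum_tmul, TensorProduct.tmul_sum, TensorProduct.assoc_tmul]
    let F (u v : B) (i j k i' j' k' : ℕ) : 𝔸 ⊗[K] (𝔸 ⊗[K] 𝔸) :=
      𝕋 x u i i' ⊗ₜ[K] (𝕋 u v j j' ⊗ₜ[K] 𝕋 v y k k')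
    calc _ = ∑ v, ∑ u, ∑ a ∈ antidiagonal n, ∑ b ∈ antidiagonal m, ∑ a' ∈ antidiagonal a.1,
        ∑ b' ∈ antidiagonal b.1, F u v a'.1 a'.2 a.2 b'.1 b'.2 b.2 := by
          refine Finset.sum_congr rfl fun q _ => Eq.trans ?_ Finset.sum_comm
          exact Finset.sum_congr rfl fun a _ => Finset.sum_comm
      _ = ∑ u, ∑ v, ∑ a ∈ antidiagonal n, ∑ b ∈ antidiagonal m, ∑ a' ∈ antidiagonal a.2,
        ∑ b' ∈ antidiagonal b.2, F u v a.1 a'.1 a'.2 b.1 b'.1 b'.2 := by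
          rw [Finset.sum_comm]
          exact Finset.sum_congr rfl fun u _ => Finset.sum_congr rfl fun v _ =>
            sum_antidiagonal_assoc₂ n m _
      _ = _ := by
          refine Finset.sum_congr rfl fun q _ => Eq.trans Finset.sum_comm ?_
          exact Finset.sum_congr rfl fun a _ => Finset.sum_comm

end


/-! ### The grading -/

open Finset.HasAntidiagonal

section

variable {K π B : Type*} [Groupoid π] [Finite π] [∀ a b : π, Finite (a ⟶ b)]
    [Fintype B] [CommRing K] [Algebra ℂ K] {deg : B → Arr π}
    {L lam : ℂ} {r : ℕ → ℕ → Matrix (B × B) (B × B) ℂ} {ωc σc : ℕ → Matrix B B ℂ}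

local notation "𝔸" => QAlg K deg L lam r ωc σc
local notation "𝕘" => gen K deg L lam r ωc σc
local notation "𝕖" => genE K deg L lam r ωc σc
local notation "𝕏" => genX K deg L lam r ωc σc
local notation "𝕋" => genT K deg L lam r ωc σc
local notation "𝒜" => component K deg L lam r ωc σc

theorem gen_mem_component (x : Gen deg) : 𝕘 x ∈ 𝒜 x.degree :=
  Submodule.subset_span (IsMonomial.gen x)

theorem genE_mem_component (f : Arr π) : 𝕖 f ∈ 𝒜 (Sq.idV f) := gen_mem_component (.e f)

theorem genXi_mem_component (s : Bool) (f : Arr π) (n m : ℕ) :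
    𝕘 (.xi s f n m) ∈ 𝒜 (Sq.idV f) := gen_mem_component (.xi s f n m)

theorem genT_mem_component (x y : B) (α : Sq.Between (deg x) (deg y)) (n m : ℕ) :
    𝕘 (.T x y α n m) ∈ 𝒜 α.1 := gen_mem_component (.T x y α n m)

theorem component_induction {α : Sq π} {p : 𝔸 → Prop} (h0 : p 0)
    (hadd : ∀ a b, p a → p b → p (a + b)) (hsmul : ∀ (k : K) a, p a → p (k • a))
    (hmon : ∀ a, IsMonomial 𝕘 Gen.degree α a → p a) {a : 𝔸} (ha : a ∈ 𝒜 α) : p a :=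
  Submodule.span_induction hmon h0 (fun a b _ _ => hadd a b) (fun k a _ => hsmul k a) ha

/-- To place the image of every component of the quantum algebra in a submodule depending on the
degree, it suffices to treat generators and products. -/
theorem map_mem_of_gen {N : Type*} [AddCommGroup N] [Module K N] (φ : 𝔸 →ₗ[K] N)
    (P : Sq π → Submodule K N) (hgen : ∀ x : Gen deg, φ (𝕘 x) ∈ P x.degree)
    (hmul : ∀ α β γ a b, Sq.VComp α β γ → φ a ∈ P α → φ b ∈ P β → φ (a * b) ∈ P γ)
    {α : Sq π} {a : 𝔸} (ha : a ∈ 𝒜 α) : φ a ∈ P α := by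
  have key : ∀ {α a}, IsMonomial 𝕘 Gen.degree α a → φ a ∈ P α := fun h => by
    induction h with
    | gen x => exact hgen x
    | mul h _ _ h1 h2 => exact hmul _ _ _ _ _ h h1 h2
  exact component_induction (p := fun a => φ a ∈ P α) (by simp)
    (fun a b ha hb => by rw [map_add]; exact add_mem ha hb)
    (fun k a ha => by rw [map_smul]; exact Submodule.smul_mem _ _ ha) (fun a => key) ha

theorem component_unit_mul {α : Sq π} {a : 𝔸} (ha : a ∈ 𝒜 α) : 𝕖 α.top * a = a := by
  have key : ∀ {α a}, IsMonomial 𝕘 Gen.degree α a → 𝕖 α.top * a = a := fun h => by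
    induction h with
    | gen x => exact genE_top_mul x
    | mul h _ _ h1 _ => rw [h.2.1, ← mul_assoc, h1]
  refine component_induction (p := fun a => 𝕖 α.top * a = a) (by simp)
    (fun a b ha hb => by rw [mul_add, ha, hb]) (fun k a ha => by rw [mul_smul_comm, ha])
    (fun a => key) ha

theorem component_mul_unit {α : Sq π} {a : 𝔸} (ha : a ∈ 𝒜 α) : a * 𝕖 α.bot = a := by
  have key : ∀ {α a}, IsMonomial 𝕘 Gen.degree α a → a * 𝕖 α.bot = a := fun h => by
    induction h with
    | gen x => exact mul_genE_bot x
    | mul h _ _ _ h2 => rw [h.2.2.1, mul_assoc, h2]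
  refine component_induction (p := fun a => a * 𝕖 α.bot = a) (by simp)
    (fun a b ha hb => by rw [add_mul, ha, hb]) (fun k a ha => by rw [smul_mul_assoc, ha])
    (fun a => key) ha

theorem component_mul_mem {α β γ : Sq π} (h : Sq.VComp α β γ) {a b : 𝔸} (ha : a ∈ 𝒜 α)
    (hb : b ∈ 𝒜 β) : a * b ∈ 𝒜 γ := by
  refine component_induction (p := fun a => a * b ∈ 𝒜 γ) (by simp)
    (fun a b ha hb => by rw [add_mul]; exact add_mem ha hb)
    (fun k a ha => by rw [smul_mul_assoc]; exact Submodule.smul_mem _ _ ha) (fun a ha => ?_) ha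
  refine component_induction (p := fun b => a * b ∈ 𝒜 γ) (by simp)
    (fun a b ha hb => by rw [mul_add]; exact add_mem ha hb)
    (fun k a ha => by rw [mul_smul_comm]; exact Submodule.smul_mem _ _ ha) (fun b hb => ?_) hb
  exact Submodule.subset_span (IsMonomial.mul h ha hb)

theorem component_mul_eq_zero {α β : Sq π} (h : α.bot ≠ β.top) {a b : 𝔸} (ha : a ∈ 𝒜 α)
    (hb : b ∈ 𝒜 β) : a * b = 0 := by
  rw [← component_mul_unit ha, ← component_unit_mul hb, mul_assoc, ← mul_assoc (𝕖 _) (𝕖 _),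
    genE_orth _ _ h, zero_mul, mul_zero]

theorem genX_mul_mem_component {α : Sq π} {a : 𝔸} (s : Bool) (n m : ℕ) (ha : a ∈ 𝒜 α) :
    𝕏 s n m * a ∈ 𝒜 α := by
  rw [← component_unit_mul ha, ← mul_assoc, genX_comm, ← gen_xi]
  have h1 : IsComp (Arr.id α.top.src) α.left α.left := (IsComp.id_left_iff _).2 ⟨rfl, α.top_src.symm⟩
  have h2 : IsComp (Arr.id α.top.tgt) α.right α.right :=
    (IsComp.id_left_iff _).2 ⟨rfl, α.top_tgt.symm⟩
  have hv : Sq.VComp (Sq.idV α.top) α α := ⟨rfl, rfl, rfl, h1, h2⟩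
  exact component_mul_mem hv (genXi_mem_component s α.top n m) ha

theorem genE_mul_genT_mul_genE_mem_component {x y : B} {n m : ℕ} {f g : Arr π} {α : Sq π}
    (h1 : α.left = deg x) (h2 : α.right = deg y) (h3 : α.top = f) (h4 : α.bot = g) :
    𝕖 f * 𝕋 x y n m * 𝕖 g ∈ 𝒜 α := by
  subst h3 h4
  rw [← gen_T x y ⟨α, h1, h2⟩ n m]
  exact genT_mem_component x y ⟨α, h1, h2⟩ n m

/-- The components span: a product of components lies in a component or, for squares that do not
match, vanishes. -/
theorem iSup_component : ⨆ α, 𝒜 α = ⊤ := by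
  refine Submodule.eq_top_iff'.2 fun a => ?_
  induction a using qalg_induction with
  | h0 => exact zero_mem _
  | hadd a b ha hb => exact add_mem ha hb
  | hsmul k a ha => exact Submodule.smul_mem _ _ ha
  | he f => exact Submodule.mem_iSup_of_mem _ (genE_mem_component f)
  | hxi s f n m => exact Submodule.mem_iSup_of_mem _ (genXi_mem_component s f n m)
  | hT x y n m => exact sum_mem fun α _ => Submodule.mem_iSup_of_mem _ (genT_mem_component x y α n m)
  | hmul a b ha hb =>
    refine Submodule.iSup_induction _ (motive := fun a => a * b ∈ ⨆ α, 𝒜 α) ha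
      (fun α a ha => ?_) (by simp) fun a a' h h' => by rw [add_mul]; exact add_mem h h'
    refine Submodule.iSup_induction _ (motive := fun b => a * b ∈ ⨆ α, 𝒜 α) hb
      (fun β b hb => ?_) (by simp) fun a a' h h' => by rw [mul_add]; exact add_mem h h'
    by_cases h : α.bot = β.top
    · obtain ⟨γ, hγ⟩ := Sq.exists_vComp h
      exact Submodule.mem_iSup_of_mem _ (component_mul_mem hγ ha hb)
    · rw [component_mul_eq_zero h ha hb]
      exact zero_mem _

/-- Linear maps on the quantum algebra that agree on all components are equal. -/
theorem linearMap_ext_component {N : Type*} [AddCommGroup N] [Module K N] {φ ψ : 𝔸 →ₗ[K] N}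
    (h : ∀ α, ∀ a ∈ 𝒜 α, φ a = ψ a) : φ = ψ := by
  ext a
  have ha : a ∈ ⨆ α, 𝒜 α := by rw [iSup_component]; trivial
  refine Submodule.iSup_induction _ (motive := fun a => φ a = ψ a) ha h (by simp)
    fun a b ha hb => by rw [map_add, map_add, ha, hb]

/-! ### The coproduct and the grading -/

/-- This is the interchange law for squares; the factors that do not match vertically contribute
zero. -/
theorem mul_mem_tensorH {α β γ : Sq π} (h : Sq.VComp α β γ) {X Y : 𝔸 ⊗[K] 𝔸}
    (hX : X ∈ tensorH 𝒜 α) (hY : Y ∈ tensorH 𝒜 β) : X * Y ∈ tensorH 𝒜 γ := by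
  have e1 : tensorH 𝒜 α ≤ (tensorH 𝒜 γ).comap (LinearMap.mulRight K Y) := by
    refine iSup_le fun α₁ => iSup_le fun α₂ => iSup_le fun hα => Submodule.map₂_le.2 ?_
    intro a ha b hb
    have e2 : tensorH 𝒜 β ≤ (tensorH 𝒜 γ).comap (LinearMap.mulLeft K (a ⊗ₜ[K] b)) := by
      refine iSup_le fun β₁ => iSup_le fun β₂ => iSup_le fun hβ => Submodule.map₂_le.2 ?_
      intro a' ha' b' hb'
      rw [Submodule.mem_comap, LinearMap.mulLeft_apply, TensorProduct.mk_apply,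
        Algebra.TensorProduct.tmul_mul_tmul]
      by_cases h1 : α₁.bot = β₁.top
      · by_cases h2 : α₂.bot = β₂.top
        · obtain ⟨γ₁, hγ₁⟩ := Sq.exists_vComp h1
          obtain ⟨γ₂, hγ₂⟩ := Sq.exists_vComp h2
          refine Submodule.mem_iSup_of_mem γ₁ (Submodule.mem_iSup_of_mem γ₂
            (Submodule.mem_iSup_of_mem (Sq.interchange hα hβ hγ₁ hγ₂ h) ?_))
          exact Submodule.apply_mem_map₂ _ (component_mul_mem hγ₁ ha ha')
            (component_mul_mem hγ₂ hb hb')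
        · rw [component_mul_eq_zero h2 hb hb', TensorProduct.tmul_zero]
          exact zero_mem _
      · rw [component_mul_eq_zero h1 ha ha', TensorProduct.zero_tmul]
        exact zero_mem _
    exact e2 hY
  exact e1 hX

theorem tmul_mem_tensorH {α β γ : Sq π} (h : Sq.HComp α β γ) {a b : 𝔸}
    (ha : a ∈ 𝒜 α) (hb : b ∈ 𝒜 β) : a ⊗ₜ[K] b ∈ tensorH 𝒜 γ :=
  Submodule.mem_iSup_of_mem α (Submodule.mem_iSup_of_mem β
    (Submodule.mem_iSup_of_mem h (Submodule.apply_mem_map₂ (TensorProduct.mk K 𝔸 𝔸) ha hb)))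

theorem Sq.hComp_idV {f g h : Arr π} (H : IsComp f g h) :
    HComp (idV f) (idV g) (idV h) :=
  ⟨congrArg Arr.id H.tgt_eq_src, congrArg Arr.id H.src_eq, congrArg Arr.id H.tgt_eq, H, H⟩

/-- The coproduct preserves the grading.  For a component of `T_x^y`, each term of the coproduct
that does not come from a pair of squares with a common vertical side vanishes. -/
theorem IsComul.map_mem {Δ : 𝔸 →ₗ[K] 𝔸 ⊗[K] 𝔸} (h : IsComul Δ) {γ : Sq π} {a : 𝔸}
    (ha : a ∈ 𝒜 γ) : Δ a ∈ tensorH 𝒜 γ := by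
  classical
  refine map_mem_of_gen Δ (tensorH 𝒜) (fun x => ?_) (fun α β γ a b hγ ha hb => ?_) ha
  · cases x with
    | e f =>
      rw [h.map_e]
      exact sum_mem fun q hq => tmul_mem_tensorH (Sq.hComp_idV (Finset.mem_filter.1 hq).2)
        (genE_mem_component _) (genE_mem_component _)
    | xi s f n m =>
      rw [h.map_xi]
      exact sum_mem fun q hq => sum_mem fun a _ => sum_mem fun b _ =>
        tmul_mem_tensorH (Sq.hComp_idV (Finset.mem_filter.1 hq).2)
          (genXi_mem_component _ _ _ _) (genXi_mem_component _ _ _ _)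
    | T x y α n m =>
      obtain ⟨α, h1, h2⟩ := α
      rw [gen_T, h.mul, h.mul, h.map_e, h.map_e, h.map_T]
      simp only [Finset.sum_mul, Finset.mul_sum, Algebra.TensorProduct.tmul_mul_tmul]
      refine sum_mem fun q' hq' => sum_mem fun z _ => sum_mem fun a _ => sum_mem fun b _ =>
        sum_mem fun q hq => ?_
      simp only [Finset.mem_filter, Finset.mem_univ, true_and] at hq hq'
      by_cases e1 : ∃ β : Sq.Between (deg x) (deg z), β.1.top = q.1 ∧ β.1.bot = q'.1
      · by_cases e2 : ∃ β : Sq.Between (deg z) (deg y), β.1.top = q.2 ∧ β.1.bot = q'.2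
        · obtain ⟨⟨β, h3, h4⟩, h5, h6⟩ := e1
          obtain ⟨⟨β', h7, h8⟩, h9, h10⟩ := e2
          refine tmul_mem_tensorH (α := β) (β := β') ⟨h4.trans h7.symm, h1.trans h3.symm,
            h2.trans h8.symm, ?_, ?_⟩ (genE_mul_genT_mul_genE_mem_component h3 h4 h5 h6)
            (genE_mul_genT_mul_genE_mem_component h7 h8 h9 h10)
          · rwa [h5, h9]
          · rwa [h6, h10]
        · rw [isRep_gen.square _ _ _ _ _ _ e2, TensorProduct.tmul_zero]
          exact zero_mem _
      · rw [isRep_gen.square _ _ _ _ _ _ e1, TensorProduct.zero_tmul]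
        exact zero_mem _
  · rw [h.mul]
    exact mul_mem_tensorH hγ ha hb

end


/-! ### The counit and the grading -/

open Finset.HasAntidiagonal

theorem sum_antidiagonal_ite_left {M : Type*} [AddCommMonoid M] (n m : ℕ)
    (F : ℕ → ℕ → ℕ → ℕ → M) :
    (∑ a ∈ antidiagonal n, ∑ b ∈ antidiagonal m,
      if a.1 = 0 ∧ b.1 = 0 then F a.1 b.1 a.2 b.2 else 0) = F 0 0 n m := by
  rw [Finset.sum_eq_single (0, n), Finset.sum_eq_single (0, m)]
  · simp
  · rintro ⟨i, j⟩ h hne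
    rw [if_neg]
    rintro ⟨-, rfl : i = 0⟩
    exact hne (by simpa [mem_antidiagonal] using h)
  · simp [mem_antidiagonal]
  · rintro ⟨i, j⟩ h hne
    refine Finset.sum_eq_zero fun b _ => if_neg ?_
    rintro ⟨rfl : i = 0, -⟩
    exact hne (by simpa [mem_antidiagonal] using h)
  · simp [mem_antidiagonal]

theorem sum_antidiagonal_ite_right {M : Type*} [AddCommMonoid M] (n m : ℕ)
    (F : ℕ → ℕ → ℕ → ℕ → M) :
    (∑ a ∈ antidiagonal n, ∑ b ∈ antidiagonal m,
      if a.2 = 0 ∧ b.2 = 0 then F a.1 b.1 a.2 b.2 else 0) = F n m 0 0 := by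
  rw [Finset.sum_eq_single (n, 0), Finset.sum_eq_single (m, 0)]
  · simp
  · rintro ⟨i, j⟩ h hne
    rw [if_neg]
    rintro ⟨-, rfl : j = 0⟩
    exact hne (by simpa [mem_antidiagonal] using h)
  · simp [mem_antidiagonal]
  · rintro ⟨i, j⟩ h hne
    refine Finset.sum_eq_zero fun b _ => if_neg ?_
    rintro ⟨rfl : j = 0, -⟩
    exact hne (by simpa [mem_antidiagonal] using h)
  · simp [mem_antidiagonal]

section

variable {K π B : Type*} [Groupoid π] [Finite π] [∀ a b : π, Finite (a ⟶ b)]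
    [Fintype B] [CommRing K] [Algebra ℂ K] {deg : B → Arr π}
    {L lam : ℂ} {r : ℕ → ℕ → Matrix (B × B) (B × B) ℂ} {ωc σc : ℕ → Matrix B B ℂ}

local notation "𝔸" => QAlg K deg L lam r ωc σc
local notation "𝕘" => gen K deg L lam r ωc σc
local notation "𝕖" => genE K deg L lam r ωc σc
local notation "𝕏" => genX K deg L lam r ωc σc
local notation "𝕋" => genT K deg L lam r ωc σc
local notation "𝒜" => component K deg L lam r ωc σc

open ConvAlg

/-- `ε` is multiplicative and has the values of the counit on generators. -/
structure IsCounit (ε : 𝔸 →ₗ[K] ConvAlg K π) : Prop where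
  mul : ∀ a b, ε (a * b) = ε a * ε b
  map_e : ∀ f, ε (𝕖 f) = counitE K f
  map_xi : ∀ s f n m, ε (𝕘 (.xi s f n m)) = if n = 0 ∧ m = 0 then counitE K f else 0
  map_T : ∀ x y n m, ε (𝕋 x y n m) = counitT K deg x y n m

theorem exists_isCounit (hr : GradedR deg r) (hω : GradedForm deg ωc) (hσ : GradedForm deg σc) :
    ∃ ε : 𝔸 →ₗ[K] ConvAlg K π, IsCounit ε := by
  classical
  obtain ⟨ε, h1, h2, -, h4⟩ := (isRep_counit (K := K) (L := L) (lam := lam) hr hω hσ).exists_hom'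
  refine ⟨(ε : 𝔸 →ₗ[K] ConvAlg K π), map_mul ε, h1, fun s f n m => (h2 s f n m).trans ?_, h4⟩
  rw [counitX]
  split_ifs <;> simp

theorem single_mul_of_isComp (C : Type*) [Ring C] [Algebra K C] {u v w : Arr π}
    (h : IsComp u v w) (a b : C) : (single K u ⊗ₜ[K] a) * (single K v ⊗ₜ[K] b) =
      single K w ⊗ₜ[K] (a * b) := by
  rw [Algebra.TensorProduct.tmul_mul_tmul, single_mul_single h]

section

theorem sum_counitE_left {M : Type*} [AddCommGroup M] [Module K M] (F : Arr π → M) (f : Arr π) :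
    (open scoped Classical in ∑ q : Arr π × Arr π with IsComp q.1 q.2 f,
      (counitE K q.1 ⊗ₜ[K] F q.2 : ConvAlg K π ⊗[K] M)) = single K (Arr.id f.src) ⊗ₜ[K] F f := by
  classical
  rw [Finset.sum_eq_single (Arr.id f.src, f), counitE_id]
  · rintro ⟨u, v⟩ h hne
    simp only [Finset.mem_filter, Finset.mem_univ, true_and] at h
    rw [counitE_of_ne, TensorProduct.zero_tmul]
    rintro a rfl
    obtain ⟨rfl, rfl⟩ := (IsComp.id_left_iff _).1 h
    exact hne rfl
  · intro h
    exact absurd (by simpa using IsComp.id_comp f) h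

theorem sum_counitE_right {M : Type*} [AddCommGroup M] [Module K M] (F : Arr π → M) (f : Arr π) :
    (open scoped Classical in ∑ q : Arr π × Arr π with IsComp q.1 q.2 f,
      (F q.1 ⊗ₜ[K] counitE K q.2 : M ⊗[K] ConvAlg K π)) = F f ⊗ₜ[K] single K (Arr.id f.tgt) := by
  classical
  rw [Finset.sum_eq_single (f, Arr.id f.tgt), counitE_id]
  · rintro ⟨u, v⟩ h hne
    simp only [Finset.mem_filter, Finset.mem_univ, true_and] at h
    rw [counitE_of_ne, TensorProduct.tmul_zero]
    rintro a rfl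
    obtain ⟨rfl, rfl⟩ := (IsComp.id_right_iff _).1 h
    exact hne rfl
  · intro h
    exact absurd (by simpa using IsComp.comp_id f) h

/-- The counit axiom in its graded form: on the component of a square, `(ε ⊗ id) ∘ Δ` splits off
the left side of the square. -/
theorem IsComul.counit_left {Δ : 𝔸 →ₗ[K] 𝔸 ⊗[K] 𝔸} {ε : 𝔸 →ₗ[K] ConvAlg K π} (hΔ : IsComul Δ)
    (hε : IsCounit ε) {α : Sq π} {a : 𝔸} (ha : a ∈ 𝒜 α) :
    ε.rTensor 𝔸 (Δ a) = single K α.left ⊗ₜ[K] a := by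
  classical
  have hmul (a b : 𝔸) : ε.rTensor 𝔸 (Δ (a * b)) = ε.rTensor 𝔸 (Δ a) * ε.rTensor 𝔸 (Δ b) := by
    rw [hΔ.mul, rTensor_mul_of_mul (C := ConvAlg K π) hε.mul]
  have he (f : Arr π) : ε.rTensor 𝔸 (Δ (𝕖 f)) = single K (Arr.id f.src) ⊗ₜ[K] 𝕖 f := by
    simp only [hΔ.map_e, map_sum, LinearMap.rTensor_tmul, hε.map_e]
    exact sum_counitE_left 𝕖 f
  have key : ∀ {α a}, IsMonomial 𝕘 Gen.degree α a →
      ε.rTensor 𝔸 (Δ a) = single K α.left ⊗ₜ[K] a := fun h => by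
    induction h with
    | gen x =>
      cases x with
      | e f => exact he f
      | xi s f n m =>
        simp only [hΔ.map_xi, map_sum, LinearMap.rTensor_tmul, hε.map_xi, TensorProduct.ite_tmul]
        refine (Finset.sum_congr rfl fun q _ => sum_antidiagonal_ite_left n m fun _ _ i j =>
          counitE K q.1 ⊗ₜ[K] 𝕘 (.xi s q.2 i j)).trans ?_
        exact sum_counitE_left (fun g => 𝕘 (.xi s g n m)) f
      | T x y α n m =>
        have hT : ε.rTensor 𝔸 (Δ (𝕋 x y n m)) = single K (deg x) ⊗ₜ[K] 𝕋 x y n m := by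
          simp only [hΔ.map_T, map_sum, LinearMap.rTensor_tmul, hε.map_T, counitT,
      TensorProduct.ite_tmul]
          refine (Finset.sum_congr rfl fun z _ => sum_antidiagonal_ite_left n m fun _ _ i j =>
            if x = z then single K (deg x) ⊗ₜ[K] 𝕋 z y i j else 0).trans ?_
          simp
        obtain ⟨α, h1, h2⟩ := α
        have e1 : IsComp (Arr.id α.top.src) (deg x) (deg x) :=
          (IsComp.id_left_iff _).2 ⟨rfl, by rw [← h1, α.top_src]⟩
        have e2 : IsComp (deg x) (Arr.id α.bot.src) (deg x) :=
          (IsComp.id_right_iff _).2 ⟨rfl, by rw [← h1, α.bot_src]⟩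
        rw [gen_T, hmul, hmul, he, he, hT, single_mul_of_isComp _ e1, single_mul_of_isComp _ e2]
        exact congrArg (fun u => single K u ⊗ₜ[K] _) h1.symm
    | mul h _ _ h1 h2 => rw [hmul, h1, h2, single_mul_of_isComp _ h.2.2.2.1]
  exact component_induction (p := fun a => ε.rTensor 𝔸 (Δ a) = single K α.left ⊗ₜ[K] a) (by simp)
    (fun a b ha hb => by rw [map_add, map_add, ha, hb, TensorProduct.tmul_add])
    (fun k a ha => by rw [map_smul, map_smul, ha, TensorProduct.tmul_smul]) (fun a => key) ha

/-- On the component of a square, `(id ⊗ ε) ∘ Δ` splits off the right side of the square. -/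
theorem IsComul.counit_right {Δ : 𝔸 →ₗ[K] 𝔸 ⊗[K] 𝔸} {ε : 𝔸 →ₗ[K] ConvAlg K π} (hΔ : IsComul Δ)
    (hε : IsCounit ε) {α : Sq π} {a : 𝔸} (ha : a ∈ 𝒜 α) :
    ε.lTensor 𝔸 (Δ a) = a ⊗ₜ[K] single K α.right := by
  classical
  have hmul (a b : 𝔸) : ε.lTensor 𝔸 (Δ (a * b)) = ε.lTensor 𝔸 (Δ a) * ε.lTensor 𝔸 (Δ b) := by
    rw [hΔ.mul, lTensor_mul_of_mul (C := ConvAlg K π) hε.mul]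
  have hs {u v w : Arr π} (h : IsComp u v w) (a b : 𝔸) :
      (a ⊗ₜ[K] single K u) * (b ⊗ₜ[K] single K v) = (a * b) ⊗ₜ[K] single K w := by
    rw [Algebra.TensorProduct.tmul_mul_tmul, single_mul_single h]
  have he (f : Arr π) : ε.lTensor 𝔸 (Δ (𝕖 f)) = 𝕖 f ⊗ₜ[K] single K (Arr.id f.tgt) := by
    simp only [hΔ.map_e, map_sum, LinearMap.lTensor_tmul, hε.map_e]
    exact sum_counitE_right 𝕖 f
  have key : ∀ {α a}, IsMonomial 𝕘 Gen.degree α a →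
      ε.lTensor 𝔸 (Δ a) = a ⊗ₜ[K] single K α.right := fun h => by
    induction h with
    | gen x =>
      cases x with
      | e f => exact he f
      | xi s f n m =>
        simp only [hΔ.map_xi, map_sum, LinearMap.lTensor_tmul, hε.map_xi, TensorProduct.tmul_ite]
        refine (Finset.sum_congr rfl fun q _ => sum_antidiagonal_ite_right n m fun i j _ _ =>
          𝕘 (.xi s q.1 i j) ⊗ₜ[K] counitE K q.2).trans ?_
        exact sum_counitE_right (fun g => 𝕘 (.xi s g n m)) f
      | T x y α n m =>
        have hT : ε.lTensor 𝔸 (Δ (𝕋 x y n m)) = 𝕋 x y n m ⊗ₜ[K] single K (deg y) := by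
          simp only [hΔ.map_T, map_sum, LinearMap.lTensor_tmul, hε.map_T, counitT,
      TensorProduct.tmul_ite]
          refine (Finset.sum_congr rfl fun z _ => sum_antidiagonal_ite_right n m fun i j _ _ =>
            if z = y then 𝕋 x z i j ⊗ₜ[K] single K (deg z) else 0).trans ?_
          simp
        obtain ⟨α, h1, h2⟩ := α
        have e1 : IsComp (Arr.id α.top.tgt) (deg y) (deg y) :=
          (IsComp.id_left_iff _).2 ⟨rfl, by rw [← h2, α.top_tgt]⟩
        have e2 : IsComp (deg y) (Arr.id α.bot.tgt) (deg y) :=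
          (IsComp.id_right_iff _).2 ⟨rfl, by rw [← h2, α.bot_tgt]⟩
        rw [gen_T, hmul, hmul, he, he, hT, hs e1, hs e2]
        exact congrArg (fun u => _ ⊗ₜ[K] single K u) h2.symm
    | mul h _ _ h1 h2 => rw [hmul, h1, h2, hs h.2.2.2.2]
  exact component_induction (p := fun a => ε.lTensor 𝔸 (Δ a) = a ⊗ₜ[K] single K α.right) (by simp)
    (fun a b ha hb => by rw [map_add, map_add, ha, hb, TensorProduct.add_tmul])
    (fun k a ha => by rw [map_smul, map_smul, ha, TensorProduct.smul_tmul']) (fun a => key) ha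

end

end


section

variable {K π B : Type*} [Groupoid π] [Finite π] [∀ a b : π, Finite (a ⟶ b)]
    [Fintype B] [CommRing K] [Algebra ℂ K] {deg : B → Arr π}
    {L lam : ℂ} {r : ℕ → ℕ → Matrix (B × B) (B × B) ℂ} {ωc σc : ℕ → Matrix B B ℂ}

local notation "𝔸" => QAlg K deg L lam r ωc σc
local notation "𝕘" => gen K deg L lam r ωc σc
local notation "𝕖" => genE K deg L lam r ωc σc
local notation "𝕏" => genX K deg L lam r ωc σc
local notation "𝕋" => genT K deg L lam r ωc σc
local notation "𝒜" => component K deg L lam r ωc σc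

open ConvAlg

/-- Evaluation at an arrow. -/
def ConvAlg.eval (u : Arr π) : ConvAlg K π →ₗ[K] K := LinearMap.proj u

open scoped Classical in
theorem ConvAlg.eval_single (u v : Arr π) :
    ConvAlg.eval u (single K v) = if v = u then 1 else 0 :=
  (single_apply v u).trans (if_congr eq_comm rfl rfl)

/-- The components of the quantum algebra can be separated: the counit axiom detects the vertical
sides of a square, and the idempotents `e f` its horizontal sides. -/
theorem exists_proj_component {Δ : 𝔸 →ₗ[K] 𝔸 ⊗[K] 𝔸} {ε : 𝔸 →ₗ[K] ConvAlg K π} (hΔ : IsComul Δ)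
    (hε : IsCounit ε) (α : Sq π) : ∃ P : 𝔸 →ₗ[K] 𝔸, (∀ a ∈ 𝒜 α, P a = a) ∧
      ∀ β, β ≠ α → ∀ a ∈ 𝒜 β, P a = 0 := by
  classical
  let pl : 𝔸 →ₗ[K] 𝔸 := (TensorProduct.lid K 𝔸).toLinearMap ∘ₗ
    (ConvAlg.eval α.left ∘ₗ ε).rTensor 𝔸 ∘ₗ Δ
  let pr : 𝔸 →ₗ[K] 𝔸 := (TensorProduct.rid K 𝔸).toLinearMap ∘ₗ
    (ConvAlg.eval α.right ∘ₗ ε).lTensor 𝔸 ∘ₗ Δ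
  have hpl : ∀ β, ∀ a ∈ 𝒜 β, pl a = if β.left = α.left then a else 0 := fun β a ha => by
    simp only [pl, LinearMap.rTensor_comp, LinearMap.comp_apply, hΔ.counit_left hε ha,
      LinearMap.rTensor_tmul, ConvAlg.eval_single, LinearEquiv.coe_coe, TensorProduct.lid_tmul]
    split_ifs <;> simp
  have hpr : ∀ β, ∀ a ∈ 𝒜 β, pr a = if β.right = α.right then a else 0 := fun β a ha => by
    simp only [pr, LinearMap.lTensor_comp, LinearMap.comp_apply, hΔ.counit_right hε ha,
      LinearMap.lTensor_tmul, ConvAlg.eval_single, LinearEquiv.coe_coe, TensorProduct.rid_tmul]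
    split_ifs <;> simp
  have ht : ∀ β, ∀ a ∈ 𝒜 β, 𝕖 α.top * a = if β.top = α.top then a else 0 := fun β a ha => by
    split_ifs with h
    · rw [← h, component_unit_mul ha]
    · rw [← component_unit_mul ha, ← mul_assoc, genE_orth _ _ (Ne.symm h), zero_mul]
  have hb : ∀ β, ∀ a ∈ 𝒜 β, a * 𝕖 α.bot = if β.bot = α.bot then a else 0 := fun β a ha => by
    split_ifs with h
    · rw [← h, component_mul_unit ha]
    · rw [← component_mul_unit ha, mul_assoc, genE_orth _ _ h, mul_zero]
  have key : ∀ β, ∀ a ∈ 𝒜 β, pl (pr (𝕖 α.top * (a * 𝕖 α.bot))) = if β = α then a else 0 :=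
    fun β a ha => by
      rw [hb β a ha]
      by_cases h1 : β.bot = α.bot
      · rw [if_pos h1, ht β a ha]
        by_cases h2 : β.top = α.top
        · rw [if_pos h2, hpr β a ha]
          by_cases h3 : β.right = α.right
          · rw [if_pos h3, hpl β a ha]
            exact if_congr ⟨fun h4 => Sq.ext h4 h3 h2 h1, fun h => by rw [h]⟩ rfl rfl
          · rw [if_neg h3, map_zero, if_neg fun h => h3 (by rw [h])]
        · rw [if_neg h2, map_zero, map_zero, if_neg fun h => h2 (by rw [h])]
      · rw [if_neg h1, mul_zero, map_zero, map_zero, if_neg fun h => h1 (by rw [h])]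
  refine ⟨pl ∘ₗ pr ∘ₗ LinearMap.mulLeft K (𝕖 α.top) ∘ₗ LinearMap.mulRight K (𝕖 α.bot),
    fun a ha => (key α a ha).trans (if_pos rfl), fun β h a ha => (key β a ha).trans (if_neg h)⟩

open scoped Classical in
theorem isInternal_component {Δ : 𝔸 →ₗ[K] 𝔸 ⊗[K] 𝔸} {ε : 𝔸 →ₗ[K] ConvAlg K π} (hΔ : IsComul Δ)
    (hε : IsCounit ε) : DirectSum.IsInternal 𝒜 := by
  refine DirectSum.isInternal_submodule_of_iSupIndep_of_iSup_eq_top ?_ iSup_component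
  refine iSupIndep_def.2 fun α => Submodule.disjoint_def.2 fun a ha ha' => ?_
  obtain ⟨P, h1, h2⟩ := exists_proj_component hΔ hε α
  have : ⨆ β, ⨆ (_ : β ≠ α), 𝒜 β ≤ LinearMap.ker P :=
    iSup_le fun β => iSup_le fun h a ha => h2 β h a ha
  rw [← h1 a ha]
  exact this ha'

theorem isGradedAlgebra {Δ : 𝔸 →ₗ[K] 𝔸 ⊗[K] 𝔸} {ε : 𝔸 →ₗ[K] ConvAlg K π} (hΔ : IsComul Δ)
    (hε : IsCounit ε) : IsGradedAlgebra K 𝒜 𝕖 where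
  isInternal := isInternal_component hΔ hε
  mul_mem _ _ _ h _ ha _ hb := component_mul_mem h ha hb
  mul_eq_zero _ _ h _ ha _ hb := component_mul_eq_zero h ha hb
  unit_mem := genE_mem_component
  unit_mul _ _ ha := component_unit_mul ha
  mul_unit _ _ ha := component_mul_unit ha

/-- The sum of the values of a function on arrows. -/
noncomputable def ConvAlg.total (K π : Type*) [Groupoid π] [Finite π] [∀ a b : π, Finite (a ⟶ b)]
    [CommRing K] : ConvAlg K π →ₗ[K] K := sumArr K π

theorem ConvAlg.total_single (u : Arr π) : ConvAlg.total K π (single K u) = 1 := by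
  classical
  have : ConvAlg.total K π (single K u) = ∑ v, single K u v :=
    LinearMap.sum_apply Finset.univ (fun v : Arr π => (LinearMap.proj v : (Arr π → K) →ₗ[K] K)) _
  rw [this]
  simp [single_apply]

/-- The functions on arrows supported at the arrows `u` with `α = Sq.idH u`. -/
def counitSupport (K : Type*) [CommRing K] (α : Sq π) : Submodule K (ConvAlg K π) where
  carrier := {f | ∀ u, α ≠ Sq.idH u → f u = 0}
  add_mem' {f g} hf hg u hu := by rw [ConvAlg.add_apply, hf u hu, hg u hu, add_zero]
  zero_mem' _ _ := rfl
  smul_mem' k f hf u hu := by rw [ConvAlg.smul_apply, hf u hu, mul_zero]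

theorem single_mem_counitSupport (u : Arr π) : single K u ∈ counitSupport K (Sq.idH u) :=
  fun v hv => by
    classical
    rw [single_apply, if_neg]
    rintro rfl
    exact hv rfl

theorem counitE_mem_counitSupport (f : Arr π) : counitE K f ∈ counitSupport K (Sq.idV f) := by
  by_cases h : ∃ a, f = Arr.id a
  · obtain ⟨a, rfl⟩ := h
    rw [counitE_id]
    exact single_mem_counitSupport (Arr.id a)
  · rw [counitE_of_ne (by simpa using h)]
    exact zero_mem _

/-- The squares `Sq.idH u` compose vertically like the arrows `u`. -/
theorem mul_mem_counitSupport {α β γ : Sq π} (h : Sq.VComp α β γ) {f g : ConvAlg K π}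
    (hf : f ∈ counitSupport K α) (hg : g ∈ counitSupport K β) : f * g ∈ counitSupport K γ := by
  classical
  intro w hw
  rw [ConvAlg.mul_apply]
  refine Finset.sum_eq_zero fun q hq => ?_
  by_cases h1 : α = Sq.idH q.1
  · rw [hg q.2 ?_, mul_zero]
    intro h2
    have hq' := (Finset.mem_filter.1 hq).2
    obtain ⟨-, h4, h5, h6, h7⟩ := h
    rw [h1] at h4 h6 h7
    rw [h2] at h5 h6 h7
    refine hw (Sq.ext (h6.unique hq') (h7.unique hq') (h4.trans ?_) (h5.trans ?_))
    · exact congrArg Arr.id hq'.src_eq.symm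
    · exact congrArg Arr.id hq'.tgt_eq.symm
  · rw [hf q.1 h1, zero_mul]

theorem IsCounit.map_mem {ε : 𝔸 →ₗ[K] ConvAlg K π} (hε : IsCounit ε) {α : Sq π} {a : 𝔸}
    (ha : a ∈ 𝒜 α) : ε a ∈ counitSupport K α := by
  classical
  refine map_mem_of_gen ε (counitSupport K) (fun x => ?_) (fun α β γ a b h ha hb => ?_) ha
  · cases x with
    | e f =>
      rw [hε.map_e]
      exact counitE_mem_counitSupport f
    | xi s f n m =>
      rw [hε.map_xi]
      split_ifs
      · exact counitE_mem_counitSupport f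
      · exact zero_mem _
    | T x y α n m =>
      obtain ⟨α, h1, h2⟩ := α
      rw [gen_T, hε.mul, hε.mul, hε.map_e, hε.map_e, hε.map_T, counitT]
      by_cases h0 : (n = 0 ∧ m = 0) ∧ x = y
      · obtain ⟨h0, rfl⟩ := h0
        rw [if_pos h0, if_pos rfl, counitE_mul_single]
        split_ifs with h3
        · rw [single_mul_counitE]
          split_ifs with h4
          · have : α = Sq.idH (deg x) := Sq.ext h1 h2 h3 h4
            subst this
            exact single_mem_counitSupport (deg x)
          · exact zero_mem _
        · rw [zero_mul]
          exact zero_mem _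
      · have : (if n = 0 ∧ m = 0 then (if x = y then single K (deg x) else 0) else 0) = 0 := by
          split_ifs with h1 h2
          · exact absurd ⟨h1, h2⟩ h0
          · rfl
          · rfl
        rw [this, mul_zero, zero_mul]
        exact zero_mem _
  · rw [hε.mul]
    exact mul_mem_counitSupport h ha hb

theorem IsComul.total_left {Δ : 𝔸 →ₗ[K] 𝔸 ⊗[K] 𝔸} {ε : 𝔸 →ₗ[K] ConvAlg K π} (hΔ : IsComul Δ)
    (hε : IsCounit ε) : (TensorProduct.lid K 𝔸).toLinearMap ∘ₗ
      (ConvAlg.total K π ∘ₗ ε).rTensor 𝔸 ∘ₗ Δ = LinearMap.id :=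
  linearMap_ext_component fun α a ha => by
    rw [LinearMap.comp_apply, LinearMap.comp_apply, LinearMap.rTensor_comp_apply,
      hΔ.counit_left hε ha, LinearMap.rTensor_tmul, ConvAlg.total_single, LinearEquiv.coe_coe,
      TensorProduct.lid_tmul, one_smul, LinearMap.id_apply]

theorem IsComul.total_right {Δ : 𝔸 →ₗ[K] 𝔸 ⊗[K] 𝔸} {ε : 𝔸 →ₗ[K] ConvAlg K π} (hΔ : IsComul Δ)
    (hε : IsCounit ε) : (TensorProduct.rid K 𝔸).toLinearMap ∘ₗ
      (ConvAlg.total K π ∘ₗ ε).lTensor 𝔸 ∘ₗ Δ = LinearMap.id :=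
  linearMap_ext_component fun α a ha => by
    rw [LinearMap.comp_apply, LinearMap.comp_apply, LinearMap.lTensor_comp_apply,
      hΔ.counit_right hε ha, LinearMap.lTensor_tmul, ConvAlg.total_single, LinearEquiv.coe_coe,
      TensorProduct.rid_tmul, one_smul, LinearMap.id_apply]

theorem isGradedCoalgebra {Δ : 𝔸 →ₗ[K] 𝔸 ⊗[K] 𝔸} {ε : 𝔸 →ₗ[K] ConvAlg K π} (hΔ : IsComul Δ)
    (hε : IsCounit ε) : IsGradedCoalgebra 𝒜 Δ (ε : 𝔸 →ₗ[K] (Arr π → K)) where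
  comul_mem _ _ ha := hΔ.map_mem ha
  counit_mem _ _ ha := hε.map_mem ha
  coassoc := hΔ.coassoc
  counit_left := hΔ.total_left hε
  counit_right := hΔ.total_right hε

end


/-! ### The antipode is bijective and preserves the grading -/

section

variable {K A : Type*} [CommRing K] [Algebra ℂ K] [Ring A] [Algebra K A]

/-- A linear map applied to the coefficients of a power series. -/
def mapCoeff {σ : Type*} (S : A →ₗ[K] A) (φ : MvPowerSeries σ A) : MvPowerSeries σ A :=
  fun d => S (MvPowerSeries.coeff d φ)

theorem coeff_mapCoeff {σ : Type*} (S : A →ₗ[K] A) (φ : MvPowerSeries σ A) (d : σ →₀ ℕ) :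
    MvPowerSeries.coeff d (mapCoeff S φ) = S (MvPowerSeries.coeff d φ) := rfl

theorem mapCoeff_mul {σ : Type*} {S : A →ₗ[K] A} (hS : ∀ a b, S (a * b) = S b * S a)
    (φ ψ : MvPowerSeries σ A) : mapCoeff S (φ * ψ) = mapCoeff S ψ * mapCoeff S φ := by
  classical
  ext d
  rw [MvPowerSeries.coeff_mul, coeff_mapCoeff, MvPowerSeries.coeff_mul, map_sum]
  simp only [hS]
  exact Finsupp.sum_antidiagonal_swap d fun a b =>
    S (MvPowerSeries.coeff b ψ) * S (MvPowerSeries.coeff a φ)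

theorem mapCoeff_sum {σ ι : Type*} (S : A →ₗ[K] A) (s : Finset ι) (φ : ι → MvPowerSeries σ A) :
    mapCoeff S (∑ i ∈ s, φ i) = ∑ i ∈ s, mapCoeff S (φ i) := by
  ext d
  simp only [coeff_mapCoeff, map_sum]

theorem mapCoeff_shiftHom (S : A →ₗ[K] A) (L c : ℂ) (φ : MvPowerSeries (Fin 2) A) :
    mapCoeff S (shiftHom K L c φ) = shiftHom K L c (mapCoeff S φ) := by
  ext d
  rw [coeff_shiftHom, coeff_mapCoeff, coeff_shiftHom, map_smul, coeff_mapCoeff]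

theorem mapCoeff_serMat {B : Type*} {S : A →ₗ[K] A} (hS : S 1 = 1) (c : ℕ → Matrix B B ℂ) (x y : B) :
    mapCoeff S (serMat K A c x y) = serMat K A c x y := by
  ext d
  rw [coeff_mapCoeff, serMat, coeff_serP]
  split_ifs
  · rw [← mul_one (scal K A _), scal_smul, map_smul, hS]
  · exact map_zero S

/-- An antimultiplicative map is compatible with twisting by central series. -/
theorem mapCoeff_twist {B : Type*} [Fintype B] {S : A →ₗ[K] A} (hS : ∀ a b, S (a * b) = S b * S a)
    {ζ : MvPowerSeries (Fin 2) A} {c d M : Matrix B B (MvPowerSeries (Fin 2) A)}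
    (hζ : ∀ w, mapCoeff S ζ * w = w * mapCoeff S ζ) (hc : ∀ x y w, c x y * w = w * c x y)
    (hd : ∀ x y w, d x y * w = w * d x y) (hSc : ∀ x y, mapCoeff S (c x y) = c x y)
    (hSd : ∀ x y, mapCoeff S (d x y) = d x y) :
    (twist ζ c d M).map (mapCoeff S) = twist (mapCoeff S ζ) c d (M.map (mapCoeff S)) := by
  ext1 x y
  simp only [Matrix.map_apply, twist_apply, mapCoeff_mul hS, mapCoeff_sum, hSc, hSd]
  rw [hζ]
  congr 1
  refine Finset.sum_congr rfl fun k _ => Finset.sum_congr rfl fun l _ => ?_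
  rw [hd, ← hc]

end

section

variable {K π B : Type*} [Groupoid π] [Finite π] [∀ a b : π, Finite (a ⟶ b)]
    [Fintype B] [CommRing K] [Algebra ℂ K] {deg : B → Arr π}
    {L lam : ℂ} {r : ℕ → ℕ → Matrix (B × B) (B × B) ℂ} {ωc σc : ℕ → Matrix B B ℂ}

local notation "𝔸" => QAlg K deg L lam r ωc σc
local notation "𝕘" => gen K deg L lam r ωc σc
local notation "𝕖" => genE K deg L lam r ωc σc
local notation "𝕏" => genX K deg L lam r ωc σc
local notation "𝕋" => genT K deg L lam r ωc σc
local notation "𝒜" => component K deg L lam r ωc σc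

/-- `S` is antimultiplicative with `S(e f) = e f⁻¹`, `S(ξ^±_f) = ξ^∓_{f⁻¹}` and
`S(T_x^y(u)) = M x y`. -/
structure IsAnti (M : Matrix B B (MvPowerSeries (Fin 2) 𝔸)) (S : 𝔸 →ₗ[K] 𝔸) : Prop where
  mul : ∀ a b, S (a * b) = S b * S a
  map_e : ∀ f, S (𝕖 f) = 𝕖 f.inv
  map_xi : ∀ s f n m, S (𝕘 (.xi s f n m)) = 𝕘 (.xi (!s) f.inv n m)
  map_X : ∀ s n m, S (𝕏 s n m) = 𝕏 (!s) n m
  map_T : ∀ x y n m, S (𝕋 x y n m) = unser (M x y) n m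

/-- Homomorphisms to the opposite algebra are antimultiplicative maps. -/
theorem exists_isAnti {M : Matrix B B (MvPowerSeries (Fin 2) 𝔸)}
    (h : IsRep K deg L lam r ωc σc (fun f => MulOpposite.op (𝕖 f.inv))
      (fun s n m => MulOpposite.op (𝕏 (!s) n m))
      (fun x y n m => MulOpposite.op (unser (M x y) n m))) :
    ∃ S : 𝔸 →ₗ[K] 𝔸, IsAnti M S := by
  obtain ⟨φ, h1, h2, h3, h4⟩ := h.exists_hom'
  refine ⟨(MulOpposite.opLinearEquiv K).symm.toLinearMap ∘ₗ (φ : 𝔸 →ₗ[K] 𝔸ᵐᵒᵖ),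
    fun a b => congrArg MulOpposite.unop (map_mul φ a b),
    fun f => congrArg MulOpposite.unop (h1 f), fun s f n m => ?_,
    fun s n m => congrArg MulOpposite.unop (h3 s n m),
    fun x y n m => congrArg MulOpposite.unop (h4 x y n m)⟩
  refine (congrArg MulOpposite.unop (h2 s f n m)).trans ?_
  rw [gen_xi, ← genX_comm]
  rfl

theorem IsAnti.map_one {M : Matrix B B (MvPowerSeries (Fin 2) 𝔸)} {S : 𝔸 →ₗ[K] 𝔸}
    (h : IsAnti M S) : S 1 = 1 := by
  rw [← genE_sum, map_sum]
  simp only [h.map_e]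
  exact (Arr.invEquiv π).sum_comp 𝕖

theorem IsAnti.mapCoeff_serT {M : Matrix B B (MvPowerSeries (Fin 2) 𝔸)} {S : 𝔸 →ₗ[K] 𝔸}
    (h : IsAnti M S) : (serT 𝕋).map (mapCoeff S) = M := by
  ext1 x y
  rw [← ser_unser (M x y)]
  exact congrArg ser (funext fun n => funext fun m => h.map_T x y n m)

theorem IsAnti.mapCoeff_ser_X {M : Matrix B B (MvPowerSeries (Fin 2) 𝔸)} {S : 𝔸 →ₗ[K] 𝔸}
    (h : IsAnti M S) (s : Bool) : mapCoeff S (ser (𝕏 s)) = ser (𝕏 (!s)) :=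
  congrArg ser (funext fun n => funext fun m => h.map_X s n m)

theorem IsAnti.map_twist {M : Matrix B B (MvPowerSeries (Fin 2) 𝔸)} {S : 𝔸 →ₗ[K] 𝔸}
    (h : IsAnti M S) (s t : ℂ) {c d : Matrix B B (MvPowerSeries (Fin 2) 𝔸)}
    (hc : ∀ x y w, c x y * w = w * c x y)
    (hd : ∀ x y w, d x y * w = w * d x y) (hSc : ∀ x y, mapCoeff S (c x y) = c x y)
    (hSd : ∀ x y, mapCoeff S (d x y) = d x y) :
    (twist (shiftHom K L s (ser (𝕏 false))) c d ((serT 𝕋).map (shiftHom K L t))).map (mapCoeff S) =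
      twist (shiftHom K L s (ser (𝕏 true))) c d (M.map (shiftHom K L t)) := by
  have e : mapCoeff S (shiftHom K L s (ser (𝕏 false))) = shiftHom K L s (ser (𝕏 true)) := by
    rw [mapCoeff_shiftHom, h.mapCoeff_ser_X]
    rfl
  rw [mapCoeff_twist h.mul (by rw [e]; exact shift_X_comm genX_comm true s) hc hd hSc hSd, e]
  congr 1
  rw [← h.mapCoeff_serT]
  ext1 x y
  exact mapCoeff_shiftHom S L t _

/-- Antimultiplicative maps whose composite is the identity on `T_x^y` are inverse to each other. -/
theorem IsAnti.comp_eq_id {M M' : Matrix B B (MvPowerSeries (Fin 2) 𝔸)} {S S' : 𝔸 →ₗ[K] 𝔸}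
    (h : IsAnti M S) (h' : IsAnti M' S') (hM : M.map (mapCoeff S') = serT 𝕋) (a : 𝔸) :
    S' (S a) = a := by
  induction a using qalg_induction with
  | h0 => rw [map_zero, map_zero]
  | hadd a b ha hb => rw [map_add, map_add, ha, hb]
  | hsmul k a ha => rw [map_smul, map_smul, ha]
  | hmul a b ha hb => rw [h.mul, h'.mul, ha, hb]
  | he f => rw [h.map_e, h'.map_e, Arr.inv_inv]
  | hxi s f n m => rw [h.map_xi, h'.map_xi, Arr.inv_inv, Bool.not_not]
  | hT x y n m =>
    rw [h.map_T]
    exact congrArg (fun N : Matrix B B (MvPowerSeries (Fin 2) 𝔸) => unser (N x y) n m) hM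

/-- The antipode and the map built from `antiInvT` are inverse to each other, as the twists that
define them are. -/
theorem bijective_of_isAnti {S S' : 𝔸 →ₗ[K] 𝔸} (h : IsAnti (antiT K L lam ωc σc 𝕏 𝕋) S)
    (h' : IsAnti (antiInvT K L lam ωc σc 𝕏 𝕋) S')
    (hωσ : ∀ [DecidableEq B], matP K 𝔸 ωc * matP K 𝔸 σc = 1)
    (hσω : ∀ [DecidableEq B], matP K 𝔸 σc * matP K 𝔸 ωc = 1) : Function.Bijective S := by
  classical
  have hT : (matP K 𝔸 ωc).transpose * (matP K 𝔸 σc).transpose = 1 := by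
    rw [← transpose_mul_of_comm (matP_comm σc), hσω, Matrix.transpose_one]
  have hXX (s : Bool) : ser (𝕏 s) * ser (𝕏 (!s)) = 1 := isRep_gen.ser_X_mul genE_sum s
  have h0 (s : Bool) : shiftHom K L 0 (ser (𝕏 s)) = ser (𝕏 s) := shiftHom_zero L _
  refine ⟨Function.LeftInverse.injective (h.comp_eq_id h' ?_),
    Function.RightInverse.surjective (h'.comp_eq_id h ?_)⟩
  · rw [antiT, h'.map_twist (-lam) (-lam) (matP_comm ωc) (matP_comm σc)
      (mapCoeff_serMat h'.map_one ωc) (mapCoeff_serMat h'.map_one σc), antiInvT, twist_map,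
      Matrix.transpose_map, Matrix.transpose_map, matP_map_shiftHom, matP_map_shiftHom,
      map_shiftHom_map, neg_add_cancel, map_shiftHom_zero]
    refine twist_twist (shift_X_comm genX_comm _ _) ?_ (matP_comm ωc) (matP_comm σc) hωσ
    rw [← map_mul]
    exact (congrArg _ (hXX true)).trans (_root_.map_one _)
  · have := h.map_twist 0 lam (c := (matP K 𝔸 ωc).transpose) (d := (matP K 𝔸 σc).transpose)
      (fun x y => matP_comm ωc y x) (fun x y => matP_comm σc y x)
      (fun x y => mapCoeff_serMat h.map_one ωc y x) (fun x y => mapCoeff_serMat h.map_one σc y x)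
    rw [h0, h0] at this
    rw [antiInvT, this, antiT, twist_map, matP_map_shiftHom, matP_map_shiftHom, map_shiftHom_map,
      add_neg_cancel, map_shiftHom_zero, shiftHom_add, add_neg_cancel, h0]
    exact twist_twist (c := (matP K 𝔸 ωc).transpose) (d := (matP K 𝔸 σc).transpose)
      (ser_X_comm genX_comm _) (hXX true) (fun x y => matP_comm ωc y x)
      (fun x y => matP_comm σc y x) hT

theorem coeff_mul_mem {P : Submodule K 𝔸} {ζ φ : MvPowerSeries (Fin 2) 𝔸}
    (hζ : ∀ d, ∀ a ∈ P, MvPowerSeries.coeff d ζ * a ∈ P)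
    (hφ : ∀ d, MvPowerSeries.coeff d φ ∈ P) (d : Fin 2 →₀ ℕ) :
    MvPowerSeries.coeff d (ζ * φ) ∈ P := by
  classical
  rw [MvPowerSeries.coeff_mul]
  exact sum_mem fun e _ => hζ _ _ (hφ _)

theorem coeff_matP_mul_mem {P : Submodule K 𝔸} (c : ℕ → Matrix B B ℂ) (x y : B)
    (d : Fin 2 →₀ ℕ) (a : 𝔸) (ha : a ∈ P) : MvPowerSeries.coeff d (matP K 𝔸 c x y) * a ∈ P := by
  rw [matP, Matrix.of_apply, serMat, coeff_serP]
  split_ifs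
  · rw [scal_smul]
    exact P.smul_mem _ ha
  · rw [zero_mul]
    exact zero_mem P

/-- The antipode sends the component of a square to the component of its double inverse. -/
theorem IsAnti.map_mem {S : 𝔸 →ₗ[K] 𝔸} (h : IsAnti (antiT K L lam ωc σc 𝕏 𝕋) S)
    (hω : GradedForm deg ωc) (hσ : GradedForm deg σc) {α : Sq π} {a : 𝔸} (ha : a ∈ 𝒜 α) :
    S a ∈ 𝒜 α.iota := by
  have hid (f : Arr π) : (Sq.idV f).iota = Sq.idV f.inv :=
    Sq.ext (Arr.id_inv _) (Arr.id_inv _) rfl rfl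
  refine map_mem_of_gen S (fun α => 𝒜 α.iota) (fun x => ?_) (fun α β γ a b hγ ha hb => ?_) ha
  · cases x with
    | e f =>
      rw [h.map_e]
      exact (hid f).symm ▸ genE_mem_component f.inv
    | xi s f n m =>
      rw [h.map_xi]
      exact (hid f).symm ▸ genXi_mem_component _ f.inv n m
    | T x y α n m =>
      obtain ⟨α, h1, h2⟩ := α
      rw [gen_T, h.mul, h.mul, h.map_e, h.map_e, h.map_T, ← mul_assoc]
      change 𝕖 α.bot.inv * unser _ n m * 𝕖 α.top.inv ∈ 𝒜 α.iota
      have key (d : Fin 2 →₀ ℕ) : MvPowerSeries.coeff d (MvPowerSeries.C (𝕖 α.bot.inv) *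
          antiT K L lam ωc σc 𝕏 𝕋 x y * MvPowerSeries.C (𝕖 α.top.inv)) ∈ 𝒜 α.iota := by
        rw [antiT, mul_twist_mul (shift_X_comm genX_comm _ _) (matP_comm _) (matP_comm _)]
        refine coeff_mul_mem (fun d a ha => ?_) (fun d => ?_) d
        · rw [coeff_shiftHom, coeff_ser, smul_mul_assoc]
          exact Submodule.smul_mem _ _ (genX_mul_mem_component _ _ _ ha)
        · rw [map_sum]
          refine sum_mem fun k _ => ?_
          rw [map_sum]
          refine sum_mem fun l _ => ?_
          rw [← matP_comm]
          by_cases hl : deg l = (deg x).inv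
          · by_cases hk : deg y = (deg k).inv
            · refine coeff_mul_mem (coeff_matP_mul_mem _ _ _) (fun d =>
                coeff_mul_mem (coeff_matP_mul_mem _ _ _) (fun d => ?_) d) d
              rw [MvPowerSeries.coeff_mul_C, MvPowerSeries.coeff_C_mul, Matrix.map_apply,
                coeff_shiftHom, mul_smul_comm, smul_mul_assoc]
              refine Submodule.smul_mem _ _ (genE_mul_genT_mul_genE_mem_component ?_ ?_ rfl rfl)
              · refine (congrArg Arr.inv (h2.trans hk)).trans (Arr.inv_inv _)
              · exact (congrArg Arr.inv h1).trans hl.symm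
            · rw [hσ.matP_eq_zero hk, zero_mul, map_zero]
              exact zero_mem _
          · rw [hω.matP_eq_zero hl, zero_mul, mul_zero, map_zero]
            exact zero_mem _
      have := key (Finsupp.equivFunOnFinite.symm ![n, m])
      rwa [MvPowerSeries.coeff_mul_C, MvPowerSeries.coeff_C_mul] at this
  · rw [h.mul]
    exact component_mul_mem hγ.iota hb ha

end


/-! ### The antipode axioms -/

open Finset.HasAntidiagonal

section

variable {K A : Type*} [CommRing K] [Ring A] [Algebra K A]

/-- The map `x ⊗ y ↦ x z S(y)`. -/
noncomputable def mulRightAnti (S : A →ₗ[K] A) (z : A) : A ⊗[K] A →ₗ[K] A :=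
  LinearMap.mul' K A ∘ₗ (LinearMap.mulRight K z).rTensor A ∘ₗ S.lTensor A

/-- The map `x ⊗ y ↦ S(x) z y`. -/
noncomputable def mulLeftAnti (S : A →ₗ[K] A) (z : A) : A ⊗[K] A →ₗ[K] A :=
  LinearMap.mul' K A ∘ₗ (LinearMap.mulRight K z).rTensor A ∘ₗ S.rTensor A

theorem mulRightAnti_tmul (S : A →ₗ[K] A) (z x y : A) :
    mulRightAnti S z (x ⊗ₜ[K] y) = x * z * S y := by simp [mulRightAnti]

theorem mulLeftAnti_tmul (S : A →ₗ[K] A) (z x y : A) :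
    mulLeftAnti S z (x ⊗ₜ[K] y) = S x * z * y := by simp [mulLeftAnti]

/-- Multiplying into the middle turns `x ⊗ y ↦ x z S(y)` into a left action of `A ⊗ A` on `z`. -/
theorem mulRightAnti_mul {S : A →ₗ[K] A} (hS : ∀ a b, S (a * b) = S b * S a) (z : A)
    (X Y : A ⊗[K] A) : mulRightAnti S z (X * Y) = mulRightAnti S (mulRightAnti S z Y) X := by
  induction X with
  | zero => simp
  | add X X' h h' => rw [add_mul, map_add, h, h', map_add]
  | tmul a b =>
    induction Y with
    | zero => simp [mulRightAnti_tmul]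
    | add Y Y' h h' =>
      rw [mul_add, map_add, h, h', map_add]
      simp only [mulRightAnti_tmul, mul_add, add_mul]
    | tmul a' b' =>
      simp only [Algebra.TensorProduct.tmul_mul_tmul, mulRightAnti_tmul, hS, mul_assoc]

/-- Multiplying into the middle turns `x ⊗ y ↦ S(x) z y` into a right action of `A ⊗ A` on `z`. -/
theorem mulLeftAnti_mul {S : A →ₗ[K] A} (hS : ∀ a b, S (a * b) = S b * S a) (z : A)
    (X Y : A ⊗[K] A) : mulLeftAnti S z (X * Y) = mulLeftAnti S (mulLeftAnti S z X) Y := by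
  induction Y with
  | zero => simp
  | add Y Y' h h' => rw [mul_add, map_add, h, h', map_add]
  | tmul a' b' =>
    induction X with
    | zero => simp [mulLeftAnti_tmul]
    | add X X' h h' =>
      rw [add_mul, map_add, h, h', map_add]
      simp only [mulLeftAnti_tmul, mul_add, add_mul]
    | tmul a b =>
      simp only [Algebra.TensorProduct.tmul_mul_tmul, mulLeftAnti_tmul, hS, mul_assoc]

theorem mulRightAnti_sum {ι : Type*} (S : A →ₗ[K] A) (s : Finset ι) (k : ι → K) (z : ι → A)
    (X : A ⊗[K] A) : mulRightAnti S (∑ i ∈ s, k i • z i) X =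
      ∑ i ∈ s, k i • mulRightAnti S (z i) X := by
  induction X with
  | zero => simp
  | add X X' h h' => simp only [map_add, h, h', smul_add, Finset.sum_add_distrib]
  | tmul a b => simp [mulRightAnti_tmul, Finset.mul_sum, Finset.sum_mul]

theorem mulLeftAnti_sum {ι : Type*} (S : A →ₗ[K] A) (s : Finset ι) (k : ι → K) (z : ι → A)
    (X : A ⊗[K] A) : mulLeftAnti S (∑ i ∈ s, k i • z i) X =
      ∑ i ∈ s, k i • mulLeftAnti S (z i) X := by
  induction X with
  | zero => simp
  | add X X' h h' => simp only [map_add, h, h', smul_add, Finset.sum_add_distrib]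
  | tmul a b => simp [mulLeftAnti_tmul, Finset.mul_sum, Finset.sum_mul]

end

section

variable {K π A : Type*} [Groupoid π] [Finite π] [∀ a b : π, Finite (a ⟶ b)] [CommRing K]
  [Ring A] [Algebra K A]

open scoped Classical in
/-- The sum of `f u • Q (source of u)` over the arrows `u` with target `c`: the action of `f` on
families indexed by objects, along arrows against their direction. -/
noncomputable def sumInto (Q : π → A) (c : π) (f : ConvAlg K π) : A :=
  ∑ u : Arr π, (if u.tgt = c then f u else 0) • Q u.src

open scoped Classical in
/-- The sum of `f u • Q (target of u)` over the arrows `u` with source `c`: the action of `f` on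
families indexed by objects, along arrows in their direction. -/
noncomputable def sumOutOf (Q : π → A) (c : π) (f : ConvAlg K π) : A :=
  ∑ u : Arr π, (if u.src = c then f u else 0) • Q u.tgt

variable (Q : π → A) (c : π) (f g : ConvAlg K π)

theorem sumInto_add : sumInto Q c (f + g) = sumInto Q c f + sumInto Q c g := by
  classical
  simp only [sumInto, ← Finset.sum_add_distrib, ← add_smul, ConvAlg.add_apply]
  exact Finset.sum_congr rfl fun u _ => by split_ifs <;> simp

theorem sumOutOf_add : sumOutOf Q c (f + g) = sumOutOf Q c f + sumOutOf Q c g := by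
  classical
  simp only [sumOutOf, ← Finset.sum_add_distrib, ← add_smul, ConvAlg.add_apply]
  exact Finset.sum_congr rfl fun u _ => by split_ifs <;> simp

theorem sumInto_smul (k : K) : sumInto Q c (k • f) = k • sumInto Q c f := by
  classical
  simp only [sumInto, Finset.smul_sum, smul_smul, ConvAlg.smul_apply, mul_ite, mul_zero]

theorem sumOutOf_smul (k : K) : sumOutOf Q c (k • f) = k • sumOutOf Q c f := by
  classical
  simp only [sumOutOf, Finset.smul_sum, smul_smul, ConvAlg.smul_apply, mul_ite, mul_zero]

theorem sumInto_zero : sumInto Q c (0 : ConvAlg K π) = 0 := by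
  simp [sumInto, ConvAlg.zero_apply]

theorem sumOutOf_zero : sumOutOf Q c (0 : ConvAlg K π) = 0 := by
  simp [sumOutOf, ConvAlg.zero_apply]

open scoped Classical in
theorem sumInto_single (u : Arr π) : sumInto Q c (ConvAlg.single K u) =
    if u.tgt = c then Q u.src else 0 := by
  rw [sumInto, Finset.sum_eq_single u]
  · rw [ConvAlg.single_apply, if_pos rfl, ite_smul, one_smul, zero_smul]
  · intro v _ hv
    rw [ConvAlg.single_apply, if_neg hv, ite_self, zero_smul]
  · simp

open scoped Classical in
theorem sumOutOf_single (u : Arr π) : sumOutOf Q c (ConvAlg.single K u) =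
    if u.src = c then Q u.tgt else 0 := by
  rw [sumOutOf, Finset.sum_eq_single u]
  · rw [ConvAlg.single_apply, if_pos rfl, ite_smul, one_smul, zero_smul]
  · intro v _ hv
    rw [ConvAlg.single_apply, if_neg hv, ite_self, zero_smul]
  · simp

open scoped Classical in
/-- Acting by a product is acting by its factors in turn. -/
theorem sumInto_mul : sumInto Q c (f * g) =
    ∑ v : Arr π, (if v.tgt = c then g v else 0) • sumInto Q v.src f := by
  have := sum_isComp (fun u v => (f u * g v) • Q u.src) (p := fun w => w.tgt = c)
    (p' := fun _ v => v.tgt = c) fun u v w h => by rw [h.tgt_eq]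
  calc _ = ∑ w : Arr π with w.tgt = c, ∑ q : Arr π × Arr π with IsComp q.1 q.2 w,
        (f q.1 * g q.2) • Q q.1.src := by
        rw [sumInto, Finset.sum_filter]
        refine Finset.sum_congr rfl fun w _ => ?_
        split_ifs
        · rw [ConvAlg.mul_apply, Finset.sum_smul]
          refine Finset.sum_congr rfl fun q hq => ?_
          rw [(Finset.mem_filter.1 hq).2.src_eq]
        · rw [zero_smul]
    _ = _ := by
        rw [this, Finset.sum_comm]
        refine Finset.sum_congr rfl fun v _ => ?_
        rw [sumInto, Finset.smul_sum]
        refine Finset.sum_congr rfl fun u _ => ?_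
        by_cases h1 : v.tgt = c <;> by_cases h2 : u.tgt = v.src <;>
          simp [h1, h2, smul_smul, mul_comm]

open scoped Classical in
/-- Acting by a product is acting by its factors in turn. -/
theorem sumOutOf_mul : sumOutOf Q c (f * g) =
    ∑ u : Arr π, (if u.src = c then f u else 0) • sumOutOf Q u.tgt g := by
  have := sum_isComp (fun u v => (f u * g v) • Q v.tgt) (p := fun w => w.src = c)
    (p' := fun u _ => u.src = c) fun u v w h => by rw [h.src_eq]
  calc _ = ∑ w : Arr π with w.src = c, ∑ q : Arr π × Arr π with IsComp q.1 q.2 w,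
        (f q.1 * g q.2) • Q q.2.tgt := by
        rw [sumOutOf, Finset.sum_filter]
        refine Finset.sum_congr rfl fun w _ => ?_
        split_ifs
        · rw [ConvAlg.mul_apply, Finset.sum_smul]
          refine Finset.sum_congr rfl fun q hq => ?_
          rw [(Finset.mem_filter.1 hq).2.tgt_eq]
        · rw [zero_smul]
    _ = _ := by
        rw [this]
        refine Finset.sum_congr rfl fun u _ => ?_
        rw [sumOutOf, Finset.smul_sum]
        refine Finset.sum_congr rfl fun v _ => ?_
        rw [eq_comm (a := v.src)]
        by_cases h1 : u.src = c <;> by_cases h2 : u.tgt = v.src <;> simp [h1, h2, smul_smul]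

end

section

variable {K π B : Type*} [Groupoid π] [Finite π] [∀ a b : π, Finite (a ⟶ b)]
    [Fintype B] [CommRing K] [Algebra ℂ K] {deg : B → Arr π}
    {L lam : ℂ} {r : ℕ → ℕ → Matrix (B × B) (B × B) ℂ} {ωc σc : ℕ → Matrix B B ℂ}

local notation "𝔸" => QAlg K deg L lam r ωc σc
local notation "𝕘" => gen K deg L lam r ωc σc
local notation "𝕖" => genE K deg L lam r ωc σc
local notation "𝕏" => genX K deg L lam r ωc σc
local notation "𝕋" => genT K deg L lam r ωc σc

theorem sum_genX_mul_genX (s : Bool) (n m : ℕ) : ∑ a ∈ antidiagonal n, ∑ b ∈ antidiagonal m,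
    𝕏 s a.1 b.1 * 𝕏 (!s) a.2 b.2 = if n = 0 ∧ m = 0 then 1 else 0 := by
  have h : ser (𝕏 s) * ser (𝕏 (!s)) = 1 := isRep_gen.ser_X_mul genE_sum s
  rw [ser_mul_ser, ← _root_.map_one (MvPowerSeries.C (σ := Fin 2)), ← ser_const] at h
  exact congrFun (congrFun (ser_injective h) n) m

theorem genE_mul_srcSum (f : Arr π) (c : π) : 𝕖 f * srcSum 𝕖 c =
    open scoped Classical in if f.src = c then 𝕖 f else 0 := by
  classical
  simp [srcSum, Finset.mul_sum, orth_ite genE_mul_self genE_orth]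

theorem genE_mul_tgtSum (f : Arr π) (c : π) : 𝕖 f * tgtSum 𝕖 c =
    open scoped Classical in if f.tgt = c then 𝕖 f else 0 := by
  classical
  simp [tgtSum, Finset.mul_sum, orth_ite genE_mul_self genE_orth]

/-- The antipode axiom on a unit `e f`, with `srcSum 𝕖 c` inserted: only decompositions `f = g g⁻¹`
contribute, and so `f` has to be an identity. -/
theorem sum_genE_mul_inv_right (f : Arr π) (c : π) : (open scoped Classical in
    ∑ q : Arr π × Arr π with IsComp q.1 q.2 f, 𝕖 q.1 * srcSum 𝕖 c * 𝕖 q.2.inv) =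
      sumInto (srcSum 𝕖) c (counitE K f) := by
  classical
  have key : ∀ q : Arr π × Arr π, 𝕖 q.1 * srcSum 𝕖 c * 𝕖 q.2.inv =
      if q.1.src = c ∧ q.2 = q.1.inv then 𝕖 q.1 else 0 := fun q => by
    rw [genE_mul_srcSum, ite_mul, zero_mul, orth_ite genE_mul_self genE_orth, ite_and]
    refine if_congr Iff.rfl (if_congr ⟨fun h => ?_, fun h => ?_⟩ rfl rfl) rfl
    · rw [h, Arr.inv_inv]
    · rw [h, Arr.inv_inv]
  simp only [key]
  rw [Finset.sum_filter, Fintype.sum_prod_type]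
  have e (g : Arr π) : (∑ g', if IsComp g g' f then (if g.src = c ∧ g' = g.inv then 𝕖 g else 0)
      else 0) = if f = Arr.id g.src ∧ g.src = c then 𝕖 g else 0 := by
    rw [Finset.sum_eq_single g.inv]
    · by_cases h : f = Arr.id g.src
      · simp [h, IsComp.inv_right g]
      · rw [if_neg fun h' => h (h'.unique (IsComp.inv_right g)), if_neg fun h' => h h'.1]
    · intro g' _ hg'
      simp [hg']
    · simp
  simp only [e]
  by_cases hf : ∃ a, f = Arr.id a
  · obtain ⟨a, rfl⟩ := hf
    rw [counitE_id, sumInto_single, srcSum, Finset.sum_filter]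
    change _ = if a = c then ∑ g, (if g.src = a then 𝕖 g else 0) else 0
    split_ifs with h
    · subst h
      refine Finset.sum_congr rfl fun g _ => if_congr ⟨fun h => h.2, fun h => ⟨by rw [h], h⟩⟩ rfl rfl
    · refine Finset.sum_eq_zero fun g _ => if_neg fun h' => h ?_
      rw [← h'.2]
      exact Arr.id_injective h'.1
  · rw [counitE_of_ne (by simpa using hf), sumInto_zero]
    exact Finset.sum_eq_zero fun g _ => if_neg fun h => hf ⟨_, h.1⟩

theorem sum_genE_mul_inv_left (f : Arr π) (c : π) : (open scoped Classical in
    ∑ q : Arr π × Arr π with IsComp q.1 q.2 f, 𝕖 q.1.inv * tgtSum 𝕖 c * 𝕖 q.2) =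
      sumOutOf (tgtSum 𝕖) c (counitE K f) := by
  classical
  have key : ∀ q : Arr π × Arr π, 𝕖 q.1.inv * tgtSum 𝕖 c * 𝕖 q.2 =
      if q.2.tgt = c ∧ q.1 = q.2.inv then 𝕖 q.2 else 0 := fun q => by
    rw [genE_mul_tgtSum, ite_mul, zero_mul, orth_ite genE_mul_self genE_orth]
    by_cases h : q.1 = q.2.inv
    · simp [h, Arr.inv_inv]
    · have h' : q.1.inv ≠ q.2 := fun h' => h (by rw [← h', Arr.inv_inv])
      simp [h, h']
  simp only [key]
  rw [Finset.sum_filter, Fintype.sum_prod_type, Finset.sum_comm]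
  have e (g : Arr π) : (∑ g', if IsComp g' g f then (if g.tgt = c ∧ g' = g.inv then 𝕖 g else 0)
      else 0) = if f = Arr.id g.tgt ∧ g.tgt = c then 𝕖 g else 0 := by
    rw [Finset.sum_eq_single g.inv]
    · by_cases h : f = Arr.id g.tgt
      · simp [h, IsComp.inv_left g]
      · rw [if_neg fun h' => h (h'.unique (IsComp.inv_left g)), if_neg fun h' => h h'.1]
    · intro g' _ hg'
      simp [hg']
    · simp
  simp only [e]
  by_cases hf : ∃ a, f = Arr.id a
  · obtain ⟨a, rfl⟩ := hf
    rw [counitE_id, sumOutOf_single, tgtSum, Finset.sum_filter]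
    change _ = if a = c then ∑ g, (if g.tgt = a then 𝕖 g else 0) else 0
    split_ifs with h
    · subst h
      refine Finset.sum_congr rfl fun g _ => if_congr ⟨fun h => h.2, fun h => ⟨by rw [h], h⟩⟩ rfl rfl
    · refine Finset.sum_eq_zero fun g _ => if_neg fun h' => h ?_
      rw [← h'.2]
      exact Arr.id_injective h'.1
  · rw [counitE_of_ne (by simpa using hf), sumOutOf_zero]
    exact Finset.sum_eq_zero fun g _ => if_neg fun h => hf ⟨_, h.1⟩

/-- The coefficient form of a matrix identity `M * N = diagonal`. -/
theorem sum_coeff_of_mul_eq_diagonal [DecidableEq B] {M N : B → B → ℕ → ℕ → 𝔸} {p : B → 𝔸}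
    (h : serT M * serT N = Matrix.diagonal fun x => MvPowerSeries.C (p x)) (x y : B) (n m : ℕ) :
    ∑ z, ∑ a ∈ antidiagonal n, ∑ b ∈ antidiagonal m, M x z a.1 b.1 * N z y a.2 b.2 =
      if n = 0 ∧ m = 0 then (if x = y then p x else 0) else 0 := by
  have h1 : ser (fun n m => ∑ z, ∑ a ∈ antidiagonal n, ∑ b ∈ antidiagonal m,
      M x z a.1 b.1 * N z y a.2 b.2) = ser fun n m => if n = 0 ∧ m = 0 then
        (if x = y then p x else 0) else 0 := by
    rw [ser_sum, ser_const]
    simp only [← ser_mul_ser]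
    refine (congrFun (congrFun h x) y).trans ?_
    rw [Matrix.diagonal_apply]
    split_ifs <;> simp
  exact congrFun (congrFun (ser_injective h1) n) m

open scoped Classical in
/-- The right antipode axiom with `srcSum 𝕖 c` inserted in the middle.  In this form it is
compatible with products, since inserting elements is an action of `A ⊗ A`, so that it can be
checked on generators. -/
theorem IsAnti.mul_right_unit {Δ : 𝔸 →ₗ[K] 𝔸 ⊗[K] 𝔸} {ε : 𝔸 →ₗ[K] ConvAlg K π} {S : 𝔸 →ₗ[K] 𝔸}
    {M : Matrix B B (MvPowerSeries (Fin 2) 𝔸)} (hΔ : IsComul Δ) (hε : IsCounit ε)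
    (h : IsAnti M S)
    (hM : serT 𝕋 * M = Matrix.diagonal fun x => MvPowerSeries.C (srcSum 𝕖 (deg x).src)) (a : 𝔸) :
    ∀ c, mulRightAnti S (srcSum 𝕖 c) (Δ a) = sumInto (srcSum 𝕖) c (ε a) := by
  induction a using qalg_induction with
  | h0 => simp [sumInto_zero]
  | hadd a b ha hb => intro c; rw [map_add, map_add, ha, hb, map_add, sumInto_add]
  | hsmul k a ha => intro c; rw [map_smul, map_smul, ha, map_smul, sumInto_smul]
  | hmul a b ha hb =>
    intro c
    rw [hΔ.mul, mulRightAnti_mul h.mul, hb, hε.mul, sumInto_mul, sumInto, mulRightAnti_sum]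
    simp only [ha]
  | he f =>
    intro c
    rw [hΔ.map_e, map_sum, hε.map_e, ← sum_genE_mul_inv_right]
    simp only [mulRightAnti_tmul, h.map_e]
  | hxi s f n m =>
    intro c
    have e (q : Arr π × Arr π) (i j k l : ℕ) : 𝕘 (.xi s q.1 i j) * srcSum 𝕖 c *
        S (𝕘 (.xi s q.2 k l)) = 𝕖 q.1 * srcSum 𝕖 c * 𝕖 q.2.inv * (𝕏 s i j * 𝕏 (!s) k l) := by
      rw [h.map_xi, gen_xi, gen_xi, mul_assoc (𝕖 _) (𝕏 _ _ _), genX_comm, mul_assoc, mul_assoc,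
        ← mul_assoc (𝕏 _ _ _) (𝕖 _), genX_comm _ _ _ (𝕖 _)]
      simp only [mul_assoc]
    rw [hΔ.map_xi, map_sum, hε.map_xi]
    simp only [map_sum, mulRightAnti_tmul, e, ← Finset.mul_sum, ← Finset.sum_mul,
      sum_genX_mul_genX]
    rw [sum_genE_mul_inv_right]
    split_ifs
    · rw [mul_one]
    · rw [mul_zero, sumInto_zero]
  | hT x y n m =>
    intro c
    rw [hΔ.map_T, hε.map_T, counitT]
    have hM' : serT 𝕋 * serT (fun z y => unser (M z y)) =
        Matrix.diagonal fun x => MvPowerSeries.C (srcSum 𝕖 (deg x).src) := by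
      rw [← hM]
      congr 1
      ext1 z y
      exact ser_unser _
    have hs := sum_coeff_of_mul_eq_diagonal hM' x y n m
    simp only [map_sum, mulRightAnti_tmul, h.map_T, isRep_gen.T_mul_srcSum, ite_mul, zero_mul]
    by_cases hc : c = (deg x).tgt
    · simp only [if_pos hc]
      rw [hs]
      split_ifs
      · rw [sumInto_single, if_pos hc.symm]
      · rw [sumInto_zero]
      · rw [sumInto_zero]
    · simp only [if_neg hc, Finset.sum_const_zero]
      split_ifs
      · rw [sumInto_single, if_neg (Ne.symm hc)]
      · rw [sumInto_zero]
      · rw [sumInto_zero]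

open scoped Classical in
/-- The left antipode axiom with `tgtSum 𝕖 c` inserted in the middle, which is compatible with
products. -/
theorem IsAnti.mul_left_unit {Δ : 𝔸 →ₗ[K] 𝔸 ⊗[K] 𝔸} {ε : 𝔸 →ₗ[K] ConvAlg K π} {S : 𝔸 →ₗ[K] 𝔸}
    {M : Matrix B B (MvPowerSeries (Fin 2) 𝔸)} (hΔ : IsComul Δ) (hε : IsCounit ε)
    (h : IsAnti M S)
    (hM : M * serT 𝕋 = Matrix.diagonal fun x => MvPowerSeries.C (tgtSum 𝕖 (deg x).tgt)) (a : 𝔸) :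
    ∀ c, mulLeftAnti S (tgtSum 𝕖 c) (Δ a) = sumOutOf (tgtSum 𝕖) c (ε a) := by
  induction a using qalg_induction with
  | h0 => simp [sumOutOf_zero]
  | hadd a b ha hb => intro c; rw [map_add, map_add, ha, hb, map_add, sumOutOf_add]
  | hsmul k a ha => intro c; rw [map_smul, map_smul, ha, map_smul, sumOutOf_smul]
  | hmul a b ha hb =>
    intro c
    rw [hΔ.mul, mulLeftAnti_mul h.mul, ha, hε.mul, sumOutOf_mul, sumOutOf, mulLeftAnti_sum]
    simp only [hb]
  | he f =>
    intro c
    rw [hΔ.map_e, map_sum, hε.map_e, ← sum_genE_mul_inv_left]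
    simp only [mulLeftAnti_tmul, h.map_e]
  | hxi s f n m =>
    intro c
    have e (q : Arr π × Arr π) (i j k l : ℕ) : S (𝕘 (.xi s q.1 i j)) * tgtSum 𝕖 c *
        𝕘 (.xi s q.2 k l) = 𝕖 q.1.inv * tgtSum 𝕖 c * 𝕖 q.2 * (𝕏 s k l * 𝕏 (!s) i j) := by
      rw [h.map_xi, gen_xi, gen_xi, ← genX_comm (!s)]
      simp only [mul_assoc]
      rw [genX_comm (!s)]
      simp only [mul_assoc]
    rw [hΔ.map_xi, map_sum, hε.map_xi]
    have hX : ∑ a ∈ antidiagonal n, ∑ b ∈ antidiagonal m, 𝕏 s a.2 b.2 * 𝕏 (!s) a.1 b.1 =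
        if n = 0 ∧ m = 0 then 1 else 0 := by
      simp only [genX_comm s]
      have := sum_genX_mul_genX (K := K) (L := L) (lam := lam) (r := r) (ωc := ωc) (σc := σc)
        (deg := deg) (!s) n m
      rwa [Bool.not_not] at this
    simp only [map_sum, mulLeftAnti_tmul, e, ← Finset.mul_sum, ← Finset.sum_mul, hX]
    rw [sum_genE_mul_inv_left]
    split_ifs
    · rw [mul_one]
    · rw [mul_zero, sumOutOf_zero]
  | hT x y n m =>
    intro c
    rw [hΔ.map_T, hε.map_T, counitT]
    have hM' : serT (fun z y => unser (M z y)) * serT 𝕋 =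
        Matrix.diagonal fun x => MvPowerSeries.C (tgtSum 𝕖 (deg x).tgt) := by
      rw [← hM]
      congr 1
      ext1 z y
      exact ser_unser _
    have hs := sum_coeff_of_mul_eq_diagonal hM' x y n m
    simp only [map_sum, mulLeftAnti_tmul, h.map_T, mul_assoc, isRep_gen.tgtSum_mul_T, mul_ite,
      mul_zero]
    by_cases hc : c = (deg y).src
    · simp only [if_pos hc]
      rw [hs]
      split_ifs with h1 h2
      · rw [sumOutOf_single, if_pos (by rw [hc, h2])]
      · rw [sumOutOf_zero]
      · rw [sumOutOf_zero]
    · simp only [if_neg hc, Finset.sum_const_zero]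
      split_ifs with h1 h2
      · rw [sumOutOf_single, if_neg (by rw [h2]; exact Ne.symm hc)]
      · rw [sumOutOf_zero]
      · rw [sumOutOf_zero]

/-- The unit is the sum over all objects `c` of the units `e f` with source `c`. -/
theorem sum_srcSum [Fintype π] : ∑ c, srcSum 𝕖 c = 1 := by
  classical
  rw [← genE_sum]
  simp only [srcSum, Finset.sum_filter]
  rw [Finset.sum_comm]
  simp

theorem sum_tgtSum [Fintype π] : ∑ c, tgtSum 𝕖 c = 1 := by
  classical
  rw [← genE_sum]
  simp only [tgtSum, Finset.sum_filter]
  rw [Finset.sum_comm]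
  simp

open scoped Classical in
/-- The axiom is the sum over `c` of the identities with `srcSum 𝕖 c` inserted. -/
theorem IsAnti.mul_antipode_right {Δ : 𝔸 →ₗ[K] 𝔸 ⊗[K] 𝔸} {ε : 𝔸 →ₗ[K] ConvAlg K π}
    {S : 𝔸 →ₗ[K] 𝔸} {M : Matrix B B (MvPowerSeries (Fin 2) 𝔸)} (hΔ : IsComul Δ)
    (hε : IsCounit ε) (h : IsAnti M S)
    (hM : serT 𝕋 * M = Matrix.diagonal fun x => MvPowerSeries.C (srcSum 𝕖 (deg x).src)) (a : 𝔸) :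
    LinearMap.mul' K 𝔸 (S.lTensor 𝔸 (Δ a)) = ∑ u : Arr π, ε a u • srcSum 𝕖 u.src := by
  have := Fintype.ofFinite π
  have h1 : LinearMap.mul' K 𝔸 (S.lTensor 𝔸 (Δ a)) = mulRightAnti S 1 (Δ a) := by
    rw [mulRightAnti, LinearMap.mulRight_one]
    simp
  have h2 := mulRightAnti_sum S Finset.univ (fun _ : π => 1) (srcSum 𝕖) (Δ a)
  simp only [one_smul, sum_srcSum, h.mul_right_unit hΔ hε hM] at h2
  rw [h1, h2]
  simp only [sumInto, ite_smul, zero_smul]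
  rw [Finset.sum_comm]
  simp

open scoped Classical in
theorem IsAnti.mul_antipode_left {Δ : 𝔸 →ₗ[K] 𝔸 ⊗[K] 𝔸} {ε : 𝔸 →ₗ[K] ConvAlg K π}
    {S : 𝔸 →ₗ[K] 𝔸} {M : Matrix B B (MvPowerSeries (Fin 2) 𝔸)} (hΔ : IsComul Δ)
    (hε : IsCounit ε) (h : IsAnti M S)
    (hM : M * serT 𝕋 = Matrix.diagonal fun x => MvPowerSeries.C (tgtSum 𝕖 (deg x).tgt)) (a : 𝔸) :
    LinearMap.mul' K 𝔸 (S.rTensor 𝔸 (Δ a)) = ∑ u : Arr π, ε a u • tgtSum 𝕖 u.tgt := by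
  have := Fintype.ofFinite π
  have h1 : LinearMap.mul' K 𝔸 (S.rTensor 𝔸 (Δ a)) = mulLeftAnti S 1 (Δ a) := by
    rw [mulLeftAnti, LinearMap.mulRight_one]
    simp
  have h2 := mulLeftAnti_sum S Finset.univ (fun _ : π => 1) (tgtSum 𝕖) (Δ a)
  simp only [one_smul, sum_tgtSum, h.mul_left_unit hΔ hε hM] at h2
  rw [h1, h2]
  simp only [sumOutOf, ite_smul, zero_smul]
  rw [Finset.sum_comm]
  simp

end


/-! ### The coefficients of the structure matrices -/

open Finset.HasAntidiagonal

theorem serP_mul_serP {A : Type*} [Ring A] (s t : ℕ → A) :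
    serP s * serP t = serP fun k => ∑ q ∈ antidiagonal k, s q.1 * t q.2 := by
  have h (s : ℕ → A) : serP s = ser fun n m => if n = m then s n else 0 := rfl
  rw [h s, h t, h, ser_mul_ser]
  congr 1
  ext n m
  have key (a : ℕ × ℕ) (ha : a ∈ antidiagonal n) : (∑ b ∈ antidiagonal m,
      (if a.1 = b.1 then s a.1 else 0) * if a.2 = b.2 then t a.2 else 0) =
        if n = m then s a.1 * t a.2 else 0 := by
    rw [mem_antidiagonal] at ha
    split_ifs with hnm
    · rw [Finset.sum_eq_single a]
      · simp
      · intro b _ hb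
        by_cases h1 : a.1 = b.1
        · rw [if_neg (c := a.2 = b.2) fun h2 => hb (Prod.ext h1.symm h2.symm), mul_zero]
        · rw [if_neg h1, zero_mul]
      · exact fun h => absurd (mem_antidiagonal.2 (ha.trans hnm)) h
    · refine Finset.sum_eq_zero fun b hb => ?_
      rw [mem_antidiagonal] at hb
      by_cases h1 : a.1 = b.1
      · rw [if_neg (c := a.2 = b.2) fun h2 => hnm (by rw [← ha, ← hb, h1, h2]), mul_zero]
      · rw [if_neg h1, zero_mul]
  rw [Finset.sum_congr rfl key]
  split_ifs <;> simp

section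

variable {K π B : Type*} [Groupoid π] [Finite π] [∀ a b : π, Finite (a ⟶ b)]
    [Fintype B] [CommRing K] [Algebra ℂ K] {deg : B → Arr π}
    {L lam : ℂ} {r : ℕ → ℕ → Matrix (B × B) (B × B) ℂ} {ωc σc : ℕ → Matrix B B ℂ}

/-- Matrices of series whose Cauchy product is the identity are inverse to each other over `A`. -/
theorem matP_mul_matP {A : Type*} [Ring A] [Algebra K A] [DecidableEq B]
    (h : ∀ k i j, ∑ l, ∑ q ∈ antidiagonal k, ωc q.1 i l * σc q.2 l j =
      if i = j ∧ k = 0 then 1 else 0) : matP K A ωc * matP K A σc = 1 := by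
  ext1 i j
  have h1 : ∑ l, serP (fun k => ωc k i l) * serP (fun k => σc k l j) =
      if i = j then 1 else 0 := by
    ext d
    simp only [serP_mul_serP, map_sum, coeff_serP]
    by_cases hd : d 0 = d 1
    · simp only [if_pos hd, h]
      have hd' : d = 0 ↔ d 0 = 0 :=
        ⟨fun h => by rw [h]; rfl, fun h => by ext k; fin_cases k; exacts [h, hd ▸ h]⟩
      by_cases hij : i = j <;> simp [hij, MvPowerSeries.coeff_one, hd']
    · have hd' : d ≠ 0 := fun h => hd (by rw [h]; rfl)
      simp only [if_neg hd, Finset.sum_const_zero]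
      split_ifs
      · rw [MvPowerSeries.coeff_one, if_neg hd']
      · simp
  simp only [Matrix.mul_apply, matP, Matrix.of_apply, serMat_eq_map, ← map_mul, ← map_sum, h1,
    Matrix.one_apply]
  split_ifs <;> simp

theorem IsInnerProduct.inv_graded [DecidableEq B] {ω : Matrix B B ℂ} (h : IsInnerProduct deg ω)
    {x y : B} (hxy : deg y ≠ (deg x).inv) : ω⁻¹ x y = 0 := by
  classical
  -- cutting `ω⁻¹` down to pairs of inverse degrees gives a right inverse of `ω`
  let W : Matrix B B ℂ := Matrix.of fun x y => if deg y = (deg x).inv then ω⁻¹ x y else 0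
  have hW : ω * W = 1 := by
    ext x y
    by_cases hyx : deg y = deg x
    · rw [← Matrix.mul_nonsing_inv ω h.nondegenerate, Matrix.mul_apply, Matrix.mul_apply]
      refine Finset.sum_congr rfl fun l _ => ?_
      by_cases hl : ω x l = 0
      · rw [hl, zero_mul, zero_mul]
      · have : deg y = (deg l).inv := by rw [h.graded x l hl, Arr.inv_inv, hyx]
        simp only [W, Matrix.of_apply, if_pos this]
    · rw [Matrix.mul_apply, Matrix.one_apply, if_neg fun h => hyx (by rw [h])]
      refine Finset.sum_eq_zero fun l _ => ?_
      by_cases hl : ω x l = 0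
      · rw [hl, zero_mul]
      · have : deg y ≠ (deg l).inv := by rwa [h.graded x l hl, Arr.inv_inv]
        simp only [W, Matrix.of_apply, if_neg this, mul_zero]
  rw [Matrix.inv_eq_right_inv hW]
  exact if_neg hxy

theorem HasExpansion.gradedR [DecidableEq B] {R : UpperHalfPlane → ℂ → Matrix (B × B) (B × B) ℂ}
    (hL : L ≠ 0) (hr : HasExpansion L R r) (hR : ∀ τ, IsRMatrix deg (R τ)) : GradedR deg r := by
  intro n m z w x y h
  by_contra hn
  refine h (hr.coeff_eq_zero hL (fun τ u => ?_) n m)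
  by_contra h0
  exact hn ((hR τ).graded u z w x y h0)

theorem HasModularExpansion.gradedForm {M : UpperHalfPlane → Matrix B B ℂ}
    {c : ℕ → Matrix B B ℂ} (hc : HasModularExpansion M c)
    (hM : ∀ τ x y, deg y ≠ (deg x).inv → M τ x y = 0) : GradedForm deg c := by
  intro k x y h
  by_contra hn
  exact h (hc.coeff_eq_zero (fun τ => hM τ x y hn) k)

/-! ### The Hopf algebra -/

local notation "𝔸" => QAlg K deg L lam r ωc σc
local notation "𝕘" => gen K deg L lam r ωc σc
local notation "𝕖" => genE K deg L lam r ωc σc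
local notation "𝕏" => genX K deg L lam r ωc σc
local notation "𝕋" => genT K deg L lam r ωc σc
local notation "𝒜" => component K deg L lam r ωc σc

theorem isGradedHopfAlgebra {Δ : 𝔸 →ₗ[K] 𝔸 ⊗[K] 𝔸} {ε : 𝔸 →ₗ[K] ConvAlg K π}
    {S S' : 𝔸 →ₗ[K] 𝔸} (hΔ : IsComul Δ) (hε : IsCounit ε)
    (hS : IsAnti (antiT K L lam ωc σc 𝕏 𝕋) S) (hS' : IsAnti (antiInvT K L lam ωc σc 𝕏 𝕋) S')
    (hω : GradedForm deg ωc) (hσ : GradedForm deg σc)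
    (hωσ : ∀ [DecidableEq B], matP K 𝔸 ωc * matP K 𝔸 σc = 1)
    (hσω : ∀ [DecidableEq B], matP K 𝔸 σc * matP K 𝔸 ωc = 1) :
    IsGradedHopfAlgebra 𝒜 𝕖 Δ (ε : 𝔸 →ₗ[K] (Arr π → K)) S := by
  classical
  exact {
    algebra := isGradedAlgebra hΔ hε
    coalgebra := isGradedCoalgebra hΔ hε
    comul_mul := hΔ.mul
    comul_unit := hΔ.map_e
    counit_mul := fun a b w => (congrFun (hε.mul a b) w).trans (ConvAlg.mul_apply _ _ _)
    counit_unit := hε.map_e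
    antipode_mem := fun α a ha => hS.map_mem hω hσ ha
    antipode_mul := hS.mul
    antipode_unit := hS.map_e
    antipode_bijective := bijective_of_isAnti hS hS' hωσ hσω
    mul_antipode_right := hS.mul_antipode_right hΔ hε
      (isRep_gen.serT_mul_antiT genE_sum genX_comm hωσ)
    mul_antipode_left := hS.mul_antipode_left hΔ hε
      (isRep_gen.antiT_mul_serT genE_sum genX_comm hω hωσ) }

theorem IsAnti.map_genT {S : 𝔸 →ₗ[K] 𝔸} (hS : IsAnti (antiT K L lam ωc σc 𝕏 𝕋) S) (x y : B)
    (d : Fin 2 →₀ ℕ) : S (𝕋 x y (d 0) (d 1)) = MvPowerSeries.coeff d (∑ x' : B, ∑ y' : B,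
      ser (shift K L (-lam) (𝕏 false)) * serP (fun k => scal K 𝔸 (ωc k x x')) *
        ser (shift K L (-lam) (𝕋 y' x')) * serP (fun k => scal K 𝔸 (σc k y' y))) := by
  have h : S (𝕋 x y (d 0) (d 1)) = MvPowerSeries.coeff d (antiT K L lam ωc σc 𝕏 𝕋 x y) := by
    rw [hS.map_T, ← ser_unser (antiT K L lam ωc σc 𝕏 𝕋 x y)]
    rfl
  rw [h, antiT, twist_apply, Finset.sum_comm, Finset.mul_sum]
  simp only [Finset.mul_sum, mul_assoc]
  rfl

theorem generatorFormulas {Δ : 𝔸 →ₗ[K] 𝔸 ⊗[K] 𝔸} {ε : 𝔸 →ₗ[K] ConvAlg K π} {S : 𝔸 →ₗ[K] 𝔸}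
    (hΔ : IsComul Δ) (hε : IsCounit ε) (hS : IsAnti (antiT K L lam ωc σc 𝕏 𝕋) S) :
    GeneratorFormulas L lam ωc σc 𝕘 Δ (ε : 𝔸 →ₗ[K] (Arr π → K)) S where
  comul_T := hΔ.map_T
  comul_xi := hΔ.map_xi
  counit_T x y n m u := by
    classical
    have h : ε (𝕋 x y n m) u = counitT K deg x y n m u := by rw [hε.map_T]
    refine h.trans ?_
    rw [counitT]
    by_cases h1 : n = 0 ∧ m = 0
    · by_cases h2 : x = y
      · rw [if_pos h1, if_pos h2, ConvAlg.single_apply]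
        exact if_congr ⟨fun h3 => ⟨h2, h3, h1⟩, fun h3 => h3.2.1⟩ rfl rfl
      · rw [if_pos h1, if_neg h2, if_neg fun h3 => h2 h3.1]
        rfl
    · rw [if_neg h1, if_neg fun h3 => h1 h3.2.2]
      rfl
  counit_xi := hε.map_xi
  antipode_T := hS.map_genT
  antipode_xi := hS.map_xi

end

end RestrictedQuantum

open RestrictedQuantum in
theorem mainTheorem3 {π B K : Type*} [Groupoid π] [Finite π] [∀ a b : π, Finite (a ⟶ b)]
    [Fintype B] [DecidableEq B] [CommRing K] [Algebra ℂ K] (deg : B → Arr π)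
    (L lam : ℂ) (hL : L ≠ 0)
    (R : UpperHalfPlane → ℂ → Matrix (B × B) (B × B) ℂ) (ω : UpperHalfPlane → Matrix B B ℂ)
    (hR : ∀ τ, IsRMatrix deg (R τ)) (hω : ∀ τ, IsInnerProduct deg (ω τ))
    (hrot : ∀ τ, IsRotationallyInvariant lam (ω τ) (R τ))
    (r : ℕ → ℕ → Matrix (B × B) (B × B) ℂ) (hr : HasExpansion L R r)
    (ωc σc : ℕ → Matrix B B ℂ) (hωc : HasModularExpansion ω ωc)
    (hσc : HasModularExpansion (fun τ => (ω τ)⁻¹) σc) :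
    ∃ (Δ : QAlg K deg L lam r ωc σc →ₗ[K]
          TensorProduct K (QAlg K deg L lam r ωc σc) (QAlg K deg L lam r ωc σc))
      (ε : QAlg K deg L lam r ωc σc →ₗ[K] (Arr π → K))
      (S : QAlg K deg L lam r ωc σc →ₗ[K] QAlg K deg L lam r ωc σc),
      IsGradedHopfAlgebra (component K deg L lam r ωc σc)
        (fun f => gen K deg L lam r ωc σc (.e f)) Δ ε S ∧
      GeneratorFormulas L lam ωc σc (gen K deg L lam r ωc σc) Δ ε S := by
  have gr : GradedR deg r := hr.gradedR hL hR
  have gω : GradedForm deg ωc := hωc.gradedForm fun τ x y hn => by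
    by_contra h
    exact hn ((hω τ).graded x y h)
  have gσ : GradedForm deg σc := hσc.gradedForm fun τ x y hn => (hω τ).inv_graded hn
  have hωσ : ∀ [DecidableEq B], matP K (QAlg K deg L lam r ωc σc) ωc *
      matP K (QAlg K deg L lam r ωc σc) σc = 1 := by
    have h := matP_mul_matP (K := K) (A := QAlg K deg L lam r ωc σc)
      (hωc.cauchyProduct_eq_one hσc fun τ => Matrix.mul_nonsing_inv _ (hω τ).nondegenerate)
    intro inst
    convert h
  have hσω : ∀ [DecidableEq B], matP K (QAlg K deg L lam r ωc σc) σc *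
      matP K (QAlg K deg L lam r ωc σc) ωc = 1 := by
    have h := matP_mul_matP (K := K) (A := QAlg K deg L lam r ωc σc)
      (hσc.cauchyProduct_eq_one hωc fun τ => Matrix.nonsing_inv_mul _ (hω τ).nondegenerate)
    intro inst
    convert h
  obtain ⟨Δ, hΔ⟩ := exists_isComul (K := K) (deg := deg) (L := L) (lam := lam) (r := r) (ωc := ωc)
    (σc := σc)
  obtain ⟨ε, hε⟩ := exists_isCounit (K := K) (L := L) (lam := lam) gr gω gσ
  obtain ⟨S, hS⟩ := exists_isAnti
    (isRep_gen.isRep_antiT (K := K) genE_sum genX_comm gr gω gσ hωσ hσω)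
  obtain ⟨S', hS'⟩ := exists_isAnti
    (isRep_gen.isRep_antiInvT (K := K) genE_sum genX_comm gr gω gσ hωσ hσω)
  exact ⟨Δ, ε, S, isGradedHopfAlgebra hΔ hε hS hS' gω gσ hωσ hσω, generatorFormulas hΔ hε hS⟩
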